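/- **Setting.** Let $n_{\mathsf T}\ge 2$, $L_s\ge 1$, $L_s\mid N_{\rm roi}$, $\eta>2$, $\lambda_E>0$, $0<\zeta<1$, $P_s,\sigma_n,B,T,b>0$, $\nu\ge 0$. In each time slot $t$ the source (at the origin) has an estimate $\hat h_{sd}$ of the legitimate fading vector; the eavesdroppers form a homogeneous Poisson point process $\Phi_E$ of density $\lambda_E$ on the plane, the $i$-th one at distance $r_i$ with fading vector $h_{se_i}$. The vectors $\hat h_{sd}$ and $h_{se_i}$ have i.i.d. $\mathcal{CN}(0,1)$ entries in $\mathbb C^{n_{\mathsf T}}$; in a slot they are independent of each other and of $\Phi_E$, and all of this is independent from slot to slot. Confidential (RoI) packets are sent in the slot if $\Psi_1:\ \|\hat h_{sd}\|^2>\nu$ holds, public ones otherwise ($\Psi_0$). With $w^{\mathsf T}=\hat h_{sd}^\dagger/\|\hat h_{sd}\|$ and $\mathbf G\in\mathbb C^{n_{\mathsf T}\times(n_{\mathsf T}-1)}$ completing $w$ to an orthonormal basis, the SINR at the $i$-th eavesdropper is $$\gamma_{E_i}=\frac{\zeta P_s r_i^{-\eta}|w^{\mathsf T}h_{se_i}|^2}{(1-\zeta)P_s\|h_{se_i}^{\mathsf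 T}\mathbf G\|^2r_i^{-\eta}/(n_{\mathsf T}-1)+\sigma_n},$$ and $\gamma_E^{\mathsf{NCE}}=\max_i\gamma_{E_i}$ (non-colluding), $\gamma_E^{\mathsf{CE}}=\sum_i\gamma_{E_i}$ (colluding). In strategy $c\in\{\mathsf{NCE},\mathsf{CE}\}$ the eavesdroppers obtain $L_s$ RoI packets in a slot if $\Psi_1$ holds and $\frac{BT}{b}\log_2(1+\gamma^c_E)\ge L_s$, and none otherwise. Let $T_E$ be the number of slots until they have obtained $N_{\rm roi}$ RoI packets. Put $\Upsilon(k,m;p)=\binom{k+m-1}{k}p^k(1-p)^m$, $\theta=2^{L_sb/(BT)}-1$, and let $$\Lambda_c=\Pr(\Psi_1)\Pr\Big\{\tfrac{BT}{b}\log_2(1+\gamma^c_E)<L_s\,\Big|\,\Psi_1\Big\}+\Pr(\Psi_0)$$ be the probability that a slot yields no RoI packet. **Proposition.** One has $\Pr(\Psi_1)=1-\Pr(\Psi_0)=e^{-\nu}\sum_{i=0}^{n_{\mathsf T}-1}\nu^i/i!$, and $\sum_i\gamma_{E_i}<\infty$ almost surely. For both strategies and all $k\ge 0$, $$\Pr(T_E\le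 k)=\sum_{l=N_{\rm roi}/L_s}^{k}\Upsilon\Big(l-\frac{N_{\rm roi}}{L_s},\frac{N_{\rm roi}}{L_s};\Lambda_c\Big).$$ (NCE) With $\beta=\pi\Gamma(1+2/\eta)$, $$\Lambda_{\mathsf{NCE}}=\Pr(\Psi_1)\exp\Big(-\beta\lambda_E\Big(\frac{\zeta P_s}{\sigma_n\theta}\Big)^{2/\eta}\Big(1+\frac{1/\zeta-1}{n_{\mathsf T}-1}\theta\Big)^{1-n_{\mathsf T}}\Big)+\Pr(\Psi_0).$$ (CE) The Laplace transform $\mathcal L(s)=\mathbb E[e^{-s\gamma_E^{\mathsf{CE}}}]$ is, for $s\ge 0$ (the exponent being read as $0$ at $s=0$), $$\mathcal L(s)=\exp\Big(-2\pi\lambda_E\mathcal B\,e^{\varsigma s/2}(a_1s)^{\frac{n_{\mathsf T}-1+2/\eta}{2}}W_{\frac{1-n_{\mathsf T}+2/\eta}{2},\frac{2-n_{\mathsf T}-2/\eta}{2}}(\varsigma s)\Big),$$ where $W$ is the Whittaker function, $a_1=\zeta P_s/\sigma_n$, $\varsigma=\zeta(n_{\mathsf T}-1)/(1-\zeta)$,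 $\varrho=(1-\zeta)\frac{P_s}{\sigma_n}/(n_{\mathsf T}-1)$, and $\mathcal B=\frac{B(2/\eta,\,1-2/\eta)}{\eta}\varrho^{(1-n_{\mathsf T}+2/\eta)/2}$ with $B(\cdot,\cdot)$ the Beta function. For $K\ge 1$ let $\varphi=K/\sqrt[K]{K!}$ and let $$\widetilde\Lambda_K=\Pr(\Psi_1)\Big[1-\sum_{k=0}^{K}\binom Kk(-1)^k\mathcal L\Big(\frac{k\varphi}{\theta}\Big)\Big]+\Pr(\Psi_0)$$ be the explicit $K$-term approximation of $\Lambda_{\mathsf{CE}}$. It approximates $\Lambda_{\mathsf{CE}}$ in the following sense. Let $\mathfrak I_K$ be a Gamma variable of shape $K$ and mean $1$, independent of $\gamma_E^{\mathsf{CE}}$, and let $\Lambda^{(K)}=\Pr(\Psi_1)\,[1-\Pr(\gamma_E^{\mathsf{CE}}>\theta\,\mathfrak I_K)]+\Pr(\Psi_0)$ be the failure probability in which the threshold $\theta$ is replaced by $\theta\,\mathfrak I_K$. Then, for every $K\ge 1$, $$\sum_{k=0}^{K}\binom Kk(-1)^k\mathcal L\Big(\frac{k\varphi}{\theta}\Big)=\mathbb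 E\Big[\big(1-e^{-\varphi\gamma_E^{\mathsf{CE}}/\theta}\big)^K\Big]\quad\text{and}\quad \Lambda^{(K)}\le\widetilde\Lambda_K,$$ while $\Lambda^{(K)}\to\Lambda_{\mathsf{CE}}$ as $K\to\infty$. Correspondingly, with $m=N_{\rm roi}/L_s$ and $T_E$ taken for the colluding strategy, for all $k\ge 0$, $$\sum_{l=m}^{k}\Upsilon(l-m,m;\widetilde\Lambda_K)\le\sum_{l=m}^{k}\Upsilon(l-m,m;\Lambda^{(K)})\ (K\ge 1),\qquad \sum_{l=m}^{k}\Upsilon(l-m,m;\Lambda^{(K)})\xrightarrow[K\to\infty]{}\Pr(T_E\le k).$$ -/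

import Mathlib

open MeasureTheory ProbabilityTheory Filter Topology
open scoped ENNReal NNReal Matrix

namespace SecureImage

noncomputable section

/-- The parameters of the transmission scheme, with their admissible ranges. -/
structure Params where
  /-- number of transmit antennas -/
  nT : ℕ
  /-- number of RoI (confidential) packets -/
  Nroi : ℕ
  /-- number of confidential packets per confidential frame -/
  Ls : ℕ
  /-- path-loss exponent -/
  eta : ℝ
  /-- density of the eavesdroppers in the plane -/
  lam : ℝ
  /-- fraction of the power given to the information-bearing signal -/
  zeta : ℝ
  /-- transmit power of confidential frames -/
  Ps : ℝ
  /-- noise power -/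
  sigma : ℝ
  /-- threshold on the estimated legitimate channel gain -/
  nu : ℝ
  /-- bandwidth -/
  B : ℝ
  /-- slot duration -/
  T : ℝ
  /-- number of bits per packet -/
  b : ℝ
  two_le_nT : 2 ≤ nT
  Ls_pos : 0 < Ls
  Ls_dvd : Ls ∣ Nroi
  two_lt_eta : 2 < eta
  lam_pos : 0 < lam
  zeta_pos : 0 < zeta
  zeta_lt_one : zeta < 1
  Ps_pos : 0 < Ps
  sigma_pos : 0 < sigma
  nu_nonneg : 0 ≤ nu
  B_pos : 0 < B
  T_pos : 0 < T
  b_pos : 0 < b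

/-- The two eavesdropping strategies: non-colluding and colluding. -/
inductive Strategy
  | nce
  | ce

/-! ### The probabilistic model -/

/-- The circularly symmetric complex normal law `CN(0,1)` on `ℂ`. -/
def stdComplexNormal : Measure ℂ :=
  volume.withDensity fun z => ENNReal.ofReal (Real.exp (-‖z‖ ^ 2) / Real.pi)

/-- The law of a vector with i.i.d. `CN(0,1)` entries. -/
def fadingLaw (n : ℕ) : Measure (Fin n → ℂ) :=
  Measure.pi fun _ => stdComplexNormal

/-- The squared `ℓ²` norm of a complex vector. -/
def sqNorm {n : ℕ} (v : Fin n → ℂ) : ℝ := ∑ j, ‖v j‖ ^ 2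

/-- The maximum ratio transmission beamformer for the channel estimate `g`: the vector `w` with
`wᵀ = g† / ‖g‖`. -/
def beam {n : ℕ} (g : Fin n → ℂ) : Fin n → ℂ :=
  fun j => star (g j) / (Real.sqrt (sqNorm g) : ℂ)

/-- The columns of `G` are orthonormal and orthogonal to `w`. If `w` is a unit vector of `ℂⁿ`, this
says that `w` and the `n - 1` columns of `G` form an orthonormal basis of `ℂⁿ`. -/
def CompletesBeam {n : ℕ} (w : Fin n → ℂ) (G : Matrix (Fin n) (Fin (n - 1)) ℂ) : Prop :=
  Gᴴ * G = 1 ∧ Gᴴ *ᵥ w = 0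

/-- The number of points of the configuration `x` (an enumerated family of points of the plane)
that lie in `A`, counted with multiplicity. -/
def pointCount (x : ℕ → EuclideanSpace ℝ (Fin 2)) (A : Set (EuclideanSpace ℝ (Fin 2))) : ℝ≥0∞ :=
  Measure.sum (fun i => Measure.dirac (x i)) A

/-- The random points `X 0, X 1, …` enumerate a homogeneous Poisson point process of density `lam`
in the plane: the number of points in a set of finite area is Poisson with mean `lam` times
the area, and the numbers of points in disjoint sets are independent. -/
structure IsHomogeneousPPP {Ω : Type*} [MeasurableSpace Ω] (P : Measure Ω) (lam : ℝ)
    (X : ℕ → Ω → EuclideanSpace ℝ (Fin 2)) : Prop where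
  measurable : ∀ i, Measurable (X i)
  law_count : ∀ A : Set (EuclideanSpace ℝ (Fin 2)), MeasurableSet A → volume A ≠ ∞ →
    HasLaw (fun ω => pointCount (fun i => X i ω) A)
      ((poissonMeasure (lam * volume.real A).toNNReal).map fun k : ℕ => (k : ℝ≥0∞)) P
  indep_count : ∀ (m : ℕ) (A : Fin m → Set (EuclideanSpace ℝ (Fin 2))),
    (∀ j, MeasurableSet (A j)) → (∀ j, volume (A j) ≠ ∞) →
    Pairwise (fun i j => Disjoint (A i) (A j)) →
    iIndepFun (fun j ω => pointCount (fun i => X i ω) (A j)) P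

/-- The random environment. In slot `t`: `g t` is the source's estimate of the legitimate fading
vector, `X t i` the location and `h t i` the fading vector of the `i`-th eavesdropper (the source
is at the origin), and `G t` the artificial-noise matrix that completes the beamformer.
Within a slot, the eavesdroppers form a homogeneous Poisson point process, all fading vectors have
i.i.d. `CN(0,1)` entries, and locations and fading vectors are independent; distinct slots are
independent. -/
structure IsEnvironment {Ω : Type*} [MeasurableSpace Ω] (P : Measure Ω) (p : Params)
    (g : ℕ → Ω → Fin p.nT → ℂ)
    (X : ℕ → ℕ → Ω → EuclideanSpace ℝ (Fin 2))
    (h : ℕ → ℕ → Ω → Fin p.nT → ℂ)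
    (G : ℕ → Ω → Matrix (Fin p.nT) (Fin (p.nT - 1)) ℂ) : Prop where
  measurable_g : ∀ t, Measurable (g t)
  law_g : ∀ t, HasLaw (g t) (fadingLaw p.nT) P
  ppp : ∀ t, IsHomogeneousPPP P p.lam (X t)
  measurable_h : ∀ t i, Measurable (h t i)
  law_h : ∀ t i, HasLaw (h t i) (fadingLaw p.nT) P
  indep_h : ∀ t, iIndepFun (h t) P
  indep_g_h : ∀ t, IndepFun (g t) (fun ω i => h t i ω) P
  indep_locations : ∀ t, IndepFun (fun ω i => X t i ω) (fun ω => (g t ω, fun i => h t i ω)) P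
  indep_slots : iIndepFun (fun t ω => (g t ω, (fun i => X t i ω), fun i => h t i ω)) P
  completes : ∀ t ω, CompletesBeam (beam (g t ω)) (G t ω)

/-! ### Signal quality at the eavesdroppers and the number of slots they need -/

/-- The SINR of a confidential frame at an eavesdropper located at `x` with fading vector `h`, for
beamformer `w` and artificial-noise matrix `G`. -/
def sinr (p : Params) (w : Fin p.nT → ℂ) (G : Matrix (Fin p.nT) (Fin (p.nT - 1)) ℂ)
    (x : EuclideanSpace ℝ (Fin 2)) (h : Fin p.nT → ℂ) : ℝ :=
  p.zeta * p.Ps * ‖x‖ ^ (-p.eta) * ‖w ⬝ᵥ h‖ ^ 2 /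
    ((1 - p.zeta) * p.Ps * sqNorm (h ᵥ* G) * ‖x‖ ^ (-p.eta) / ((p.nT : ℝ) - 1) + p.sigma)

section

variable {Ω : Type*} [MeasurableSpace Ω] (P : Measure Ω) (p : Params)
  (g : ℕ → Ω → Fin p.nT → ℂ)
  (X : ℕ → ℕ → Ω → EuclideanSpace ℝ (Fin 2))
  (h : ℕ → ℕ → Ω → Fin p.nT → ℂ)
  (G : ℕ → Ω → Matrix (Fin p.nT) (Fin (p.nT - 1)) ℂ)

/-- The event `Ψ₁` that confidential packets are sent in slot `t`. -/
def confSlot (t : ℕ) : Set Ω := {ω | p.nu < sqNorm (g t ω)}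

/-- The SINR of the `i`-th eavesdropper in slot `t`. -/
def eveSinr (t i : ℕ) (ω : Ω) : ℝ :=
  sinr p (beam (g t ω)) (G t ω) (X t i ω) (h t i ω)

/-- The SINR of the equivalent wiretap channel in slot `t`: the largest SINR for non-colluding, the
sum of the SINRs for colluding eavesdroppers. -/
def wiretapSinr (c : Strategy) (t : ℕ) (ω : Ω) : ℝ :=
  match c with
  | .nce => ⨆ i, eveSinr p g X h G t i ω
  | .ce => ∑' i, eveSinr p g X h G t i ω

/-- The wiretap channel does not support the `Ls` packets of a confidential frame in slot `t`. -/
def wiretapOutage (c : Strategy) (t : ℕ) : Set Ω :=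
  {ω | p.B * p.T / p.b * Real.logb 2 (1 + wiretapSinr p g X h G c t ω) < p.Ls}

/-- The number of RoI packets that the eavesdroppers have collected in the first `k` slots. -/
def collected (c : Strategy) (k : ℕ) (ω : Ω) : ℕ :=
  open Classical in
  ∑ t ∈ Finset.range k,
    if ω ∈ confSlot p g t ∧ ω ∉ wiretapOutage p g X h G c t then p.Ls else 0

/-- `T_E`: the number of slots until the eavesdroppers have collected `Nroi` RoI packets (`⊤` if
they never do). -/
def TE (c : Strategy) (ω : Ω) : ℕ∞ :=
  ⨅ (k : ℕ) (_ : p.Nroi ≤ collected p g X h G c k ω), (k : ℕ∞)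

/-- `Pr(Ψ₁) Pr(outage of the wiretap channel | Ψ₁) + Pr(Ψ₀)`: the probability that the
eavesdroppers collect no RoI packet in slot `t`. -/
def failProb (c : Strategy) (t : ℕ) : ℝ :=
  P.real (confSlot p g t) *
      (ProbabilityTheory.cond P (confSlot p g t)).real (wiretapOutage p g X h G c t) +
    P.real (confSlot p g t)ᶜ

/-- The SINR value `θ` above which the wiretap channel supports `Ls` packets. -/
def theta : ℝ := (2 : ℝ) ^ ((p.Ls : ℝ) * p.b / (p.B * p.T)) - 1

/-- The failure probability of colluding eavesdroppers in slot `t` when the SINR threshold `θ` is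
replaced by `θ` times an independent normalized Gamma variable of shape `K` (and mean 1). -/
def smoothedFailProb (K t : ℕ) : ℝ :=
  P.real (confSlot p g t) *
      (1 - (P.prod (gammaMeasure K K)).real
        {q : Ω × ℝ | theta p * q.2 < wiretapSinr p g X h G .ce t q.1}) +
    P.real (confSlot p g t)ᶜ

end

/-! ### The explicit expressions -/

/-- `Υ(k, m; p) = C(k + m - 1, k) p ^ k (1 - p) ^ m`. -/
def Upsilon (k m : ℕ) (p : ℝ) : ℝ :=
  ((k + m - 1).choose k : ℝ) * p ^ k * (1 - p) ^ m

/-- The distribution function `k ↦ ∑_{l=m}^k Υ(l - m, m; Λ)` with `m = Nroi / Ls`. -/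
def upsilonSum (p : Params) (k : ℕ) (Lam : ℝ) : ℝ :=
  ∑ l ∈ Finset.Icc (p.Nroi / p.Ls) k, Upsilon (l - p.Nroi / p.Ls) (p.Nroi / p.Ls) Lam

/-- The explicit value of `Pr(Ψ₁)`. -/
def prConf (p : Params) : ℝ :=
  Real.exp (-p.nu) * ∑ i ∈ Finset.range p.nT, p.nu ^ i / (i.factorial : ℝ)

/-- The explicit failure probability for non-colluding eavesdroppers. -/
def LambdaNCE (p : Params) : ℝ :=
  prConf p *
      Real.exp (-(Real.pi * Real.Gamma (1 + 2 / p.eta)) * p.lam *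
        (p.zeta * (p.Ps / p.sigma) / theta p) ^ (2 / p.eta) *
        (1 + (1 / p.zeta - 1) / ((p.nT : ℝ) - 1) * theta p) ^ (1 - (p.nT : ℝ))) +
    (1 - prConf p)

/-- The Whittaker function `W_{κ,μ}(z)` for `z > 0` and `μ - κ + 1/2 > 0` (by its integral
representation). -/
def whittakerW (κ μ z : ℝ) : ℝ :=
  Real.exp (-z / 2) * z ^ (μ + 1 / 2) / Real.Gamma (μ - κ + 1 / 2) *
    ∫ t in Set.Ioi (0 : ℝ),
      Real.exp (-z * t) * t ^ (μ - κ - 1 / 2) * (1 + t) ^ (μ + κ - 1 / 2)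

/-- `a₁ = ζ Pₛ / σₙ`. -/
def aOne (p : Params) : ℝ := p.zeta * (p.Ps / p.sigma)

/-- `ϱ = (1 - ζ) (Pₛ / σₙ) / (n_T - 1)`. -/
def varrho (p : Params) : ℝ := (1 - p.zeta) * (p.Ps / p.sigma) / ((p.nT : ℝ) - 1)

/-- `ς = ζ (n_T - 1) / (1 - ζ)`. -/
def varsigma (p : Params) : ℝ := p.zeta * ((p.nT : ℝ) - 1) / (1 - p.zeta)

/-- The constant `ℬ = (B(2/η, 1 - 2/η) / η) ϱ ^ ((1 - n_T + 2/η) / 2)`. -/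
def calB (p : Params) : ℝ :=
  ProbabilityTheory.beta (2 / p.eta) (1 - 2 / p.eta) / p.eta *
    varrho p ^ ((1 - (p.nT : ℝ) + 2 / p.eta) / 2)

/-- The explicit Laplace transform of the colluding wiretap SINR; at `s = 0` the power of `a₁ s`
vanishes and the value is `1`. -/
def laplaceCE (p : Params) (s : ℝ) : ℝ :=
  Real.exp (-2 * Real.pi * p.lam * calB p * Real.exp (varsigma p * s / 2) *
    (aOne p * s) ^ (((p.nT : ℝ) - 1 + 2 / p.eta) / 2) *
    whittakerW ((1 - (p.nT : ℝ) + 2 / p.eta) / 2) ((2 - (p.nT : ℝ) - 2 / p.eta) / 2)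
      (varsigma p * s))

/-- `φ = K / (K!)^{1/K}`. -/
def varphi (K : ℕ) : ℝ := (K : ℝ) / (K.factorial : ℝ) ^ (1 / (K : ℝ))

/-- The explicit `K`-term expression for the complementary distribution function of the colluding
wiretap SINR. -/
def ccdfCE (p : Params) (K : ℕ) (x : ℝ) : ℝ :=
  ∑ k ∈ Finset.range (K + 1),
    (K.choose k : ℝ) * (-1) ^ k * laplaceCE p ((k : ℝ) * varphi K / x)

/-- The explicit `K`-term failure probability for colluding eavesdroppers. -/
def LambdaCE (p : Params) (K : ℕ) : ℝ :=
  prConf p * (1 - ccdfCE p K (theta p)) + (1 - prConf p)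

end

end SecureImage

open SecureImage

namespace SecureImage

noncomputable section

/-! One slot is a Poisson process whose points carry independent fading vectors. For a unit
beamformer `w`, adjoining `w` to the columns of `G` gives a unitary matrix, so `G` drops out of the
SINR. By unitary invariance of the fading law, the beamformed gain is Exp(1) and the residual gain
is an independent sum of `nT - 1` such variables, whatever `w` is. This gives the explicit tail
`sinrTail` of the SINR at each distance.

Everything about a slot then follows from one formula, `lintegral_slot_expNeg`: the mean of `φ(g)
exp(-∑ f)` is the mean of `φ(g)` times `exp(-λ ∫ (1 - u))`, where `u` is the fading average of
`exp(-f)`. It combines conditioning with the Laplace functional of the Poisson process. Taking `f =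
∞` where the SINR reaches `θ`, and `0` elsewhere, gives the void probability behind `LambdaNCE`.
Taking `f = s γ` gives the Laplace transform of the colluding sum, and a change of variable
identifies its exponent with the Whittaker expression. Because `u` does not see `g`, the factor
`φ(g)` splits off. Uniqueness of Laplace transforms turns this into independence of the colluding
SINR from `Ψ₁`.

Success in a slot is, up to a null set, a measurable event of that slot's data, so the slots are
i.i.d. Bernoulli trials. Since `Ls` divides `Nroi`, `T_E ≤ k` means at least `Nroi / Ls` successes
among `k` trials; conditioning on the last trial gives the same recursion as Pascal's rule gives for
the sums of `Υ`.

For the `K`-term expression, binomial expansion gives the mean of `(1 - e^{-φγ/θ})^K`. Alzer's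
inequality bounds the integrand by the Gamma distribution function at `γ/θ`, whence
`smoothedFailProb ≤ LambdaCE`. The Gamma law has variance `1/K` and concentrates at `1`; as `γ` has
no atom at `θ`, the smoothed probabilities converge. These statements pass to `T_E` because
`negBinomCdf` is antitone on `[0, 1]` and continuous in the failure probability. -/

/-! ### The exponential on `[0, ∞]` and transforms of the Poisson law. -/

/-- The function `a ↦ e^{-a}` on `[0, ∞]`. -/
def expNeg (a : ℝ≥0∞) : ℝ≥0∞ := EReal.exp (-(a : EReal))

@[simp] lemma expNeg_zero : expNeg 0 = 1 := by simp [expNeg]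

@[simp] lemma expNeg_top : expNeg ∞ = 0 := by simp [expNeg]

lemma expNeg_ofReal {x : ℝ} (hx : 0 ≤ x) : expNeg (ENNReal.ofReal x) = ENNReal.ofReal (Real.exp (-x)) := by
  rw [expNeg, EReal.coe_ennreal_ofReal, max_eq_left hx, ← EReal.coe_neg, EReal.exp_coe]

lemma expNeg_coe (x : ℝ≥0) : expNeg x = ENNReal.ofReal (Real.exp (-x)) := by
  rw [← expNeg_ofReal x.coe_nonneg, ENNReal.ofReal_coe_nnreal]

lemma expNeg_add (a b : ℝ≥0∞) : expNeg (a + b) = expNeg a * expNeg b := by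
  induction a with
  | top => simp
  | coe a =>
    induction b with
    | top => simp
    | coe b =>
      rw [← ENNReal.coe_add, expNeg_coe, expNeg_coe, expNeg_coe, ← ENNReal.ofReal_mul (by positivity),
        ← Real.exp_add]
      congr 2; push_cast; ring

lemma continuous_expNeg : Continuous expNeg :=
  ENNReal.continuous_exp.comp (continuous_neg.comp continuous_coe_ennreal_ereal)

@[fun_prop] lemma measurable_expNeg : Measurable expNeg := continuous_expNeg.measurable

lemma expNeg_le_one (a : ℝ≥0∞) : expNeg a ≤ 1 := by
  simpa [expNeg] using EReal.coe_ennreal_nonneg a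

lemma expNeg_sum {ι : Type*} (s : Finset ι) (f : ι → ℝ≥0∞) :
    expNeg (∑ i ∈ s, f i) = ∏ i ∈ s, expNeg (f i) := by
  induction s using Finset.cons_induction with
  | empty => simp
  | cons a s ha ih => simp [expNeg_add, ih]

/-- The Laplace transform of the Poisson law. -/
lemma lintegral_expNeg_poisson (r c : ℝ≥0) :
    ∫⁻ k : ℕ, expNeg (c * k) ∂(poissonMeasure r) = expNeg (r * (1 - expNeg c)) := by
  have h1 : (1 : ℝ≥0∞) - expNeg c = ENNReal.ofReal (1 - Real.exp (-c)) := by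
    rw [expNeg_coe, ENNReal.ofReal_sub _ (Real.exp_pos _).le, ENNReal.ofReal_one]
  have h0 : 0 ≤ 1 - Real.exp (-(c : ℝ)) := by simp
  rw [h1, ← ENNReal.ofReal_coe_nnreal (p := r), ← ENNReal.ofReal_mul r.coe_nonneg, expNeg_ofReal (by positivity),
    poissonMeasure, lintegral_sum_measure]
  simp_rw [lintegral_smul_measure, lintegral_dirac, smul_eq_mul]
  have h2 : ∀ k : ℕ, ENNReal.ofReal (Real.exp (-r) * r ^ k / k.factorial) * expNeg (c * k) =
      ENNReal.ofReal (Real.exp (-r) * ((r * Real.exp (-c)) ^ k / k.factorial)) := by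
    intro k
    have : (c * k : ℝ≥0∞) = ((c * k : ℝ≥0) : ℝ≥0∞) := by push_cast; rfl
    rw [this, expNeg_coe, ← ENNReal.ofReal_mul (by positivity)]
    congr 1
    rw [mul_pow, ← Real.exp_nat_mul]
    push_cast
    rw [show -((c : ℝ) * k) = k * -c by ring]
    ring
  simp_rw [h2]
  have h3 := (NormedSpace.expSeries_div_hasSum_exp ((r : ℝ) * Real.exp (-c))).mul_left (Real.exp (-r))
  rw [← ENNReal.ofReal_tsum_of_nonneg (fun k => by positivity) h3.summable, h3.tsum_eq,
    ← Real.exp_eq_exp_ℝ, ← Real.exp_add]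
  congr 2; ring

/-- The mean of the Poisson law. -/
lemma lintegral_poisson (r : ℝ≥0) : ∫⁻ k : ℕ, (k : ℝ≥0∞) ∂(poissonMeasure r) = r := by
  rw [poissonMeasure, lintegral_sum_measure]
  simp_rw [lintegral_smul_measure, lintegral_dirac, smul_eq_mul]
  have h2 : ∀ k : ℕ, ENNReal.ofReal (Real.exp (-r) * r ^ (k + 1) / (k + 1).factorial) * ((k + 1 : ℕ) : ℝ≥0∞) =
      r * ENNReal.ofReal (Real.exp (-r) * r ^ k / k.factorial) := by
    intro k
    rw [← ENNReal.ofReal_natCast, ← ENNReal.ofReal_coe_nnreal, ← ENNReal.ofReal_mul (by positivity),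
      ← ENNReal.ofReal_mul (by positivity)]
    congr 1
    rw [Nat.factorial_succ]
    push_cast
    field_simp
    ring
  rw [tsum_eq_zero_add' ENNReal.summable]
  simp_rw [h2]
  rw [ENNReal.tsum_mul_left, ← ENNReal.ofReal_tsum_of_nonneg (fun k => by positivity)
    (hasSum_one_poissonMeasure r).summable, (hasSum_one_poissonMeasure r).tsum_eq]
  simp

/-! ### Laplace functional and Campbell's formula of the Poisson process. -/

section PoissonProcess

variable {Ω : Type*} [MeasurableSpace Ω] {P : Measure Ω} {lam : ℝ}
  {X : ℕ → Ω → EuclideanSpace ℝ (Fin 2)}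

lemma lintegral_count_eq_tsum (x : ℕ → EuclideanSpace ℝ (Fin 2))
    {v : EuclideanSpace ℝ (Fin 2) → ℝ≥0∞} (hv : Measurable v) :
    ∫⁻ y, v y ∂(Measure.sum fun i => Measure.dirac (x i)) = ∑' i, v (x i) := by
  rw [lintegral_sum_measure]
  simp_rw [lintegral_dirac' _ hv]

lemma IsHomogeneousPPP.measurable_count (hX : IsHomogeneousPPP P lam X)
    {A : Set (EuclideanSpace ℝ (Fin 2))} (hA : MeasurableSet A) :
    Measurable fun ω => pointCount (fun i => X i ω) A := by
  simp only [pointCount, Measure.sum_apply _ hA, Measure.dirac_apply' _ hA]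
  exact Measurable.tsum fun i => (measurable_one.indicator hA).comp (hX.measurable i)

lemma IsHomogeneousPPP.lintegral_expNeg_count (hX : IsHomogeneousPPP P lam X) (hlam : 0 ≤ lam)
    {A : Set (EuclideanSpace ℝ (Fin 2))} (hA : MeasurableSet A) (hA' : volume A ≠ ∞) {c : ℝ≥0∞}
    (hc : c ≠ ∞) :
    ∫⁻ ω, expNeg (c * pointCount (fun i => X i ω) A) ∂P =
      expNeg (ENNReal.ofReal lam * ((1 - expNeg c) * volume A)) := by
  lift c to ℝ≥0 using hc
  rw [(hX.law_count A hA hA').lintegral_comp (f := fun n => expNeg (c * n)) (by fun_prop),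
    lintegral_map (by fun_prop) (by fun_prop), lintegral_expNeg_poisson]
  congr 1
  rw [← ENNReal.ofReal, ENNReal.ofReal_mul hlam, Measure.real, ENNReal.ofReal_toReal hA']
  ring

/-- The sum over the points is `∑ c · N(v⁻¹{c})`. The level sets are disjoint with finite area, so
the counts are independent Poisson variables and their Laplace transforms multiply. -/
lemma IsHomogeneousPPP.lintegral_expNeg_simple (hX : IsHomogeneousPPP P lam X) (hlam : 0 ≤ lam)
    (v : SimpleFunc (EuclideanSpace ℝ (Fin 2)) ℝ≥0∞) (hv : ∀ x, v x ≠ ∞)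
    (hv' : volume (Function.support v) ≠ ∞) :
    ∫⁻ ω, expNeg (∑' i, v (X i ω)) ∂P =
      expNeg (ENNReal.ofReal lam * ∫⁻ x, (1 - expNeg (v x))) := by
  -- The value `0` is dropped: it contributes nothing, and its level set has infinite area.
  set s : Finset ℝ≥0∞ := {c ∈ v.range | c ≠ 0}
  have hs : ∀ c ∈ s, c ≠ 0 ∧ c ≠ ∞ := by
    intro c hc
    rw [Finset.mem_filter, SimpleFunc.mem_range] at hc
    obtain ⟨⟨x, rfl⟩, h⟩ := hc
    exact ⟨h, hv x⟩
  have hfin : ∀ c ∈ s, volume (v ⁻¹' {c}) ≠ ∞ := by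
    intro c hc
    refine ne_top_of_le_ne_top hv' (measure_mono fun x hx => ?_)
    rw [Set.mem_preimage, Set.mem_singleton_iff] at hx
    simpa [hx] using (hs c hc).1
  let e := s.equivFin
  have hind := hX.indep_count s.card (fun j => v ⁻¹' {(e.symm j : ℝ≥0∞)})
    (fun j => v.measurableSet_preimage _) (fun j => hfin _ (e.symm j).2) (by
      intro i j hij
      refine Set.disjoint_left.2 fun x hx hx' => hij ?_
      simp only [Set.mem_preimage, Set.mem_singleton_iff] at hx hx'
      exact e.symm.injective (Subtype.ext (hx.symm.trans hx')))
  have hind2 := hind.comp (fun j n => expNeg ((e.symm j : ℝ≥0∞) * n)) (fun j => by fun_prop)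
  have key := lintegral_prod_eq_prod_lintegral_of_indepFun Finset.univ _ hind2
    (fun j => (measurable_expNeg.comp (measurable_const.mul
      (hX.measurable_count (v.measurableSet_preimage _)))))
  have hL : ∀ ω, expNeg (∑' i, v (X i ω)) =
      ∏ j, expNeg ((e.symm j : ℝ≥0∞) * pointCount (fun i => X i ω) (v ⁻¹' {(e.symm j : ℝ≥0∞)})) := by
    intro ω
    rw [← lintegral_count_eq_tsum _ v.measurable, SimpleFunc.lintegral_eq_lintegral,
      SimpleFunc.lintegral, ← expNeg_sum]
    congr 1
    rw [e.symm.sum_comp (fun c : s => (c : ℝ≥0∞) * pointCount (fun i => X i ω) (v ⁻¹' {(c : ℝ≥0∞)})),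
      Finset.sum_coe_sort s (fun c => c * pointCount (fun i => X i ω) (v ⁻¹' {c}))]
    refine (Finset.sum_filter_of_ne ?_).symm
    intro c _ h h0
    simp [h0] at h
  simp_rw [hL]
  simp only [Function.comp_def] at key
  rw [key]
  have hR : ∫⁻ x, (1 - expNeg (v x)) = ∑ c ∈ s, (1 - expNeg c) * volume (v ⁻¹' {c}) := by
    have := SimpleFunc.map_lintegral (μ := volume) (fun c => 1 - expNeg c) v
    rw [← SimpleFunc.lintegral_eq_lintegral] at this
    simp only [SimpleFunc.coe_map, Function.comp_def] at this
    rw [this]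
    refine (Finset.sum_filter_of_ne ?_).symm
    intro c _ h h0
    simp [h0] at h
  rw [hR, Finset.mul_sum, expNeg_sum, ← Finset.prod_coe_sort s, ← e.symm.prod_comp]
  refine Finset.prod_congr rfl fun j _ => ?_
  exact hX.lintegral_expNeg_count hlam (v.measurableSet_preimage _) (hfin _ (e.symm j).2)
    (hs _ (e.symm j).2).2

/-- The Laplace functional of a homogeneous Poisson point process. -/
theorem IsHomogeneousPPP.lintegral_expNeg (hX : IsHomogeneousPPP P lam X) [IsProbabilityMeasure P]
    (hlam : 0 ≤ lam) {v : EuclideanSpace ℝ (Fin 2) → ℝ≥0∞} (hv : Measurable v) :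
    ∫⁻ ω, expNeg (∑' i, v (X i ω)) ∂P =
      expNeg (ENNReal.ofReal lam * ∫⁻ x, (1 - expNeg (v x))) := by
  -- Simple approximations are cut off to growing balls, which keeps their supports of finite area
  -- and the sequence increasing.
  let u : ℕ → SimpleFunc (EuclideanSpace ℝ (Fin 2)) ℝ≥0∞ := fun n =>
    (SimpleFunc.eapprox v n).restrict (Metric.ball 0 n)
  have hu : ∀ n x, u n x = (Metric.ball 0 (n : ℝ)).indicator (SimpleFunc.eapprox v n) x := fun n x =>
    SimpleFunc.restrict_apply _ Metric.isOpen_ball.measurableSet x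
  have hmono : ∀ x, Monotone fun n => u n x := by
    intro x m n hmn
    simp only [hu]
    refine (Set.indicator_le_indicator_of_subset (Metric.ball_subset_ball (by exact_mod_cast hmn))
      (fun _ => zero_le) x).trans (Set.indicator_le_indicator (SimpleFunc.monotone_eapprox v hmn x))
  have hlim : ∀ x, Tendsto (fun n => u n x) atTop (𝓝 (v x)) := by
    intro x
    refine (SimpleFunc.tendsto_eapprox hv x).congr' ?_
    obtain ⟨N, hN⟩ := exists_nat_gt ‖x‖
    filter_upwards [eventually_ge_atTop N] with n hn
    rw [hu, Set.indicator_of_mem]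
    rw [mem_ball_zero_iff]
    exact hN.trans_le (by exact_mod_cast hn)
  have h1 := fun n => hX.lintegral_expNeg_simple hlam (u n)
    (fun x => by
      rw [hu]
      by_cases hx : x ∈ Metric.ball (0 : EuclideanSpace ℝ (Fin 2)) n
      · rw [Set.indicator_of_mem hx]; exact (SimpleFunc.eapprox_lt_top v n x).ne
      · rw [Set.indicator_of_notMem hx]; simp)
    (ne_top_of_le_ne_top (measure_ball_lt_top (x := (0 : EuclideanSpace ℝ (Fin 2))) (r := n)).ne
      (measure_mono fun x hx => by
        rw [Function.mem_support, hu] at hx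
        exact Set.mem_of_indicator_ne_zero hx))
  have hR : Tendsto (fun n => expNeg (ENNReal.ofReal lam * ∫⁻ x, (1 - expNeg (u n x)))) atTop
      (𝓝 (expNeg (ENNReal.ofReal lam * ∫⁻ x, (1 - expNeg (v x))))) := by
    refine (continuous_expNeg.tendsto _).comp (ENNReal.Tendsto.const_mul ?_ (Or.inr ENNReal.ofReal_ne_top))
    -- `1 - e^{-u n}` increases with `n`, so no integrability is needed on this side.
    refine lintegral_tendsto_of_tendsto_of_monotone (fun n => ?_) ?_ ?_
    · exact (measurable_const.sub (measurable_expNeg.comp (u n).measurable)).aemeasurable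
    · refine Eventually.of_forall fun x m n hmn => tsub_le_tsub_left ?_ _
      exact EReal.exp_monotone (EReal.neg_le_neg_iff.2 (by exact_mod_cast hmono x hmn))
    · refine Eventually.of_forall fun x => ?_
      exact ENNReal.Tendsto.sub tendsto_const_nhds ((continuous_expNeg.tendsto _).comp (hlim x))
        (Or.inl ENNReal.one_ne_top)
  have hL : Tendsto (fun n => ∫⁻ ω, expNeg (∑' i, u n (X i ω)) ∂P) atTop
      (𝓝 (∫⁻ ω, expNeg (∑' i, v (X i ω)) ∂P)) := by
    -- Here the integrands decrease, so domination by `1` replaces monotone convergence.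
    refine tendsto_lintegral_of_dominated_convergence (fun _ => 1) (fun n => ?_) (fun n => ?_) ?_ ?_
    · exact measurable_expNeg.comp (Measurable.tsum fun i => (u n).measurable.comp (hX.measurable i))
    · exact Eventually.of_forall fun ω => expNeg_le_one _
    · simp
    · refine Eventually.of_forall fun ω => (continuous_expNeg.tendsto _).comp ?_
      simp_rw [← lintegral_count_eq_tsum _ (u _).measurable, ← lintegral_count_eq_tsum _ hv]
      exact lintegral_tendsto_of_tendsto_of_monotone (fun n => (u n).measurable.aemeasurable)
        (Eventually.of_forall hmono) (Eventually.of_forall hlim)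
  simp_rw [h1] at hL
  exact tendsto_nhds_unique hL hR

/-- Campbell's formula for a homogeneous Poisson point process. -/
theorem IsHomogeneousPPP.lintegral_tsum (hX : IsHomogeneousPPP P lam X) (hlam : 0 ≤ lam)
    {v : EuclideanSpace ℝ (Fin 2) → ℝ≥0∞} (hv : Measurable v) :
    ∑' i, ∫⁻ ω, v (X i ω) ∂P = ENNReal.ofReal lam * ∫⁻ x, v x := by
  -- The intensity measure is `λ` times area: on sets of finite area this is the Poisson mean, and
  -- exhaustion by balls covers the rest.
  have key : Measure.sum (fun i => P.map (X i)) = ENNReal.ofReal lam • volume := by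
    have hfin : ∀ A, MeasurableSet A → volume A ≠ ∞ →
        Measure.sum (fun i => P.map (X i)) A = (ENNReal.ofReal lam • volume) A := by
      intro A hA hA'
      have h1 := (hX.law_count A hA hA').lintegral_comp (f := fun n => n) (by fun_prop)
      rw [lintegral_map (by fun_prop) (by fun_prop), lintegral_poisson] at h1
      simp only [pointCount, Measure.sum_apply _ hA] at h1
      rw [MeasureTheory.lintegral_tsum (fun i => by
        simp only [Measure.dirac_apply' _ hA]
        exact ((measurable_one.indicator hA).comp (hX.measurable i)).aemeasurable)] at h1
      rw [Measure.sum_apply _ hA, Measure.smul_apply, smul_eq_mul]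
      rw [← ENNReal.ofReal, ENNReal.ofReal_mul hlam, Measure.real, ENNReal.ofReal_toReal hA'] at h1
      rw [← h1]
      refine tsum_congr fun i => ?_
      rw [Measure.map_apply (hX.measurable i) hA, ← lintegral_indicator_one ((hX.measurable i) hA)]
      refine lintegral_congr fun ω => ?_
      rw [Measure.dirac_apply' _ hA]
      rfl
    ext A hA
    have hun : A = ⋃ n : ℕ, A ∩ Metric.ball 0 n := by
      rw [← Set.inter_iUnion, Metric.iUnion_ball_nat, Set.inter_univ]
    have hm : Monotone fun n : ℕ => A ∩ Metric.ball (0 : EuclideanSpace ℝ (Fin 2)) n := fun m n hmn =>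
      Set.inter_subset_inter_right _ (Metric.ball_subset_ball (by exact_mod_cast hmn))
    rw [hun, hm.measure_iUnion, hm.measure_iUnion]
    exact iSup_congr fun n => hfin _ (hA.inter Metric.isOpen_ball.measurableSet)
      (ne_top_of_le_ne_top measure_ball_lt_top.ne (measure_mono Set.inter_subset_right))
  have := congrArg (fun μ => ∫⁻ x, v x ∂μ) key
  simp only [lintegral_sum_measure, lintegral_smul_measure, smul_eq_mul] at this
  rw [← this]
  exact tsum_congr fun i => (lintegral_map hv (hX.measurable i)).symm

end PoissonProcess

/-! ### The complex normal law -/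

lemma lintegral_complex_norm {F : ℝ → ℝ≥0∞} (hF : Measurable F) :
    ∫⁻ z : ℂ, F ‖z‖ = ENNReal.ofReal (2 * Real.pi) * ∫⁻ r in Set.Ioi (0 : ℝ), ENNReal.ofReal r * F r := by
  rw [← Complex.lintegral_comp_polarCoord_symm, polarCoord_target]
  have h1 : ∫⁻ q in Set.Ioi (0 : ℝ) ×ˢ Set.Ioo (-Real.pi) Real.pi,
      ENNReal.ofReal q.1 • F ‖Complex.polarCoord.symm q‖ =
      ∫⁻ q in Set.Ioi (0 : ℝ) ×ˢ Set.Ioo (-Real.pi) Real.pi, ENNReal.ofReal q.1 * F q.1 := by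
    refine setLIntegral_congr_fun (measurableSet_Ioi.prod measurableSet_Ioo) fun q hq => ?_
    have : |q.1| = q.1 := abs_of_pos hq.1
    simp [this]
  rw [h1, Measure.volume_eq_prod, ← Measure.prod_restrict, lintegral_prod _ (by fun_prop)]
  simp only [lintegral_const, Measure.restrict_apply_univ, Real.volume_Ioo]
  rw [lintegral_mul_const _ (by fun_prop), mul_comm]
  congr 2; ring

lemma lintegral_Ioi_mul_exp_neg_sq {a : ℝ} (ha : 0 ≤ a) :
    ∫⁻ r in Set.Ioi a, ENNReal.ofReal (2 * r * Real.exp (-r ^ 2)) = ENNReal.ofReal (Real.exp (-a ^ 2)) := by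
  have hd : ∀ x ∈ Set.Ici a, HasDerivAt (fun r : ℝ => -Real.exp (-r ^ 2)) (2 * x * Real.exp (-x ^ 2)) x := by
    intro x _
    have := ((hasDerivAt_pow 2 x).neg.exp).neg
    refine this.congr_deriv ?_
    simp; ring
  have hpos : ∀ x ∈ Set.Ioi a, 0 ≤ 2 * x * Real.exp (-x ^ 2) := fun x hx => by
    have : 0 < x := ha.trans_lt hx
    positivity
  have hlim : Tendsto (fun r : ℝ => -Real.exp (-r ^ 2)) atTop (𝓝 0) := by
    rw [← neg_zero]
    refine (Real.tendsto_exp_neg_atTop_nhds_zero.comp (tendsto_pow_atTop two_ne_zero)).neg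
  rw [← ofReal_integral_eq_lintegral_ofReal (integrableOn_Ioi_deriv_of_nonneg' hd hpos hlim)
    ((ae_restrict_mem measurableSet_Ioi).mono hpos),
    integral_Ioi_of_hasDerivAt_of_nonneg' hd hpos hlim]
  simp

/-- In polar coordinates the radial density is `2 r e^{-r²}`, and its mass beyond `√y` is `e^{-y}`.
-/
lemma stdComplexNormal_lt_norm_sq {y : ℝ} (hy : 0 ≤ y) :
    stdComplexNormal {z | y < ‖z‖ ^ 2} = ENNReal.ofReal (Real.exp (-y)) := by
  have hm : MeasurableSet {z : ℂ | y < ‖z‖ ^ 2} := measurableSet_lt (by fun_prop) (by fun_prop)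
  rw [stdComplexNormal, withDensity_apply _ hm, ← lintegral_indicator hm]
  have h1 : ∀ z : ℂ, {z : ℂ | y < ‖z‖ ^ 2}.indicator
      (fun z => ENNReal.ofReal (Real.exp (-‖z‖ ^ 2) / Real.pi)) z =
      (Set.Ioi y).indicator (fun _ => 1) (‖z‖ ^ 2) * ENNReal.ofReal (Real.exp (-‖z‖ ^ 2) / Real.pi) := by
    intro z
    by_cases hz : y < ‖z‖ ^ 2 <;> simp [Set.indicator, hz]
  simp_rw [h1]
  have hm2 : Measurable fun r : ℝ => (Set.Ioi y).indicator (fun _ => (1 : ℝ≥0∞)) (r ^ 2) :=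
    (measurable_const.indicator measurableSet_Ioi).comp (by fun_prop)
  have hm3 : Measurable fun r : ℝ => ENNReal.ofReal r * ((Set.Ioi y).indicator (fun _ => 1) (r ^ 2) *
      ENNReal.ofReal (Real.exp (-r ^ 2) / Real.pi)) :=
    ENNReal.measurable_ofReal.mul (hm2.mul (by fun_prop))
  rw [lintegral_complex_norm (F := fun r => (Set.Ioi y).indicator (fun _ => 1) (r ^ 2) *
    ENNReal.ofReal (Real.exp (-r ^ 2) / Real.pi)) (hm2.mul (by fun_prop)),
    ← lintegral_const_mul _ hm3]
  have h2 := lintegral_Ioi_mul_exp_neg_sq (Real.sqrt_nonneg y)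
  rw [Real.sq_sqrt hy] at h2
  rw [← h2, ← lintegral_indicator measurableSet_Ioi, ← lintegral_indicator measurableSet_Ioi]
  refine lintegral_congr fun r => ?_
  by_cases hr : Real.sqrt y < r
  · have hr0 : 0 < r := (Real.sqrt_nonneg y).trans_lt hr
    have hy' : y < r ^ 2 := (Real.sqrt_lt' hr0).1 hr
    rw [Set.indicator_of_mem (show r ∈ Set.Ioi 0 from hr0), Set.indicator_of_mem (show r ∈ Set.Ioi (Real.sqrt y) from hr),
      Set.indicator_of_mem (show r ^ 2 ∈ Set.Ioi y from hy'), one_mul, ← ENNReal.ofReal_mul hr0.le,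
      ← ENNReal.ofReal_mul (by positivity)]
    congr 1
    field_simp
  · rw [Set.indicator_of_notMem (show r ∉ Set.Ioi (Real.sqrt y) from hr)]
    by_cases hr0 : 0 < r
    · have hy' : ¬ y < r ^ 2 := fun h => hr ((Real.sqrt_lt' hr0).2 h)
      rw [Set.indicator_of_mem (show r ∈ Set.Ioi 0 from hr0), Set.indicator_of_notMem (show r ^ 2 ∉ Set.Ioi y from hy')]
      simp
    · rw [Set.indicator_of_notMem (show r ∉ Set.Ioi 0 from hr0)]

lemma stdComplexNormal_absolutelyContinuous : stdComplexNormal ≪ volume :=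
  withDensity_absolutelyContinuous _ _

instance : IsProbabilityMeasure stdComplexNormal := by
  constructor
  -- The tail at `0` is the total mass, up to the origin, which is a null set.
  have h := stdComplexNormal_lt_norm_sq le_rfl
  rw [neg_zero, Real.exp_zero, ENNReal.ofReal_one] at h
  rw [← h]
  refine measure_congr ?_
  have : stdComplexNormal {(0 : ℂ)} = 0 := stdComplexNormal_absolutelyContinuous (by simp)
  filter_upwards [compl_mem_ae_iff.2 this] with z hz
  have hz' : z ≠ 0 := hz
  refine propext ⟨fun _ => ?_, fun _ => trivial⟩
  show 0 < ‖z‖ ^ 2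
  positivity

instance (n : ℕ) : IsProbabilityMeasure (fadingLaw n) := by
  unfold fadingLaw; infer_instance

lemma map_norm_sq_stdComplexNormal :
    stdComplexNormal.map (fun z => ‖z‖ ^ 2) = expMeasure 1 := by
  have hm : Measurable fun z : ℂ => ‖z‖ ^ 2 := by fun_prop
  have := isProbabilityMeasure_expMeasure one_pos
  have := Measure.isProbabilityMeasure_map (μ := stdComplexNormal) hm.aemeasurable
  refine Measure.ext_of_Iic _ _ fun a => ?_
  rw [← ofReal_cdf (expMeasure 1), cdf_expMeasure_eq one_pos, Measure.map_apply hm measurableSet_Iic]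
  by_cases ha : 0 ≤ a
  · have : (fun z : ℂ => ‖z‖ ^ 2) ⁻¹' Set.Iic a = {z | a < ‖z‖ ^ 2}ᶜ := by ext; simp
    rw [this, prob_compl_eq_one_sub (measurableSet_lt (by fun_prop) (by fun_prop)), stdComplexNormal_lt_norm_sq ha,
      if_pos ha, one_mul, ENNReal.ofReal_sub _ (by positivity), ENNReal.ofReal_one]
  · have : (fun z : ℂ => ‖z‖ ^ 2) ⁻¹' Set.Iic a = ∅ := by
      ext z
      simp only [Set.mem_preimage, Set.mem_Iic, Set.mem_empty_iff_false, iff_false, not_le]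
      exact (not_le.1 ha).trans_le (by positivity)
    rw [this, if_neg ha]; simp

lemma lintegral_expMeasure_one {f : ℝ → ℝ≥0∞} (hf : Measurable f) :
    ∫⁻ y, f y ∂(expMeasure 1) = ∫⁻ y in Set.Ioi 0, ENNReal.ofReal (Real.exp (-y)) * f y := by
  have hpdf : Measurable (gammaPDF 1 1) := (measurable_gammaPDFReal 1 1).ennreal_ofReal
  rw [expMeasure, gammaMeasure, lintegral_withDensity_eq_lintegral_mul _ hpdf hf,
    ← setLIntegral_congr Ioi_ae_eq_Ici.symm, ← lintegral_indicator measurableSet_Ici]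
  refine lintegral_congr fun y => ?_
  by_cases hy : 0 ≤ y
  · rw [Set.indicator_of_mem (show y ∈ Set.Ici 0 from hy)]
    simp [gammaPDF_of_nonneg hy]
  · rw [Set.indicator_of_notMem (show y ∉ Set.Ici 0 from hy)]
    simp [gammaPDF_of_neg (not_le.1 hy)]

/-- The Laplace transform of Exp(1). Each of the `nT - 1` artificial-noise directions will
contribute one such factor to the SINR tail. -/
lemma lintegral_exp_neg_mul_norm_sq {c : ℝ} (hc : 0 ≤ c) :
    ∫⁻ z, ENNReal.ofReal (Real.exp (-(c * ‖z‖ ^ 2))) ∂stdComplexNormal = ENNReal.ofReal (1 + c)⁻¹ := by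
  rw [← lintegral_map (f := fun y => ENNReal.ofReal (Real.exp (-(c * y)))) (by fun_prop) (by fun_prop),
    map_norm_sq_stdComplexNormal, lintegral_expMeasure_one (by fun_prop)]
  have h : ∀ y, ENNReal.ofReal (Real.exp (-y)) * ENNReal.ofReal (Real.exp (-(c * y))) =
      ENNReal.ofReal (Real.exp (-(1 + c) * y)) := by
    intro y
    rw [← ENNReal.ofReal_mul (by positivity), ← Real.exp_add]
    congr 2; ring
  simp_rw [h]
  rw [← ofReal_integral_eq_lintegral_ofReal (integrableOn_exp_mul_Ioi (by linarith) _)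
    (Eventually.of_forall fun _ => by positivity), integral_exp_mul_Ioi (by linarith)]
  congr 1
  rw [mul_zero, Real.exp_zero, neg_div_neg_eq, one_div]

lemma stdComplexNormal_norm_sq_eq (y : ℝ) : stdComplexNormal {z | ‖z‖ ^ 2 = y} = 0 := by
  refine stdComplexNormal_absolutelyContinuous (measure_mono_null (t := Metric.sphere 0 (Real.sqrt y)) ?_
    (Measure.addHaar_sphere _ _ _))
  intro z hz
  have hz' : ‖z‖ ^ 2 = y := hz
  rw [mem_sphere_zero_iff_norm, ← hz', Real.sqrt_sq (norm_nonneg z)]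

/-! ### Vectors with independent complex normal entries -/

lemma lintegral_fin_prod {α : Type*} [MeasurableSpace α] (μ : Measure α) [SigmaFinite μ] {n : ℕ}
    (f : Fin n → α → ℝ≥0∞) (hf : ∀ i, Measurable (f i)) :
    ∫⁻ x, ∏ i, f i (x i) ∂(Measure.pi fun _ : Fin n => μ) = ∏ i, ∫⁻ y, f i y ∂μ := by
  induction n with
  | zero => simp
  | succ n ih =>
    have hmp := (measurePreserving_piFinSuccAbove (fun _ : Fin (n + 1) => μ) 0).symm
    rw [← hmp.lintegral_comp (by fun_prop), Fin.prod_univ_succ, ← ih (fun i => f i.succ) (fun i => hf _),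
      ← lintegral_prod_mul (hf 0).aemeasurable (Measurable.aemeasurable (by fun_prop))]
    refine lintegral_congr fun x => ?_
    simp [MeasurableEquiv.piFinSuccAbove_symm_apply, Fin.prod_univ_succ, Fin.insertNthEquiv]

lemma lintegral_fadingLaw_succ (n : ℕ) {F : ℂ → (Fin n → ℂ) → ℝ≥0∞}
    (hF : Measurable (Function.uncurry F)) :
    ∫⁻ v, F (v 0) (fun j => v j.succ) ∂(fadingLaw (n + 1)) =
      ∫⁻ v', ∫⁻ z, F z v' ∂stdComplexNormal ∂(fadingLaw n) := by
  have hmp := measurePreserving_piFinSuccAbove (fun _ : Fin (n + 1) => stdComplexNormal) 0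
  have h1 := hmp.lintegral_comp hF
  have h2 := lintegral_prod_symm' (μ := stdComplexNormal) (ν := fadingLaw n) _ hF
  simp only [Function.uncurry_apply_pair] at h2
  rw [← h2]
  exact h1

/-- The density depends on the vector only through its norm, which is what makes the law unitarily
invariant. -/
lemma fadingLaw_eq_withDensity (n : ℕ) : fadingLaw n =
    volume.withDensity fun v => ENNReal.ofReal (Real.exp (-sqNorm v) / Real.pi ^ n) := by
  refine Measure.pi_eq fun s hs => ?_
  rw [withDensity_apply _ (MeasurableSet.univ_pi hs), ← lintegral_indicator (MeasurableSet.univ_pi hs)]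
  have h : ∀ v : Fin n → ℂ, (Set.univ.pi s).indicator
      (fun v => ENNReal.ofReal (Real.exp (-sqNorm v) / Real.pi ^ n)) v =
      ∏ i, (s i).indicator (fun z => ENNReal.ofReal (Real.exp (-‖z‖ ^ 2) / Real.pi)) (v i) := by
    intro v
    by_cases hv : v ∈ Set.univ.pi s
    · rw [Set.indicator_of_mem hv, Finset.prod_congr rfl fun i _ => Set.indicator_of_mem (hv i trivial) _,
        ← ENNReal.ofReal_prod_of_nonneg (fun i _ => by positivity), Finset.prod_div_distrib, ← Real.exp_sum,
        sqNorm, Finset.sum_neg_distrib]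
      simp
    · rw [Set.indicator_of_notMem hv]
      simp only [Set.mem_univ_pi, not_forall] at hv
      obtain ⟨i, hi⟩ := hv
      exact (Finset.prod_eq_zero (Finset.mem_univ i) (Set.indicator_of_notMem hi _)).symm
  simp_rw [h]
  rw [volume_pi, lintegral_fin_prod _ _ (fun i => Measurable.indicator (by fun_prop) (hs i))]
  refine Finset.prod_congr rfl fun i _ => ?_
  rw [lintegral_indicator (hs i), stdComplexNormal, withDensity_apply _ (hs i)]

lemma sqNorm_eq_star_dotProduct {n : ℕ} (v : Fin n → ℂ) : (sqNorm v : ℂ) = v ⬝ᵥ star v := by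
  simp [sqNorm, dotProduct, Complex.mul_conj, Complex.normSq_eq_norm_sq]

lemma sqNorm_nonneg {n : ℕ} (v : Fin n → ℂ) : 0 ≤ sqNorm v :=
  Finset.sum_nonneg fun _ _ => by positivity

@[fun_prop] lemma measurable_sqNorm {n : ℕ} : Measurable (sqNorm (n := n)) := by
  unfold sqNorm; fun_prop

lemma sqNorm_vecMul {n : ℕ} {U : Matrix (Fin n) (Fin n) ℂ} (hU : Uᴴ * U = 1) (v : Fin n → ℂ) :
    sqNorm (v ᵥ* U) = sqNorm v := by
  have hU' : U * Uᴴ = 1 := mul_eq_one_comm.1 hU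
  have : (sqNorm (v ᵥ* U) : ℂ) = sqNorm v := by
    rw [sqNorm_eq_star_dotProduct, sqNorm_eq_star_dotProduct, Matrix.star_vecMul,
      Matrix.dotProduct_mulVec, Matrix.vecMul_vecMul, hU', Matrix.vecMul_one]
  exact_mod_cast this

/-- The law of a vector with i.i.d. complex normal entries is invariant under unitary maps. -/
lemma measurePreserving_vecMul {n : ℕ} {U : Matrix (Fin n) (Fin n) ℂ} (hU : Uᴴ * U = 1) :
    MeasurePreserving (fun v => v ᵥ* U) (fadingLaw n) (fadingLaw n) := by
  have hm : Measurable fun v : Fin n → ℂ => v ᵥ* U := by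
    unfold Matrix.vecMul dotProduct; fun_prop
  refine ⟨hm, ?_⟩
  have hdet : ‖U.det‖ = 1 := by
    have := congrArg Matrix.det hU
    rw [Matrix.det_mul, Matrix.det_conjTranspose, Matrix.det_one] at this
    have h2 := congrArg norm this
    rw [norm_mul, norm_star, norm_one] at h2
    nlinarith [norm_nonneg U.det]
  -- Volume on `ℂⁿ` scales by the real determinant, which for a complex-linear map is `|det U|² =
  -- 1`.
  let L : (Fin n → ℂ) →ₗ[ℝ] (Fin n → ℂ) := (Matrix.toLinearMapRight' U).restrictScalars ℝ
  have hL : LinearMap.det L = 1 := by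
    rw [LinearMap.det_restrictScalars, Algebra.norm_complex_apply, Complex.normSq_eq_norm_sq]
    have : LinearMap.det (Matrix.toLinearMapRight' U) = U.det := by
      have h : Matrix.toLinearMapRight' U = Matrix.toLin' Uᵀ := by
        ext; simp [Matrix.toLinearMapRight'_apply]
      rw [h, LinearMap.det_toLin', Matrix.det_transpose]
    rw [this, hdet, one_pow]
  have hvol : (volume : Measure (Fin n → ℂ)).map (fun v => v ᵥ* U) = volume := by
    have := Measure.map_linearMap_addHaar_eq_smul_addHaar (volume : Measure (Fin n → ℂ)) (f := L) (by simp [hL])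
    rw [hL] at this
    simp only [inv_one, abs_one, ENNReal.ofReal_one, one_smul] at this
    exact this
  rw [fadingLaw_eq_withDensity]
  ext s hs
  rw [Measure.map_apply hm hs, withDensity_apply _ (hm hs), withDensity_apply _ hs]
  conv_rhs => rw [← hvol, setLIntegral_map hs (by fun_prop) hm]
  simp_rw [sqNorm_vecMul hU]

/-- A unit vector is the first column of a unitary matrix. -/
lemma exists_unitary_first_column {m : ℕ} {w : Fin (m + 1) → ℂ} (hw : sqNorm w = 1) :
    ∃ U : Matrix (Fin (m + 1)) (Fin (m + 1)) ℂ, Uᴴ * U = 1 ∧ ∀ i, U i 0 = w i := by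
  -- The family is constant, but only its value at index `0` is prescribed for the orthonormal
  -- basis.
  let v : Fin (m + 1) → EuclideanSpace ℂ (Fin (m + 1)) := fun _ => WithLp.toLp 2 w
  have hv : Orthonormal ℂ (({0} : Set (Fin (m + 1))).domRestrict v) := by
    constructor
    · intro i
      have : ‖WithLp.toLp 2 w‖ ^ 2 = 1 := by rw [EuclideanSpace.norm_sq_eq]; exact hw
      exact (pow_eq_one_iff_of_nonneg (norm_nonneg _) two_ne_zero).1 this
    · intro i j hij
      exact absurd (Subsingleton.elim i j) hij
  obtain ⟨b, hb⟩ := hv.exists_orthonormalBasis_extension_of_card_eq (by simp)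
  refine ⟨Matrix.of fun i j => b j i, ?_, fun i => ?_⟩
  · ext i j
    have := (orthonormal_iff_ite.1 b.orthonormal) i j
    rw [Matrix.mul_apply, Matrix.one_apply, ← this, PiLp.inner_apply]
    refine Finset.sum_congr rfl fun k _ => ?_
    simp [mul_comm]
  · simp [hb 0 rfl, v]

/-! ### The channel gain of the legitimate receiver -/

/-- The inductive step for the Erlang tail: if the first gain is `y ≤ ν`, the other `n` must exceed
`ν - y`. The exponentials merge into `e^{-ν}`, and integrating each power raises its degree by one.
-/
lemma setLIntegral_exp_tail_step (n : ℕ) {ν : ℝ} (hν : 0 ≤ ν) :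
    ∫⁻ y in Set.Ioc 0 ν, ENNReal.ofReal (Real.exp (-y)) *
      ENNReal.ofReal (Real.exp (-(ν - y)) * ∑ i ∈ Finset.range n, (ν - y) ^ i / (i.factorial : ℝ)) =
    ENNReal.ofReal (Real.exp (-ν) * ∑ i ∈ Finset.range n, ν ^ (i + 1) / ((i + 1).factorial : ℝ)) := by
  have h1 : ∀ y ∈ Set.Ioc 0 ν, ENNReal.ofReal (Real.exp (-y)) *
      ENNReal.ofReal (Real.exp (-(ν - y)) * ∑ i ∈ Finset.range n, (ν - y) ^ i / (i.factorial : ℝ)) =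
      ENNReal.ofReal (Real.exp (-ν) * ∑ i ∈ Finset.range n, (ν - y) ^ i / (i.factorial : ℝ)) := by
    intro y _
    rw [← ENNReal.ofReal_mul (by positivity), ← mul_assoc, ← Real.exp_add]
    congr 3; ring
  have hc : Continuous fun y : ℝ => Real.exp (-ν) * ∑ i ∈ Finset.range n, (ν - y) ^ i / (i.factorial : ℝ) := by
    fun_prop
  rw [setLIntegral_congr_fun measurableSet_Ioc h1,
    ← ofReal_integral_eq_lintegral_ofReal (hc.integrableOn_Ioc) ?_]
  · congr 1
    rw [← intervalIntegral.integral_of_le hν, intervalIntegral.integral_const_mul,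
      intervalIntegral.integral_finsetSum fun i _ => Continuous.intervalIntegrable (by fun_prop) _ _]
    congr 1
    refine Finset.sum_congr rfl fun i _ => ?_
    rw [intervalIntegral.integral_div, intervalIntegral.integral_comp_sub_left (fun y => y ^ i), integral_pow]
    simp [Nat.factorial_succ]
    field_simp
  · filter_upwards [ae_restrict_mem measurableSet_Ioc] with y hy
    have : 0 ≤ ν - y := sub_nonneg.2 hy.2
    exact mul_nonneg (Real.exp_pos _).le (Finset.sum_nonneg fun i _ => by positivity)

lemma setLIntegral_Ioi_exp_neg (ν : ℝ) :
    ∫⁻ y in Set.Ioi ν, ENNReal.ofReal (Real.exp (-y)) = ENNReal.ofReal (Real.exp (-ν)) := by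
  rw [← ofReal_integral_eq_lintegral_ofReal (integrableOn_exp_neg_Ioi ν)
    (Eventually.of_forall fun _ => by positivity), integral_exp_neg_Ioi]

/-- The squared norm of a vector of `n` i.i.d. complex normal entries has an Erlang law. -/
lemma fadingLaw_lt_sqNorm (n : ℕ) {ν : ℝ} (hν : 0 ≤ ν) :
    fadingLaw n {v | ν < sqNorm v} =
      ENNReal.ofReal (Real.exp (-ν) * ∑ i ∈ Finset.range n, ν ^ i / (i.factorial : ℝ)) := by
  induction n generalizing ν with
  | zero => simp [sqNorm, hν.not_gt]
  | succ n ih =>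
    have hm : MeasurableSet {q : ℂ × (Fin n → ℂ) | ν < ‖q.1‖ ^ 2 + sqNorm q.2} :=
      measurableSet_lt (by fun_prop) (by fun_prop)
    have hmr : MeasurableSet {q : ℝ × (Fin n → ℂ) | ν < q.1 + sqNorm q.2} :=
      measurableSet_lt (by fun_prop) (by fun_prop)
    have h1 := (measurePreserving_piFinSuccAbove (fun _ : Fin (n + 1) => stdComplexNormal) 0).measure_preimage
      hm.nullMeasurableSet
    have h2 : (MeasurableEquiv.piFinSuccAbove (fun _ : Fin (n + 1) => ℂ) 0) ⁻¹'
        {q : ℂ × (Fin n → ℂ) | ν < ‖q.1‖ ^ 2 + sqNorm q.2} = {v | ν < sqNorm v} := by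
      ext v
      simp only [Set.mem_preimage, Set.mem_ofPred_eq, sqNorm, Fin.sum_univ_succ]
      rfl
    rw [h2] at h1
    have hF : Measurable fun y : ℝ => fadingLaw n {v | ν < y + sqNorm v} :=
      measurable_measure_prodMk_left (ν := fadingLaw n) hmr
    have h3 : fadingLaw (n + 1) {v | ν < sqNorm v} = ∫⁻ y, fadingLaw n {v | ν < y + sqNorm v} ∂(expMeasure 1) := by
      rw [← map_norm_sq_stdComplexNormal, lintegral_map hF (by fun_prop)]
      refine h1.trans ((Measure.prod_apply (μ := stdComplexNormal) (ν := fadingLaw n) hm).trans ?_)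
      rfl
    -- Beyond `ν` the first gain suffices on its own; that part supplies the missing term `i = 0` of
    -- the Erlang sum.
    rw [h3, lintegral_expMeasure_one hF, ← Set.Ioc_union_Ioi_eq_Ioi hν,
      lintegral_union measurableSet_Ioi (Set.Ioc_disjoint_Ioi le_rfl)]
    have h4 : ∀ y ∈ Set.Ioc 0 ν, ENNReal.ofReal (Real.exp (-y)) * fadingLaw n {v | ν < y + sqNorm v} =
        ENNReal.ofReal (Real.exp (-y)) *
          ENNReal.ofReal (Real.exp (-(ν - y)) * ∑ i ∈ Finset.range n, (ν - y) ^ i / (i.factorial : ℝ)) := by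
      intro y hy
      rw [← ih (sub_nonneg.2 hy.2)]
      simp_rw [sub_lt_iff_lt_add']
    have h5 : ∀ y ∈ Set.Ioi ν, ENNReal.ofReal (Real.exp (-y)) * fadingLaw n {v | ν < y + sqNorm v} =
        ENNReal.ofReal (Real.exp (-y)) := by
      intro y hy
      have : {v : Fin n → ℂ | ν < y + sqNorm v} = Set.univ := by
        ext v
        simp only [Set.mem_ofPred_eq, Set.mem_univ, iff_true]
        have : ν < y := hy
        linarith [sqNorm_nonneg v]
      rw [this, measure_univ, mul_one]
    rw [setLIntegral_congr_fun measurableSet_Ioc h4, setLIntegral_congr_fun measurableSet_Ioi h5,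
      setLIntegral_exp_tail_step n hν, setLIntegral_Ioi_exp_neg,
      ← ENNReal.ofReal_add (by positivity) (by positivity), Finset.sum_range_succ']
    congr 1
    simp; ring

/-! ### The SINR at one eavesdropper -/

lemma sqNorm_beam {n : ℕ} {g : Fin n → ℂ} (hg : sqNorm g ≠ 0) : sqNorm (beam g) = 1 := by
  have h : ∀ j, ‖beam g j‖ ^ 2 = ‖g j‖ ^ 2 / sqNorm g := by
    intro j
    rw [beam, norm_div, norm_star, div_pow, Complex.norm_real, Real.norm_eq_abs, sq_abs,
      Real.sq_sqrt (sqNorm_nonneg g)]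
  rw [sqNorm]
  simp_rw [h]
  rw [← Finset.sum_div]
  exact div_self hg

/-- With `w` adjoined as first column, `G` becomes unitary, and the claim is Parseval's identity.
This eliminates `G` from the SINR. -/
lemma sqNorm_vecMul_complement {n : ℕ} {w : Fin n → ℂ} (hw : sqNorm w = 1)
    {G : Matrix (Fin n) (Fin (n - 1)) ℂ} (hG : CompletesBeam w G) (h : Fin n → ℂ) :
    sqNorm (h ᵥ* G) = sqNorm h - ‖w ⬝ᵥ h‖ ^ 2 := by
  cases n with
  | zero => simp [sqNorm] at hw
  | succ m =>
    obtain ⟨h1, h2⟩ := hG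
    -- The index `m + 1 - 1` reduces to `m` by definition, which lets `Fin.cons` typecheck.
    change Matrix (Fin (m + 1)) (Fin m) ℂ at G
    change Gᴴ * G = (1 : Matrix (Fin m) (Fin m) ℂ) at h1
    change Gᴴ *ᵥ w = (0 : Fin m → ℂ) at h2
    let U : Matrix (Fin (m + 1)) (Fin (m + 1)) ℂ := Matrix.of fun i => Fin.cons (w i) (G i)
    have hw' : star w ⬝ᵥ w = 1 := by
      rw [dotProduct_comm, ← sqNorm_eq_star_dotProduct, hw]; simp
    have hU : Uᴴ * U = 1 := by
      ext i j
      refine Fin.cases ?_ (fun i => ?_) i <;> refine Fin.cases ?_ (fun j => ?_) j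
      · simpa [U, Matrix.mul_apply, dotProduct] using hw'
      · have := congrArg star (congrFun h2 j)
        simp only [Matrix.mulVec, dotProduct, Matrix.conjTranspose_apply, star_sum, star_mul', star_star] at this
        simp only [U, Matrix.mul_apply, Matrix.conjTranspose_apply, Matrix.of_apply, Fin.cons_zero, Fin.cons_succ]
        rw [Matrix.one_apply_ne (Fin.succ_ne_zero j).symm]
        simpa [mul_comm] using this
      · have := congrFun h2 i
        simp only [Matrix.mulVec, dotProduct, Matrix.conjTranspose_apply] at this
        simp only [U, Matrix.mul_apply, Matrix.conjTranspose_apply, Matrix.of_apply, Fin.cons_zero, Fin.cons_succ]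
        rw [Matrix.one_apply_ne (Fin.succ_ne_zero i)]
        simpa using this
      · have := congrFun (congrFun h1 i) j
        simp only [Matrix.mul_apply, Matrix.conjTranspose_apply] at this
        simp only [U, Matrix.mul_apply, Matrix.conjTranspose_apply, Matrix.of_apply, Fin.cons_succ]
        rw [this]
        simp [Matrix.one_apply]
    have h3 := sqNorm_vecMul hU h
    rw [← h3]
    have h4 : sqNorm (h ᵥ* U) = ‖w ⬝ᵥ h‖ ^ 2 + sqNorm (h ᵥ* G) := by
      rw [sqNorm, Fin.sum_univ_succ, sqNorm]
      congr 2
      · rw [dotProduct_comm]; rfl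
    change sqNorm (h ᵥ* G : Fin m → ℂ) = _
    rw [h4]; ring

/-- Averages over the fading vector of functions of the beamformed and the residual gain. -/
lemma lintegral_fadingLaw_beam {n : ℕ} {w : Fin n → ℂ} (hw : sqNorm w = 1) {F : ℝ → ℝ → ℝ≥0∞}
    (hF : Measurable (Function.uncurry F)) :
    ∫⁻ h, F (‖w ⬝ᵥ h‖ ^ 2) (sqNorm h - ‖w ⬝ᵥ h‖ ^ 2) ∂(fadingLaw n) =
      ∫⁻ v, ∫⁻ z, F (‖z‖ ^ 2) (sqNorm v) ∂stdComplexNormal ∂(fadingLaw (n - 1)) := by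
  cases n with
  | zero => simp [sqNorm] at hw
  | succ m =>
    obtain ⟨U, hU, hUw⟩ := exists_unitary_first_column hw
    change _ = ∫⁻ v, ∫⁻ z, F (‖z‖ ^ 2) (sqNorm v) ∂stdComplexNormal ∂(fadingLaw m)
    have hF' : Measurable (Function.uncurry fun (z : ℂ) (v : Fin m → ℂ) => F (‖z‖ ^ 2) (sqNorm v)) :=
      hF.comp (f := fun q : ℂ × (Fin m → ℂ) => (‖q.1‖ ^ 2, sqNorm q.2)) (by fun_prop)
    have hF'' : Measurable fun v : Fin (m + 1) → ℂ => F (‖v 0‖ ^ 2) (sqNorm fun j : Fin m => v j.succ) :=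
      hF.comp (f := fun v : Fin (m + 1) → ℂ => (‖v 0‖ ^ 2, sqNorm fun j : Fin m => v j.succ)) (by fun_prop)
    -- Rotating by `U` preserves the law and turns `w ⬝ᵥ h` into the first coordinate, independent
    -- of the others.
    rw [← lintegral_fadingLaw_succ m hF', ← (measurePreserving_vecMul hU).lintegral_comp hF'']
    refine lintegral_congr fun h => ?_
    have h0 : (h ᵥ* U) 0 = w ⬝ᵥ h := by
      rw [dotProduct_comm]
      simp [Matrix.vecMul, dotProduct, hUw]
    have h1 : sqNorm h = ‖(h ᵥ* U) 0‖ ^ 2 + sqNorm fun j : Fin m => (h ᵥ* U) j.succ := by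
      rw [← sqNorm_vecMul hU, sqNorm, Fin.sum_univ_succ, sqNorm]
    rw [← h0, h1]
    congr 1; ring

/-- The SINR as a function of the beamformer, the location and the fading vector. -/
def effSinr (p : Params) (w : Fin p.nT → ℂ) (x : EuclideanSpace ℝ (Fin 2)) (h : Fin p.nT → ℂ) : ℝ :=
  p.zeta * p.Ps * ‖x‖ ^ (-p.eta) * ‖w ⬝ᵥ h‖ ^ 2 /
    ((1 - p.zeta) * p.Ps * (sqNorm h - ‖w ⬝ᵥ h‖ ^ 2) * ‖x‖ ^ (-p.eta) / ((p.nT : ℝ) - 1) + p.sigma)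

lemma sinr_eq_effSinr (p : Params) {w : Fin p.nT → ℂ} (hw : sqNorm w = 1)
    {G : Matrix (Fin p.nT) (Fin (p.nT - 1)) ℂ} (hG : CompletesBeam w G)
    (x : EuclideanSpace ℝ (Fin 2)) (h : Fin p.nT → ℂ) : sinr p w G x h = effSinr p w x h := by
  rw [sinr, effSinr, sqNorm_vecMul_complement hw hG]

/-- The tail of the law of the SINR at an eavesdropper at distance `r`. -/
def sinrTail (p : Params) (r y : ℝ) : ℝ :=
  Real.exp (-(y * p.sigma / (p.zeta * p.Ps) * r ^ p.eta)) *
    (1 + (1 / p.zeta - 1) / ((p.nT : ℝ) - 1) * y) ^ (1 - (p.nT : ℝ))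

lemma Params.nT_sub_one_pos (p : Params) : 0 < (p.nT : ℝ) - 1 := by
  have : (2 : ℝ) ≤ p.nT := by exact_mod_cast p.two_le_nT
  linarith

lemma Params.one_sub_zeta_pos (p : Params) : 0 < 1 - p.zeta := sub_pos.2 p.zeta_lt_one

lemma Params.one_div_zeta_sub_one_pos (p : Params) : 0 < 1 / p.zeta - 1 :=
  sub_pos.2 ((one_lt_div p.zeta_pos).2 p.zeta_lt_one)

/-- Clearing the denominator turns a threshold on the SINR into one on the beamformed gain `u` that
is affine in the residual gain `V`. -/
lemma lt_sinr_iff (p : Params) {r y u V : ℝ} (hr : 0 < r) (hV : 0 ≤ V) :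
    y < p.zeta * p.Ps * r ^ (-p.eta) * u /
      ((1 - p.zeta) * p.Ps * V * r ^ (-p.eta) / ((p.nT : ℝ) - 1) + p.sigma) ↔
    y * p.sigma / (p.zeta * p.Ps) * r ^ p.eta + (1 / p.zeta - 1) / ((p.nT : ℝ) - 1) * y * V < u := by
  have hn := p.nT_sub_one_pos
  have hz := p.one_sub_zeta_pos
  have := p.zeta_pos
  have := p.Ps_pos
  have := p.sigma_pos
  have hre : 0 < r ^ p.eta := Real.rpow_pos_of_pos hr _
  rw [Real.rpow_neg hr.le, lt_div_iff₀ (by positivity)]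
  have key : y * ((1 - p.zeta) * p.Ps * V * (r ^ p.eta)⁻¹ / ((p.nT : ℝ) - 1) + p.sigma) =
      p.zeta * p.Ps * (r ^ p.eta)⁻¹ *
        (y * p.sigma / (p.zeta * p.Ps) * r ^ p.eta + (1 / p.zeta - 1) / ((p.nT : ℝ) - 1) * y * V) := by
    field_simp
    ring
  rw [key, mul_lt_mul_iff_of_pos_left (by positivity)]

lemma sinr_eq_iff (p : Params) {r y u V : ℝ} (hr : 0 < r) (hV : 0 ≤ V) :
    p.zeta * p.Ps * r ^ (-p.eta) * u /
      ((1 - p.zeta) * p.Ps * V * r ^ (-p.eta) / ((p.nT : ℝ) - 1) + p.sigma) = y ↔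
    u = y * p.sigma / (p.zeta * p.Ps) * r ^ p.eta + (1 / p.zeta - 1) / ((p.nT : ℝ) - 1) * y * V := by
  have hn := p.nT_sub_one_pos
  have hz := p.one_sub_zeta_pos
  have := p.zeta_pos
  have := p.Ps_pos
  have := p.sigma_pos
  have hre : 0 < r ^ p.eta := Real.rpow_pos_of_pos hr _
  rw [Real.rpow_neg hr.le, div_eq_iff (by positivity)]
  have key : y * ((1 - p.zeta) * p.Ps * V * (r ^ p.eta)⁻¹ / ((p.nT : ℝ) - 1) + p.sigma) =
      p.zeta * p.Ps * (r ^ p.eta)⁻¹ *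
        (y * p.sigma / (p.zeta * p.Ps) * r ^ p.eta + (1 / p.zeta - 1) / ((p.nT : ℝ) - 1) * y * V) := by
    field_simp
    ring
  rw [key, mul_right_inj' (by positivity)]

/-- Given the residual gain `V`, the exponential beamformed gain exceeds `d + c V` with probability
`e^{-d - cV}`; averaging over the `nT - 1` residual coordinates gives `(1 + c)^{-(nT - 1)}`. The
origin is excluded because there `‖x‖ ^ (-η)` takes the default value `0`. -/
lemma fadingLaw_lt_effSinr (p : Params) {w : Fin p.nT → ℂ} (hw : sqNorm w = 1)
    {x : EuclideanSpace ℝ (Fin 2)} (hx : x ≠ 0) {y : ℝ} (hy : 0 ≤ y) :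
    fadingLaw p.nT {h | y < effSinr p w x h} = ENNReal.ofReal (sinrTail p ‖x‖ y) := by
  have hr : 0 < ‖x‖ := norm_pos_iff.2 hx
  have hn := p.nT_sub_one_pos
  have hz := p.one_div_zeta_sub_one_pos
  have := p.zeta_pos
  have := p.Ps_pos
  have := p.sigma_pos
  let F : ℝ → ℝ → ℝ≥0∞ := fun u V => (Set.Ioi y).indicator (fun _ => 1) (p.zeta * p.Ps * ‖x‖ ^ (-p.eta) * u /
      ((1 - p.zeta) * p.Ps * V * ‖x‖ ^ (-p.eta) / ((p.nT : ℝ) - 1) + p.sigma))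
  have hF : Measurable (Function.uncurry F) :=
    (measurable_const.indicator measurableSet_Ioi).comp (f := fun q : ℝ × ℝ => p.zeta * p.Ps * ‖x‖ ^ (-p.eta) * q.1 /
      ((1 - p.zeta) * p.Ps * q.2 * ‖x‖ ^ (-p.eta) / ((p.nT : ℝ) - 1) + p.sigma)) (by fun_prop)
  have hm : MeasurableSet {h | y < effSinr p w x h} := by
    unfold effSinr dotProduct
    exact measurableSet_lt (by fun_prop) (by fun_prop)
  rw [← lintegral_indicator_one hm]
  have h1 := lintegral_fadingLaw_beam hw hF
  refine Eq.trans ?_ (h1.trans ?_)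
  · rfl
  set c := (1 / p.zeta - 1) / ((p.nT : ℝ) - 1) * y
  set d := y * p.sigma / (p.zeta * p.Ps) * ‖x‖ ^ p.eta
  have hc : 0 ≤ c := by positivity
  have hd : 0 ≤ d := by positivity
  have h2 : ∀ v : Fin (p.nT - 1) → ℂ, ∫⁻ z, F (‖z‖ ^ 2) (sqNorm v) ∂stdComplexNormal =
      ENNReal.ofReal (Real.exp (-d)) * ∏ j, ENNReal.ofReal (Real.exp (-(c * ‖v j‖ ^ 2))) := by
    intro v
    have h3 : ∀ z : ℂ, F (‖z‖ ^ 2) (sqNorm v) = {z : ℂ | d + c * sqNorm v < ‖z‖ ^ 2}.indicator 1 z := by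
      intro z
      simp only [F, Set.indicator_apply, Set.mem_Ioi, Set.mem_ofPred_eq, lt_sinr_iff p hr (sqNorm_nonneg v)]
      rfl
    simp_rw [h3]
    have := sqNorm_nonneg v
    rw [lintegral_indicator_one (measurableSet_lt (by fun_prop) (by fun_prop)),
      stdComplexNormal_lt_norm_sq (by positivity), neg_add, Real.exp_add, ENNReal.ofReal_mul (by positivity)]
    rw [← ENNReal.ofReal_prod_of_nonneg (fun _ _ => by positivity), ← Real.exp_sum, sqNorm, Finset.mul_sum,
      Finset.sum_neg_distrib]
  simp_rw [h2]
  rw [lintegral_const_mul _ (by fun_prop), fadingLaw,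
    lintegral_fin_prod _ (fun _ z => ENNReal.ofReal (Real.exp (-(c * ‖z‖ ^ 2)))) (by fun_prop)]
  simp_rw [lintegral_exp_neg_mul_norm_sq hc]
  rw [Finset.prod_const, Finset.card_univ, Fintype.card_fin, ← ENNReal.ofReal_pow (by positivity),
    ← ENNReal.ofReal_mul (by positivity), sinrTail]
  congr 2
  rw [show 1 - (p.nT : ℝ) = -((p.nT - 1 : ℕ) : ℝ) by
    rw [Nat.cast_sub (by linarith [p.two_le_nT])]; simp, Real.rpow_neg (by positivity), Real.rpow_natCast, inv_pow]

/-- Given the residual gain, the event puts the first coordinate on a fixed circle, a null set.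
Hence strict and weak thresholds are interchangeable. -/
lemma fadingLaw_effSinr_eq (p : Params) {w : Fin p.nT → ℂ} (hw : sqNorm w = 1)
    {x : EuclideanSpace ℝ (Fin 2)} (hx : x ≠ 0) (y : ℝ) :
    fadingLaw p.nT {h | effSinr p w x h = y} = 0 := by
  have hr : 0 < ‖x‖ := norm_pos_iff.2 hx
  let F : ℝ → ℝ → ℝ≥0∞ := fun u V => ({y} : Set ℝ).indicator (fun _ => 1) (p.zeta * p.Ps * ‖x‖ ^ (-p.eta) * u /
      ((1 - p.zeta) * p.Ps * V * ‖x‖ ^ (-p.eta) / ((p.nT : ℝ) - 1) + p.sigma))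
  have hF : Measurable (Function.uncurry F) :=
    (measurable_const.indicator (measurableSet_singleton y)).comp (f := fun q : ℝ × ℝ => p.zeta * p.Ps * ‖x‖ ^ (-p.eta) * q.1 /
      ((1 - p.zeta) * p.Ps * q.2 * ‖x‖ ^ (-p.eta) / ((p.nT : ℝ) - 1) + p.sigma)) (by fun_prop)
  have hm : MeasurableSet {h | effSinr p w x h = y} := by
    unfold effSinr dotProduct
    exact measurableSet_eq_fun (by fun_prop) (by fun_prop)
  rw [← lintegral_indicator_one hm]
  have h1 := lintegral_fadingLaw_beam hw hF
  refine Eq.trans ?_ (h1.trans ?_)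
  · rfl
  refine (lintegral_congr fun v => ?_).trans lintegral_zero
  have h3 : ∀ z : ℂ, F (‖z‖ ^ 2) (sqNorm v) = {z : ℂ | ‖z‖ ^ 2 = y * p.sigma / (p.zeta * p.Ps) * ‖x‖ ^ p.eta +
      (1 / p.zeta - 1) / ((p.nT : ℝ) - 1) * y * sqNorm v}.indicator 1 z := by
    intro z
    simp only [F, Set.indicator_apply, Set.mem_singleton_iff, Set.mem_ofPred_eq, sinr_eq_iff p hr (sqNorm_nonneg v)]
    rfl
  simp_rw [h3]
  rw [lintegral_indicator_one (measurableSet_eq_fun (by fun_prop) (by fun_prop)), stdComplexNormal_norm_sq_eq]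

/-! ### Integrals over the plane -/

lemma norm_dotProduct_sq_le {n : ℕ} {w : Fin n → ℂ} (hw : sqNorm w = 1) (h : Fin n → ℂ) :
    ‖w ⬝ᵥ h‖ ^ 2 ≤ sqNorm h := by
  cases n with
  | zero => simp [sqNorm] at hw
  | succ m =>
    obtain ⟨U, hU, hUw⟩ := exists_unitary_first_column hw
    have h0 : (h ᵥ* U) 0 = w ⬝ᵥ h := by
      rw [dotProduct_comm]
      simp [Matrix.vecMul, dotProduct, hUw]
    rw [← sqNorm_vecMul hU, ← h0]
    exact Finset.single_le_sum (f := fun j => ‖(h ᵥ* U) j‖ ^ 2) (fun _ _ => by positivity) (Finset.mem_univ 0)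

lemma effSinr_nonneg (p : Params) {w : Fin p.nT → ℂ} (hw : sqNorm w = 1)
    (x : EuclideanSpace ℝ (Fin 2)) (h : Fin p.nT → ℂ) : 0 ≤ effSinr p w x h := by
  have hn := p.nT_sub_one_pos
  have hz := p.one_sub_zeta_pos
  have := p.zeta_pos
  have := p.Ps_pos
  have := p.sigma_pos
  have := sub_nonneg.2 (norm_dotProduct_sq_le hw h)
  unfold effSinr
  positivity

@[fun_prop] lemma measurable_effSinr (p : Params) :
    Measurable fun q : (Fin p.nT → ℂ) × EuclideanSpace ℝ (Fin 2) × (Fin p.nT → ℂ) =>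
      effSinr p q.1 q.2.1 q.2.2 := by
  unfold effSinr dotProduct
  fun_prop

/-- The integral of the tail of the SINR over the plane. -/
def tailMass (p : Params) (y : ℝ) : ℝ :=
  Real.pi * Real.Gamma (1 + 2 / p.eta) * (p.zeta * (p.Ps / p.sigma) / y) ^ (2 / p.eta) *
    (1 + (1 / p.zeta - 1) / ((p.nT : ℝ) - 1) * y) ^ (1 - (p.nT : ℝ))

lemma Params.eta_pos (p : Params) : 0 < p.eta := two_pos.trans p.two_lt_eta

lemma Params.aOne_pos (p : Params) : 0 < p.zeta * (p.Ps / p.sigma) :=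
  mul_pos p.zeta_pos (div_pos p.Ps_pos p.sigma_pos)

lemma volume_real_unitBall_plane :
    (volume : Measure (EuclideanSpace ℝ (Fin 2))).real (Metric.ball 0 1) = Real.pi := by
  rw [Measure.real, EuclideanSpace.volume_ball]
  simp [one_add_one_eq_two, Real.pi_pos.le]

/-- In polar coordinates this is `2π ∫ r e^{-b r^η} dr = (2π/η) Γ(2/η) b^{-2/η}`, and `(2/η) Γ(2/η)
= Γ(1 + 2/η)`. -/
lemma lintegral_exp_neg_mul_norm_rpow {η b : ℝ} (hη : 0 < η) (hb : 0 < b) :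
    ∫⁻ x : EuclideanSpace ℝ (Fin 2), ENNReal.ofReal (Real.exp (-(b * ‖x‖ ^ η))) =
      ENNReal.ofReal (Real.pi * Real.Gamma (1 + 2 / η) * b ^ (-(2 / η))) := by
  have hd : Module.finrank ℝ (EuclideanSpace ℝ (Fin 2)) = 2 := by simp
  have hi : Integrable (fun x : EuclideanSpace ℝ (Fin 2) => Real.exp (-(b * ‖x‖ ^ η))) := by
    rw [integrable_fun_norm_addHaar volume (f := fun r => Real.exp (-(b * r ^ η))), hd]
    refine (integrableOn_rpow_mul_exp_neg_mul_rpow (s := 1) (by norm_num) hη hb).congr_fun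
      (fun r _ => ?_) measurableSet_Ioi
    simp
  rw [← ofReal_integral_eq_lintegral_ofReal hi (Eventually.of_forall fun _ => by positivity)]
  congr 1
  rw [integral_fun_norm_addHaar volume (fun r => Real.exp (-(b * r ^ η))), hd, volume_real_unitBall_plane]
  have h := integral_rpow_mul_exp_neg_mul_rpow (p := η) (q := 1) hη (by norm_num) hb
  have h2 : ∫ y in Set.Ioi (0 : ℝ), y ^ (2 - 1) • Real.exp (-(b * y ^ η)) =
      ∫ x in Set.Ioi (0 : ℝ), x ^ (1 : ℝ) * Real.exp (-b * x ^ η) := by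
    refine setIntegral_congr_fun measurableSet_Ioi fun r _ => ?_
    simp
  rw [h2, h, add_comm 1 (2 / η), Real.Gamma_add_one (by positivity)]
  rw [show (1 : ℝ) + 1 = 2 by norm_num, neg_div]
  simp only [smul_eq_mul, nsmul_eq_mul]
  push_cast
  ring

lemma lintegral_sinrTail (p : Params) {y : ℝ} (hy : 0 < y) :
    ∫⁻ x : EuclideanSpace ℝ (Fin 2), ENNReal.ofReal (sinrTail p ‖x‖ y) = ENNReal.ofReal (tailMass p y) := by
  have hn := p.nT_sub_one_pos
  have hz := p.one_div_zeta_sub_one_pos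
  have h1 := p.zeta_pos
  have h2 := p.Ps_pos
  have h3 := p.sigma_pos
  have hD : 0 ≤ (1 + (1 / p.zeta - 1) / ((p.nT : ℝ) - 1) * y) ^ (1 - (p.nT : ℝ)) := by positivity
  simp_rw [sinrTail, fun x : ℝ => ENNReal.ofReal_mul' (p := x) hD]
  rw [lintegral_mul_const _ (by fun_prop), lintegral_exp_neg_mul_norm_rpow p.eta_pos (by positivity),
    ← ENNReal.ofReal_mul' hD, tailMass]
  congr 3
  rw [Real.rpow_neg (by positivity), ← Real.inv_rpow (by positivity)]
  congr 1
  field_simp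

/-! ### The Laplace exponent and its Whittaker form. -/

/-- The average over the fading vector of `1 - e^{-s γ}` for the SINR `γ` at distance `r`. -/
def tailLaplace (p : Params) (s r : ℝ) : ℝ≥0∞ :=
  ∫⁻ t in Set.Ioi 0, ENNReal.ofReal (sinrTail p r t) * ENNReal.ofReal (s * Real.exp (-(s * t)))

@[fun_prop] lemma measurable_sinrTail (p : Params) : Measurable fun q : ℝ × ℝ => sinrTail p q.1 q.2 := by
  unfold sinrTail; fun_prop

lemma measurable_tailLaplace (p : Params) (s : ℝ) : Measurable (tailLaplace p s) := by
  unfold tailLaplace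
  refine Measurable.lintegral_prod_right' (f := fun q : ℝ × ℝ =>
    ENNReal.ofReal (sinrTail p q.1 q.2) * ENNReal.ofReal (s * Real.exp (-(s * q.2)))) ?_
  exact (measurable_sinrTail p).ennreal_ofReal.mul (by fun_prop)

/-- The layer-cake formula, with `1 - e^{-sγ} = ∫₀^γ s e^{-st} dt`. -/
lemma lintegral_one_sub_exp_effSinr (p : Params) {w : Fin p.nT → ℂ} (hw : sqNorm w = 1)
    {x : EuclideanSpace ℝ (Fin 2)} (hx : x ≠ 0) {s : ℝ} (hs : 0 ≤ s) :
    ∫⁻ h, ENNReal.ofReal (1 - Real.exp (-(s * effSinr p w x h))) ∂(fadingLaw p.nT) =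
      tailLaplace p s ‖x‖ := by
  have hint : ∀ y : ℝ, ∫ t in (0 : ℝ)..y, s * Real.exp (-(s * t)) = 1 - Real.exp (-(s * y)) := by
    intro y
    have hd : ∀ t ∈ Set.uIcc 0 y, HasDerivAt (fun t => -Real.exp (-(s * t))) (s * Real.exp (-(s * t))) t := by
      intro t _
      refine (((hasDerivAt_id t).const_mul s).neg.exp.neg).congr_deriv ?_
      simp; ring
    rw [intervalIntegral.integral_eq_sub_of_hasDerivAt hd (Continuous.intervalIntegrable (by fun_prop) _ _)]
    simp; ring
  have hm : Measurable fun h => effSinr p w x h :=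
    (measurable_effSinr p).comp (f := fun h => (w, x, h)) (by fun_prop)
  have h := lintegral_comp_eq_lintegral_meas_lt_mul (fadingLaw p.nT)
    (Eventually.of_forall (effSinr_nonneg p hw x)) hm.aemeasurable (g := fun t => s * Real.exp (-(s * t)))
    (fun t _ => Continuous.intervalIntegrable (by fun_prop) _ _)
    (Eventually.of_forall fun t => mul_nonneg hs (Real.exp_pos _).le)
  simp_rw [hint] at h
  rw [h, tailLaplace]
  refine setLIntegral_congr_fun measurableSet_Ioi fun t ht => ?_
  rw [fadingLaw_lt_effSinr p hw hx (le_of_lt ht)]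

/-- The integral over the plane of the average of `1 - e^{-s γ}`. -/
def laplaceMass (p : Params) (s : ℝ) : ℝ :=
  ∫ t in Set.Ioi (0 : ℝ), tailMass p t * (s * Real.exp (-(s * t)))

lemma tailMass_nonneg (p : Params) {y : ℝ} (hy : 0 ≤ y) : 0 ≤ tailMass p y := by
  have hn := p.nT_sub_one_pos
  have hz := p.one_div_zeta_sub_one_pos
  have := p.aOne_pos
  have := p.eta_pos
  have : 0 < Real.Gamma (1 + 2 / p.eta) := Real.Gamma_pos_of_pos (by positivity)
  unfold tailMass
  positivity

/-- The integrand is of order `t^{-2/η}` at `0`, integrable because `η > 2`; the exponential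
controls infinity. The finiteness of the total interference rests on this. -/
lemma integrableOn_tailMass (p : Params) {s : ℝ} (hs : 0 < s) :
    IntegrableOn (fun t => tailMass p t * (s * Real.exp (-(s * t)))) (Set.Ioi 0) := by
  have hn := p.nT_sub_one_pos
  have hz := p.one_div_zeta_sub_one_pos
  have ha := p.aOne_pos
  have he := p.eta_pos
  have hG : 0 < Real.Gamma (1 + 2 / p.eta) := Real.Gamma_pos_of_pos (by positivity)
  have hlt : 2 / p.eta < 1 := (div_lt_one he).2 p.two_lt_eta
  have h1 := (integrableOn_rpow_mul_exp_neg_mul_rpow (s := -(2 / p.eta)) (p := 1) (by linarith) one_pos hs).const_mul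
    (Real.pi * Real.Gamma (1 + 2 / p.eta) * (p.zeta * (p.Ps / p.sigma)) ^ (2 / p.eta) * s)
  refine Integrable.mono' h1 (Measurable.aestronglyMeasurable (by unfold tailMass; fun_prop)) ?_
  filter_upwards [ae_restrict_mem measurableSet_Ioi] with t ht
  have ht' : 0 < t := ht
  have h0 := tailMass_nonneg p ht'.le
  rw [Real.norm_of_nonneg (by positivity), tailMass, Real.div_rpow ha.le ht'.le, Real.rpow_one, Real.rpow_neg ht'.le]
  have hle : (1 + (1 / p.zeta - 1) / ((p.nT : ℝ) - 1) * t) ^ (1 - (p.nT : ℝ)) ≤ 1 :=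
    Real.rpow_le_one_of_one_le_of_nonpos (le_add_of_nonneg_right (by positivity)) (by linarith)
  calc _ = (Real.pi * Real.Gamma (1 + 2 / p.eta) * (p.zeta * (p.Ps / p.sigma)) ^ (2 / p.eta) * s *
        ((t ^ (2 / p.eta))⁻¹ * Real.exp (-s * t))) *
        (1 + (1 / p.zeta - 1) / ((p.nT : ℝ) - 1) * t) ^ (1 - (p.nT : ℝ)) := by rw [neg_mul]; ring
    _ ≤ _ := mul_le_of_le_one_right (by positivity) hle

lemma lintegral_tailLaplace (p : Params) {s : ℝ} (hs : 0 < s) :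
    ∫⁻ x : EuclideanSpace ℝ (Fin 2), tailLaplace p s ‖x‖ = ENNReal.ofReal (laplaceMass p s) := by
  unfold tailLaplace
  have hm := (measurable_sinrTail p).comp (f := fun q : EuclideanSpace ℝ (Fin 2) × ℝ => (‖q.1‖, q.2)) (by fun_prop)
  rw [lintegral_lintegral_swap (hm.ennreal_ofReal.mul (by fun_prop)).aemeasurable, laplaceMass,
    ofReal_integral_eq_lintegral_ofReal (integrableOn_tailMass p hs)]
  · refine setLIntegral_congr_fun measurableSet_Ioi fun t ht => ?_
    have hmt : Measurable fun x : EuclideanSpace ℝ (Fin 2) => ENNReal.ofReal (sinrTail p ‖x‖ t) :=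
      (hm.comp (measurable_prodMk_right (y := t))).ennreal_ofReal
    rw [lintegral_mul_const _ hmt,
      ENNReal.ofReal_mul (tailMass_nonneg p (le_of_lt ht)), ← lintegral_sinrTail p ht]
  · filter_upwards [ae_restrict_mem measurableSet_Ioi] with t ht
    exact mul_nonneg (tailMass_nonneg p (le_of_lt ht)) (by positivity)

lemma varsigma_pos (p : Params) : 0 < varsigma p :=
  div_pos (mul_pos p.zeta_pos p.nT_sub_one_pos) p.one_sub_zeta_pos

lemma varrho_pos (p : Params) : 0 < varrho p :=
  div_pos (mul_pos p.one_sub_zeta_pos (div_pos p.Ps_pos p.sigma_pos)) p.nT_sub_one_pos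

lemma aOne_eq (p : Params) : aOne p = varsigma p * varrho p := by
  have := p.nT_sub_one_pos
  have := p.one_sub_zeta_pos
  have := p.sigma_pos
  rw [aOne, varsigma, varrho]
  field_simp

/-- Substitute `t ↦ ς t`: since `(1/ζ - 1)/(nT - 1) = 1/ς`, the artificial-noise factor becomes `(1
+ t)^{1 - nT}`, as in the Whittaker integral. -/
lemma laplaceMass_eq (p : Params) (s : ℝ) :
    laplaceMass p s = Real.pi * Real.Gamma (1 + 2 / p.eta) * varrho p ^ (2 / p.eta) * varsigma p * s *
      ∫ t in Set.Ioi (0 : ℝ), Real.exp (-(varsigma p * s) * t) * t ^ (-(2 / p.eta)) * (1 + t) ^ (1 - (p.nT : ℝ)) := by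
  have hσ := varsigma_pos p
  have hϱ := varrho_pos p
  have h1 := integral_comp_mul_left_Ioi (fun t => tailMass p t * (s * Real.exp (-(s * t)))) 0 hσ
  rw [mul_zero, smul_eq_mul, eq_inv_mul_iff_mul_eq₀ hσ.ne'] at h1
  rw [laplaceMass, ← h1, ← integral_const_mul, ← integral_const_mul]
  refine setIntegral_congr_fun measurableSet_Ioi fun t ht => ?_
  have ht' : 0 < t := ht
  have ha := aOne_eq p
  rw [aOne] at ha
  have hc : (1 / p.zeta - 1) / ((p.nT : ℝ) - 1) * (varsigma p * t) = t := by
    have := p.nT_sub_one_pos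
    have := p.one_sub_zeta_pos
    have := p.zeta_pos
    rw [varsigma]
    field_simp
  simp only [tailMass]
  rw [hc, ha, mul_div_mul_left _ _ hσ.ne', Real.div_rpow hϱ.le ht'.le, Real.rpow_neg ht'.le]
  rw [show -(s * (varsigma p * t)) = -(varsigma p * s) * t by ring]
  ring

/-- For these indices the Whittaker integrand has exponents `-2/η` and `1 - nT`. Its prefactor
`1/Γ(1 - 2/η)` cancels against the Beta function, `e^{ςs/2}` cancels against `e^{-ςs/2}`, and `a₁ =
ς ϱ` collects the powers. -/
lemma laplaceCE_eq (p : Params) {s : ℝ} (hs : 0 < s) :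
    laplaceCE p s = Real.exp (-(p.lam * laplaceMass p s)) := by
  have hσ := varsigma_pos p
  have hϱ := varrho_pos p
  have he := p.eta_pos
  have hlt : 2 / p.eta < 1 := (div_lt_one he).2 p.two_lt_eta
  have hδ : 0 < 2 / p.eta := by positivity
  rw [laplaceCE, laplaceMass_eq p s, whittakerW, calB, beta, aOne_eq]
  set J := ∫ t in Set.Ioi (0 : ℝ), Real.exp (-(varsigma p * s) * t) * t ^ (-(2 / p.eta)) * (1 + t) ^ (1 - (p.nT : ℝ)) with hJ
  set δ := 2 / p.eta with hδdef
  have e1 : (2 - (p.nT : ℝ) - δ) / 2 - (1 - (p.nT : ℝ) + δ) / 2 + 1 / 2 = 1 - δ := by ring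
  have e2 : (2 - (p.nT : ℝ) - δ) / 2 - (1 - (p.nT : ℝ) + δ) / 2 - 1 / 2 = -δ := by ring
  have e3 : (2 - (p.nT : ℝ) - δ) / 2 + (1 - (p.nT : ℝ) + δ) / 2 - 1 / 2 = 1 - (p.nT : ℝ) := by ring
  rw [e1, e2, e3, ← hJ, add_sub_cancel, Real.Gamma_one, div_one, add_comm 1 δ, Real.Gamma_add_one hδ.ne']
  have hG : 0 < Real.Gamma (1 - δ) := Real.Gamma_pos_of_pos (by linarith)
  have hexp : Real.exp (varsigma p * s / 2) * Real.exp (-(varsigma p * s) / 2) = 1 := by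
    rw [← Real.exp_add, neg_div, add_neg_cancel, Real.exp_zero]
  have hpow : varrho p ^ ((1 - (p.nT : ℝ) + δ) / 2) * (varsigma p * varrho p * s) ^ (((p.nT : ℝ) - 1 + δ) / 2) *
      (varsigma p * s) ^ ((2 - (p.nT : ℝ) - δ) / 2 + 1 / 2) = varrho p ^ δ * varsigma p * s := by
    have f1 : varrho p ^ δ = varrho p ^ ((1 - (p.nT : ℝ) + δ) / 2) * varrho p ^ (((p.nT : ℝ) - 1 + δ) / 2) := by
      rw [← Real.rpow_add hϱ]; congr 1; ring
    have f2 : varsigma p * s = (varsigma p * s) ^ (((p.nT : ℝ) - 1 + δ) / 2) *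
        (varsigma p * s) ^ ((2 - (p.nT : ℝ) - δ) / 2 + 1 / 2) := by
      rw [← Real.rpow_add (by positivity)]
      conv_lhs => rw [← Real.rpow_one (varsigma p * s)]
      congr 1; ring
    rw [show varsigma p * varrho p * s = varrho p * (varsigma p * s) by ring,
      Real.mul_rpow hϱ.le (by positivity), mul_assoc (varrho p ^ δ), f1]
    linear_combination (-(varrho p ^ ((1 - (p.nT : ℝ) + δ) / 2) * varrho p ^ (((p.nT : ℝ) - 1 + δ) / 2))) * f2
  congr 1
  calc _ = -(p.lam * (Real.pi * (2 / p.eta * Real.Gamma δ) *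
        (varrho p ^ ((1 - (p.nT : ℝ) + δ) / 2) * (varsigma p * varrho p * s) ^ (((p.nT : ℝ) - 1 + δ) / 2) *
          (varsigma p * s) ^ ((2 - (p.nT : ℝ) - δ) / 2 + 1 / 2)) *
        (Real.exp (varsigma p * s / 2) * Real.exp (-(varsigma p * s) / 2)) * J)) *
          (Real.Gamma (1 - δ) / Real.Gamma (1 - δ)) := by ring
    _ = _ := by rw [hpow, hexp, div_self hG.ne', ← hδdef]; ring

lemma laplaceCE_zero (p : Params) : laplaceCE p 0 = 1 := by
  have := p.nT_sub_one_pos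
  have := p.eta_pos
  rw [laplaceCE, mul_zero (aOne p), Real.zero_rpow (by positivity)]
  simp

/-! ### Averages over one slot by successive conditioning. -/

/-- Fubini as a substitute for conditional expectation: `A` is frozen at one sample point while `B`
is averaged over another. -/
lemma lintegral_of_indepFun {Ω α β : Type*} [MeasurableSpace Ω] [MeasurableSpace α] [MeasurableSpace β]
    {P : Measure Ω} [IsProbabilityMeasure P] {A : Ω → α} {B : Ω → β} (hA : Measurable A) (hB : Measurable B)
    (hAB : IndepFun A B P) {F : α → β → ℝ≥0∞} (hF : Measurable (Function.uncurry F)) :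
    ∫⁻ ω, F (A ω) (B ω) ∂P = ∫⁻ ω₁, ∫⁻ ω₂, F (A ω₁) (B ω₂) ∂P ∂P := by
  have h1 : ∫⁻ ω, F (A ω) (B ω) ∂P = ∫⁻ q, Function.uncurry F q ∂(P.map fun ω => (A ω, B ω)) := by
    rw [lintegral_map hF (hA.prodMk hB)]; rfl
  have := Measure.isProbabilityMeasure_map (μ := P) hB.aemeasurable
  rw [h1, (indepFun_iff_map_prod_eq_prod_map_map hA.aemeasurable hB.aemeasurable).1 hAB, lintegral_prod _ hF.aemeasurable,
    lintegral_map hF.lintegral_prod_right' hA]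
  refine lintegral_congr fun ω => ?_
  exact lintegral_map (hF.comp measurable_prodMk_left) hB

/-- A generalized inverse of `expNeg`. -/
def negLog (u : ℝ≥0∞) : ℝ≥0∞ := (-(ENNReal.log u)).toENNReal

lemma measurable_negLog : Measurable negLog :=
  measurable_ereal_toENNReal.comp ((continuous_neg.comp ENNReal.continuous_log).measurable)

lemma expNeg_negLog {u : ℝ≥0∞} (hu : u ≤ 1) : expNeg (negLog u) = u := by
  have : 0 ≤ -(ENNReal.log u) := by
    rw [EReal.neg_nonneg]
    simpa using hu
  rw [expNeg, negLog, EReal.coe_toENNReal this, neg_neg, ENNReal.exp_log]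

@[fun_prop] lemma measurable_beam {n : ℕ} : Measurable (beam (n := n)) := by
  unfold beam; fun_prop

/-- Convergence forces `1 - e^{-γ i} → 0`, and where this is below `1/2` one has `γ i ≤ 2 (1 - e^{-γ
i})`. -/
lemma summable_of_tsum_one_sub_exp_neg {γ : ℕ → ℝ} (h0 : ∀ i, 0 ≤ γ i)
    (h : ∑' i, ENNReal.ofReal (1 - Real.exp (-γ i)) ≠ ∞) : Summable γ := by
  have h01 : ∀ i, 0 ≤ 1 - Real.exp (-γ i) := fun i => by simp [h0 i]
  have h6 : Summable fun i => 1 - Real.exp (-γ i) :=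
    (ENNReal.summable_toReal h).congr fun i => ENNReal.toReal_ofReal (h01 i)
  have h7 := h6.tendsto_atTop_zero.eventually (gt_mem_nhds (show (0 : ℝ) < 1 / 2 by norm_num))
  refine Summable.of_norm_bounded_eventually_nat (g := fun i => 2 * (1 - Real.exp (-γ i))) (h6.mul_left 2) ?_
  filter_upwards [h7] with i hi
  rw [Real.norm_of_nonneg (h0 i)]
  have h8 : Real.exp (-γ i) * Real.exp (γ i) = 1 := by rw [← Real.exp_add]; simp
  have h9 := Real.add_one_le_exp (γ i)
  -- From `e^γ ≥ 1 + γ` follows `γ e^{-γ} ≤ 1 - e^{-γ}`, and here `e^{-γ} > 1/2`.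
  nlinarith [Real.exp_pos (-γ i), h0 i]

section Slot

variable {Ω : Type*} [MeasurableSpace Ω] {P : Measure Ω} {p : Params}
  {g : ℕ → Ω → Fin p.nT → ℂ}
  {X : ℕ → ℕ → Ω → EuclideanSpace ℝ (Fin 2)}
  {h : ℕ → ℕ → Ω → Fin p.nT → ℂ}
  {G : ℕ → Ω → Matrix (Fin p.nT) (Fin (p.nT - 1)) ℂ}

lemma measureReal_confSlot (henv : IsEnvironment P p g X h G) (t : ℕ) :
    P.real (confSlot p g t) = prConf p := by
  have h1 := (henv.law_g t).measure_eq (p := fun v => p.nu < sqNorm v)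
    (measurableSet_lt measurable_const measurable_sqNorm)
  rw [Measure.real, confSlot, h1, fadingLaw_lt_sqNorm _ p.nu_nonneg, ENNReal.toReal_ofReal, prConf]
  have := p.nu_nonneg
  positivity

/-- Campbell's formula for the indicator of the origin, which has zero area. -/
lemma ae_location_ne_zero (henv : IsEnvironment P p g X h G) (t : ℕ) :
    ∀ᵐ ω ∂P, ∀ i, X t i ω ≠ 0 := by
  rw [ae_all_iff]
  intro i
  have h1 := (henv.ppp t).lintegral_tsum p.lam_pos.le (v := ({0} : Set _).indicator 1)
    (measurable_one.indicator (measurableSet_singleton _))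
  rw [lintegral_indicator_one (measurableSet_singleton _)] at h1
  simp only [measure_singleton, mul_zero, ENNReal.tsum_eq_zero] at h1
  have h2 := h1 i
  have hm : MeasurableSet {ω | X t i ω = 0} := (henv.ppp t).measurable i (measurableSet_singleton _)
  have h3 : ∀ ω, ({0} : Set _).indicator (1 : EuclideanSpace ℝ (Fin 2) → ℝ≥0∞) (X t i ω) =
      {ω | X t i ω = 0}.indicator 1 ω := fun ω => rfl
  simp_rw [h3] at h2
  rw [lintegral_indicator_one hm] at h2
  exact measure_eq_zero_iff_ae_notMem.1 h2

lemma measurable_slot (henv : IsEnvironment P p g X h G) (t i : ℕ) :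
    Measurable fun ω => (beam (g t ω), X t i ω, h t i ω) :=
  (measurable_beam.comp (henv.measurable_g t)).prodMk
    (((henv.ppp t).measurable i).prodMk (henv.measurable_h t i))

lemma measurable_effSinr_slot (henv : IsEnvironment P p g X h G) (t i : ℕ) :
    Measurable fun ω => effSinr p (beam (g t ω)) (X t i ω) (h t i ω) := by
  have := (measurable_effSinr p).comp (measurable_slot henv t i)
  exact this

variable [IsProbabilityMeasure P]

/-- Only a vanishing estimate yields a non-unit beam, and the Erlang tail at `0` equals `1`. -/
lemma ae_sqNorm_beam (henv : IsEnvironment P p g X h G) (t : ℕ) :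
    ∀ᵐ ω ∂P, sqNorm (beam (g t ω)) = 1 := by
  have h1 := (henv.law_g t).measure_eq (p := fun v => 0 < sqNorm v)
    (measurableSet_lt measurable_const measurable_sqNorm)
  rw [fadingLaw_lt_sqNorm _ le_rfl] at h1
  have h2 : Real.exp (-0) * ∑ i ∈ Finset.range p.nT, (0 : ℝ) ^ i / (i.factorial : ℝ) = 1 := by
    rw [Finset.sum_eq_single_of_mem 0 (Finset.mem_range.2 (two_pos.trans_le p.two_le_nT))
      (fun i _ hi => by simp [hi])]
    simp
  rw [h2, ENNReal.ofReal_one] at h1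
  have hm : MeasurableSet {ω | 0 < sqNorm (g t ω)} :=
    measurableSet_lt measurable_const (measurable_sqNorm.comp (henv.measurable_g t))
  filter_upwards [(prob_compl_eq_zero_iff hm).2 h1 |> compl_mem_ae_iff.2] with ω hω
  rw [compl_compl] at hω
  exact sqNorm_beam (ne_of_gt hω)

/-- `G` carries no measurability assumption; this replaces the SINR almost surely by a measurable
function of the remaining data. -/
lemma ae_eveSinr_eq (henv : IsEnvironment P p g X h G) (t : ℕ) :
    ∀ᵐ ω ∂P, ∀ i, eveSinr p g X h G t i ω = effSinr p (beam (g t ω)) (X t i ω) (h t i ω) := by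
  filter_upwards [ae_sqNorm_beam henv t] with ω hω i
  exact sinr_eq_effSinr p hω (henv.completes t ω) _ _

/-- Condition on the locations, then on `g`. The fading vectors are then i.i.d. and each factor
averages to `u (x i)`, which is free of `g`; hence the factorization. -/
lemma lintegral_slot_prod (henv : IsEnvironment P p g X h G) (t : ℕ)
    {e : (Fin p.nT → ℂ) → EuclideanSpace ℝ (Fin 2) → (Fin p.nT → ℂ) → ℝ≥0∞}
    (he : Measurable fun q : (Fin p.nT → ℂ) × EuclideanSpace ℝ (Fin 2) × (Fin p.nT → ℂ) => e q.1 q.2.1 q.2.2)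
    {u : EuclideanSpace ℝ (Fin 2) → ℝ≥0∞} (hu : Measurable u)
    (heu : ∀ w, sqNorm w = 1 → ∀ x ≠ 0, ∫⁻ h, e w x h ∂(fadingLaw p.nT) = u x)
    {φ : (Fin p.nT → ℂ) → ℝ≥0∞} (hφ : Measurable φ) (N : ℕ) :
    ∫⁻ ω, φ (g t ω) * ∏ i ∈ Finset.range N, e (beam (g t ω)) (X t i ω) (h t i ω) ∂P =
      (∫⁻ ω, φ (g t ω) ∂P) * ∫⁻ ω, ∏ i ∈ Finset.range N, u (X t i ω) ∂P := by
  have hX : Measurable fun ω i => X t i ω := measurable_pi_lambda _ fun i => (henv.ppp t).measurable i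
  have hh : Measurable fun ω i => h t i ω := measurable_pi_lambda _ fun i => henv.measurable_h t i
  have hg := henv.measurable_g t
  let F : (ℕ → EuclideanSpace ℝ (Fin 2)) → ((Fin p.nT → ℂ) × (ℕ → Fin p.nT → ℂ)) → ℝ≥0∞ := fun x q =>
    φ q.1 * ∏ i ∈ Finset.range N, e (beam q.1) (x i) (q.2 i)
  have he' : ∀ i : ℕ, Measurable fun q : (ℕ → EuclideanSpace ℝ (Fin 2)) × ((Fin p.nT → ℂ) × (ℕ → Fin p.nT → ℂ)) =>
      e (beam q.2.1) (q.1 i) (q.2.2 i) := fun i =>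
    he.comp (f := fun q : (ℕ → EuclideanSpace ℝ (Fin 2)) × ((Fin p.nT → ℂ) × (ℕ → Fin p.nT → ℂ)) =>
      (beam q.2.1, q.1 i, q.2.2 i)) (by fun_prop)
  have hF : Measurable (Function.uncurry F) :=
    (hφ.comp (by fun_prop)).mul (Finset.measurable_fun_prod _ fun i _ => he' i)
  have h1 := lintegral_of_indepFun hX (hg.prodMk hh) (henv.indep_locations t) hF
  have h2 : ∀ x : ℕ → EuclideanSpace ℝ (Fin 2), (∀ i, x i ≠ 0) →
      ∫⁻ ω, F x (g t ω, fun i => h t i ω) ∂P = (∫⁻ ω, φ (g t ω) ∂P) * ∏ i ∈ Finset.range N, u (x i) := by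
    intro x hx
    have h3 := lintegral_of_indepFun hg hh (henv.indep_g_h t) (F := fun a b => F x (a, b))
      (hF.comp (measurable_prodMk_left (x := x)))
    have hφg : Measurable fun ω => φ (g t ω) := hφ.comp hg
    rw [h3, ← lintegral_mul_const _ hφg]
    refine lintegral_congr_ae ?_
    filter_upwards [ae_sqNorm_beam henv t] with ω hω
    have hei : ∀ i, Measurable (e (beam (g t ω)) (x i)) := fun i =>
      he.comp (f := fun v => (beam (g t ω), x i, v)) (by fun_prop)
    have hpm : Measurable fun ω' => ∏ i ∈ Finset.range N, e (beam (g t ω)) (x i) (h t i ω') :=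
      Finset.measurable_fun_prod _ fun i _ => (hei i).comp (henv.measurable_h t i)
    simp only [F]
    rw [lintegral_const_mul _ hpm]
    congr 1
    have h4 := lintegral_prod_eq_prod_lintegral_of_indepFun (Finset.range N) _
      ((henv.indep_h t).comp (fun i => e (beam (g t ω)) (x i)) hei) (fun i => (hei i).comp (henv.measurable_h t i))
    simp only [Function.comp_apply] at h4
    rw [h4]
    refine Finset.prod_congr rfl fun i _ => ?_
    rw [(henv.law_h t i).lintegral_comp (hei i).aemeasurable, heu _ hω _ (hx i)]
  refine h1.trans ?_
  have hpm : Measurable fun ω => ∏ i ∈ Finset.range N, u (X t i ω) :=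
    Finset.measurable_fun_prod _ fun i _ => hu.comp ((henv.ppp t).measurable i)
  rw [← lintegral_const_mul _ hpm]
  refine lintegral_congr_ae ?_
  filter_upwards [ae_location_ne_zero henv t] with ω hω
  exact h2 _ hω

/-- Averages over one slot of exponential functionals of the eavesdroppers. -/
theorem lintegral_slot_expNeg (henv : IsEnvironment P p g X h G) (t : ℕ)
    {f : (Fin p.nT → ℂ) → EuclideanSpace ℝ (Fin 2) → (Fin p.nT → ℂ) → ℝ≥0∞}
    (hf : Measurable fun q : (Fin p.nT → ℂ) × EuclideanSpace ℝ (Fin 2) × (Fin p.nT → ℂ) => f q.1 q.2.1 q.2.2)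
    {u : EuclideanSpace ℝ (Fin 2) → ℝ≥0∞} (hu : Measurable u) (hu1 : ∀ x, u x ≤ 1)
    (hfu : ∀ w, sqNorm w = 1 → ∀ x ≠ 0, ∫⁻ h, expNeg (f w x h) ∂(fadingLaw p.nT) = u x)
    {φ : (Fin p.nT → ℂ) → ℝ≥0∞} (hφ : Measurable φ) (hφ1 : ∀ v, φ v ≤ 1) :
    ∫⁻ ω, φ (g t ω) * expNeg (∑' i, f (beam (g t ω)) (X t i ω) (h t i ω)) ∂P =
      (∫⁻ ω, φ (g t ω) ∂P) * expNeg (ENNReal.ofReal p.lam * ∫⁻ x, (1 - u x)) := by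
  have hg := henv.measurable_g t
  have hφg : Measurable fun ω => φ (g t ω) := hφ.comp hg
  have hfm : ∀ i, Measurable fun ω => f (beam (g t ω)) (X t i ω) (h t i ω) := fun i =>
    hf.comp ((measurable_beam.comp hg).prodMk (((henv.ppp t).measurable i).prodMk (henv.measurable_h t i)))
  have key := lintegral_slot_prod henv t (measurable_expNeg.comp hf) hu hfu hφ
  have hlim : ∀ a : ℕ → ℝ≥0∞, Tendsto (fun N => ∏ i ∈ Finset.range N, expNeg (a i)) atTop (𝓝 (expNeg (∑' i, a i))) := by
    intro a
    simp_rw [← expNeg_sum]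
    exact (continuous_expNeg.tendsto _).comp (ENNReal.tendsto_nat_tsum a)
  have hprod : ∀ (a : ℕ → ℝ≥0∞) (N : ℕ), ∏ i ∈ Finset.range N, expNeg (a i) ≤ 1 := fun a N =>
    Finset.prod_le_one' fun i _ => expNeg_le_one _
  have hL : Tendsto (fun N => ∫⁻ ω, φ (g t ω) * ∏ i ∈ Finset.range N,
      expNeg (f (beam (g t ω)) (X t i ω) (h t i ω)) ∂P) atTop
      (𝓝 (∫⁻ ω, φ (g t ω) * expNeg (∑' i, f (beam (g t ω)) (X t i ω) (h t i ω)) ∂P)) := by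
    refine tendsto_lintegral_of_dominated_convergence (fun _ => 1) (fun N => ?_) (fun N => ?_) (by simp) ?_
    · exact hφg.mul (Finset.measurable_fun_prod _ fun i _ => measurable_expNeg.comp (hfm i))
    · exact Eventually.of_forall fun ω => mul_le_one' (hφ1 _) (hprod _ _)
    · exact Eventually.of_forall fun ω => ENNReal.Tendsto.const_mul (hlim _)
        (Or.inr ((hφ1 _).trans_lt ENNReal.one_lt_top).ne)
  -- Writing `u = e^{-v}` with `v` in `[0, ∞]` brings the product over the points into the scope of
  -- the Laplace functional.
  have hv : Measurable fun x => negLog (u x) := measurable_negLog.comp hu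
  have hR : Tendsto (fun N => ∫⁻ ω, ∏ i ∈ Finset.range N, u (X t i ω) ∂P) atTop
      (𝓝 (expNeg (ENNReal.ofReal p.lam * ∫⁻ x, (1 - u x)))) := by
    have h1 := (henv.ppp t).lintegral_expNeg p.lam_pos.le hv
    simp_rw [expNeg_negLog (hu1 _)] at h1
    rw [← h1]
    have h2 : ∀ N ω, ∏ i ∈ Finset.range N, u (X t i ω) = ∏ i ∈ Finset.range N, expNeg (negLog (u (X t i ω))) :=
      fun N ω => Finset.prod_congr rfl fun i _ => (expNeg_negLog (hu1 _)).symm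
    simp_rw [h2]
    refine tendsto_lintegral_of_dominated_convergence (fun _ => 1) (fun N => ?_) (fun N => ?_) (by simp) ?_
    · exact Finset.measurable_fun_prod _ fun i _ => measurable_expNeg.comp (hv.comp ((henv.ppp t).measurable i))
    · exact Eventually.of_forall fun ω => hprod _ _
    · exact Eventually.of_forall fun ω => hlim _
  have hφint : ∫⁻ ω, φ (g t ω) ∂P ≠ ∞ := by
    refine ((lintegral_mono fun ω => hφ1 _).trans_lt ?_).ne
    simp
  refine tendsto_nhds_unique hL ?_
  refine Tendsto.congr (fun N => (key N).symm) ?_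
  exact ENNReal.Tendsto.const_mul hR (Or.inr hφint)

lemma lintegral_eavesdropper (henv : IsEnvironment P p g X h G) (t i : ℕ)
    {e : (Fin p.nT → ℂ) → EuclideanSpace ℝ (Fin 2) → (Fin p.nT → ℂ) → ℝ≥0∞}
    (he : Measurable fun q : (Fin p.nT → ℂ) × EuclideanSpace ℝ (Fin 2) × (Fin p.nT → ℂ) => e q.1 q.2.1 q.2.2)
    {u : EuclideanSpace ℝ (Fin 2) → ℝ≥0∞}
    (heu : ∀ w, sqNorm w = 1 → ∀ x ≠ 0, ∫⁻ h, e w x h ∂(fadingLaw p.nT) = u x) :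
    ∫⁻ ω, e (beam (g t ω)) (X t i ω) (h t i ω) ∂P = ∫⁻ ω, u (X t i ω) ∂P := by
  have hg := henv.measurable_g t
  have hF : Measurable (Function.uncurry fun (x : EuclideanSpace ℝ (Fin 2)) (q : (Fin p.nT → ℂ) × (Fin p.nT → ℂ)) =>
      e (beam q.1) x q.2) :=
    he.comp (f := fun q : EuclideanSpace ℝ (Fin 2) × (Fin p.nT → ℂ) × (Fin p.nT → ℂ) => (beam q.2.1, q.1, q.2.2))
      (by fun_prop)
  have hind : IndepFun (X t i) (fun ω => (g t ω, h t i ω)) P :=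
    (henv.indep_locations t).comp (φ := fun x : ℕ → EuclideanSpace ℝ (Fin 2) => x i)
      (ψ := fun q : (Fin p.nT → ℂ) × (ℕ → Fin p.nT → ℂ) => (q.1, q.2 i)) (by fun_prop) (by fun_prop)
  have hind2 : IndepFun (g t) (h t i) P :=
    (henv.indep_g_h t).comp (φ := id) (ψ := fun q : ℕ → Fin p.nT → ℂ => q i) measurable_id (by fun_prop)
  refine (lintegral_of_indepFun ((henv.ppp t).measurable i) (hg.prodMk (henv.measurable_h t i)) hind hF).trans ?_
  refine lintegral_congr_ae ?_
  filter_upwards [ae_location_ne_zero henv t] with ω hω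
  refine (lintegral_of_indepFun hg (henv.measurable_h t i) hind2 (F := fun a b => e (beam a) (X t i ω) b)
    (hF.comp (measurable_prodMk_left (x := X t i ω)))).trans ?_
  refine (lintegral_congr_ae (g := fun _ => u (X t i ω)) ?_).trans (by simp)
  filter_upwards [ae_sqNorm_beam henv t] with ω' hω'
  rw [← heu _ hω' _ (hω i)]
  exact (henv.law_h t i).lintegral_comp (f := e (beam (g t ω')) (X t i ω))
    (he.comp (f := fun v => (beam (g t ω'), X t i ω, v)) (by fun_prop)).aemeasurable

/-- The wiretap SINRs are almost surely summable. -/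
theorem ae_summable_eveSinr (henv : IsEnvironment P p g X h G) (t : ℕ) :
    ∀ᵐ ω ∂P, Summable fun i => eveSinr p g X h G t i ω := by
  let e : (Fin p.nT → ℂ) → EuclideanSpace ℝ (Fin 2) → (Fin p.nT → ℂ) → ℝ≥0∞ := fun w x v =>
    ENNReal.ofReal (1 - Real.exp (-(1 * effSinr p w x v)))
  have he : Measurable fun q : (Fin p.nT → ℂ) × EuclideanSpace ℝ (Fin 2) × (Fin p.nT → ℂ) => e q.1 q.2.1 q.2.2 :=
    (measurable_const.sub ((measurable_effSinr p).const_mul 1).neg.exp).ennreal_ofReal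
  have hm : ∀ i, Measurable fun ω => e (beam (g t ω)) (X t i ω) (h t i ω) := fun i =>
    (measurable_const.sub ((measurable_effSinr_slot henv t i).const_mul 1).neg.exp).ennreal_ofReal
  have h1 : ∀ i, ∫⁻ ω, e (beam (g t ω)) (X t i ω) (h t i ω) ∂P = ∫⁻ ω, tailLaplace p 1 ‖X t i ω‖ ∂P := fun i =>
    lintegral_eavesdropper henv t i he (u := fun x => tailLaplace p 1 ‖x‖)
      fun w hw x hx => lintegral_one_sub_exp_effSinr p hw hx zero_le_one
  -- By Campbell's formula the mean of `∑ (1 - e^{-γ i})` is `λ` times the finite `laplaceMass p 1`.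
  have h2 : ∫⁻ ω, ∑' i, e (beam (g t ω)) (X t i ω) (h t i ω) ∂P ≠ ∞ := by
    rw [lintegral_tsum fun i => (hm i).aemeasurable]
    simp_rw [h1]
    rw [(henv.ppp t).lintegral_tsum p.lam_pos.le (v := fun x => tailLaplace p 1 ‖x‖)
      ((measurable_tailLaplace p 1).comp measurable_norm), lintegral_tailLaplace p one_pos]
    exact ENNReal.mul_ne_top ENNReal.ofReal_ne_top ENNReal.ofReal_ne_top
  filter_upwards [ae_lt_top (Measurable.tsum hm) h2, ae_eveSinr_eq henv t, ae_sqNorm_beam henv t] with ω h3 h4 h5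
  simp_rw [h4]
  simp only [e, one_mul] at h3
  exact summable_of_tsum_one_sub_exp_neg (fun i => effSinr_nonneg p h5 _ _) h3.ne

end Slot

/-! ### Uniqueness of Laplace transforms -/

/-- On `[-1, 1]` the exponential series is dominated by `|t|^k / k!` and integrates term by term. -/
lemma hasSum_charFun_of_bounded {μ : Measure ℝ} [IsFiniteMeasure μ] (hμ : ∀ᵐ y ∂μ, |y| ≤ 1) (t : ℝ) :
    HasSum (fun k : ℕ => ((t : ℂ) * Complex.I) ^ k / (k.factorial : ℂ) * ((∫ y, y ^ k ∂μ : ℝ) : ℂ)) (charFun μ t) := by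
  let F : ℕ → ℝ → ℂ := fun k y => ((t : ℂ) * Complex.I) ^ k / (k.factorial : ℂ) * ((y ^ k : ℝ) : ℂ)
  have hb : ∀ k, ∀ᵐ y ∂μ, ‖F k y‖ ≤ |t| ^ k / (k.factorial : ℝ) := by
    intro k
    filter_upwards [hμ] with y hy
    simp only [F, norm_mul, norm_div, norm_pow, Complex.norm_real, Complex.norm_I, mul_one, Complex.norm_natCast,
      Real.norm_eq_abs]
    exact mul_le_of_le_one_right (by positivity) (pow_le_one₀ (abs_nonneg y) hy)
  have hint : ∀ k, Integrable (F k) μ := fun k =>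
    Integrable.mono' (integrable_const _) (by fun_prop) (hb k)
  have hsum : Summable fun k => ∫ y, ‖F k y‖ ∂μ := by
    refine Summable.of_nonneg_of_le (fun k => integral_nonneg fun _ => norm_nonneg _) (fun k => ?_)
      ((Real.summable_pow_div_factorial |t|).mul_left (μ.real Set.univ))
    refine (integral_mono_ae (hint k).norm (integrable_const _) (hb k)).trans ?_
    simp
  have h := hasSum_integral_of_summable_integral_norm hint hsum
  have h1 : ∫ y, ∑' k, F k y ∂μ = charFun μ t := by
    rw [charFun_apply_real]
    refine integral_congr_ae (Eventually.of_forall fun y => ?_)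
    have := NormedSpace.expSeries_div_hasSum_exp ((t : ℂ) * y * Complex.I)
    rw [← Complex.exp_eq_exp_ℂ] at this
    simp only
    rw [← this.tsum_eq]
    refine tsum_congr fun k => ?_
    simp only [F]
    push_cast
    ring
  rw [h1] at h
  convert! h using 2 with k
  rw [integral_const_mul, integral_complex_ofReal]

/-- A finite measure on `[-1, 1]` is determined by its moments. -/
lemma measure_ext_of_moments {μ ν : Measure ℝ} [IsFiniteMeasure μ] [IsFiniteMeasure ν]
    (hμ : ∀ᵐ y ∂μ, |y| ≤ 1) (hν : ∀ᵐ y ∂ν, |y| ≤ 1) (h : ∀ k : ℕ, ∫ y, y ^ k ∂μ = ∫ y, y ^ k ∂ν) : μ = ν := by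
  refine Measure.ext_of_charFun (funext fun t => ?_)
  have h1 := hasSum_charFun_of_bounded hμ t
  simp_rw [h] at h1
  exact h1.unique (hasSum_charFun_of_bounded hν t)

/-- A finite measure on `[0, ∞)` is determined by its Laplace transform. -/
theorem measure_ext_of_laplace {μ ν : Measure ℝ} [IsFiniteMeasure μ] [IsFiniteMeasure ν]
    (hμ : ∀ᵐ x ∂μ, 0 ≤ x) (hν : ∀ᵐ x ∂ν, 0 ≤ x)
    (h : ∀ s : ℝ, 0 ≤ s → ∫⁻ x, ENNReal.ofReal (Real.exp (-(s * x))) ∂μ = ∫⁻ x, ENNReal.ofReal (Real.exp (-(s * x))) ∂ν) :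
    μ = ν := by
  have hm : Measurable fun x : ℝ => Real.exp (-x) := by fun_prop
  have hb : ∀ (ρ : Measure ℝ), (∀ᵐ x ∂ρ, 0 ≤ x) → ∀ᵐ y ∂(ρ.map fun x => Real.exp (-x)), |y| ≤ 1 := by
    intro ρ hρ
    rw [ae_map_iff hm.aemeasurable (measurableSet_le (by fun_prop) (by fun_prop))]
    filter_upwards [hρ] with x hx
    rw [abs_of_pos (Real.exp_pos _)]
    simpa using hx
  -- Under `x ↦ e^{-x}` the Laplace transform at the integers becomes the moment sequence of a
  -- measure on `[0, 1]`.
  have hmom : ∀ (ρ : Measure ℝ) (k : ℕ), ∫ y, y ^ k ∂(ρ.map fun x => Real.exp (-x)) =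
      (∫⁻ x, ENNReal.ofReal (Real.exp (-(k * x))) ∂ρ).toReal := by
    intro ρ k
    rw [integral_map hm.aemeasurable (by fun_prop), ← integral_toReal (by fun_prop) (by simp)]
    refine integral_congr_ae (Eventually.of_forall fun x => ?_)
    simp only
    rw [ENNReal.toReal_ofReal (Real.exp_pos _).le, ← Real.exp_nat_mul]
    congr 1; ring
  have key := measure_ext_of_moments (hb μ hμ) (hb ν hν) fun k => by
    rw [hmom, hmom, h k k.cast_nonneg]
  have hinv : ∀ ρ : Measure ℝ, (ρ.map fun x => Real.exp (-x)).map (fun y => -Real.log y) = ρ := by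
    intro ρ
    rw [Measure.map_map (by fun_prop) hm]
    convert! Measure.map_id using 2
    ext x
    simp
  rw [← hinv μ, key, hinv]

lemma indepFun_zero_succ {Ω α : Type*} [MeasurableSpace Ω] [MeasurableSpace α] {P : Measure Ω} [IsProbabilityMeasure P]
    {f : ℕ → Ω → α} (hf : ∀ i, Measurable (f i)) (h : iIndepFun f P) :
    IndepFun (f 0) (fun ω i => f (i + 1) ω) P := by
  refine IndepFun.indepFun_process (hf 0) (fun i => hf (i + 1)) fun I => ?_
  have h1 := h.indepFun_finset {0} (I.image (· + 1)) (by simp) hf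
  exact h1.comp (φ := fun x : ({0} : Finset ℕ) → α => x ⟨0, by simp⟩)
    (ψ := fun (y : (I.image (· + 1) : Finset ℕ) → α) (i : I) => y ⟨(i : ℕ) + 1, Finset.mem_image_of_mem _ i.2⟩) (by fun_prop) (by fun_prop)

/-! ### The wiretap channel with colluding eavesdroppers -/

section Slot

variable {Ω : Type*} [MeasurableSpace Ω] {P : Measure Ω} {p : Params}
  {g : ℕ → Ω → Fin p.nT → ℂ}
  {X : ℕ → ℕ → Ω → EuclideanSpace ℝ (Fin 2)}
  {h : ℕ → ℕ → Ω → Fin p.nT → ℂ}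
  {G : ℕ → Ω → Matrix (Fin p.nT) (Fin (p.nT - 1)) ℂ}

/-- The sum of the SINRs as a measurable function of one slot. -/
def sumSinr (p : Params) (w : Fin p.nT → ℂ) (x : ℕ → EuclideanSpace ℝ (Fin 2)) (v : ℕ → Fin p.nT → ℂ) : ℝ :=
  (∑' i, ENNReal.ofReal (effSinr p w (x i) (v i))).toReal

lemma measurable_sumSinr (p : Params) :
    Measurable fun q : (Fin p.nT → ℂ) × (ℕ → EuclideanSpace ℝ (Fin 2)) × (ℕ → Fin p.nT → ℂ) =>
      sumSinr p q.1 q.2.1 q.2.2 := by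
  refine (Measurable.tsum fun i => ?_).ennreal_toReal
  have h1 : Measurable fun q : (Fin p.nT → ℂ) × (ℕ → EuclideanSpace ℝ (Fin 2)) × (ℕ → Fin p.nT → ℂ) =>
    (q.1, q.2.1 i, q.2.2 i) := by fun_prop
  have h2 := (measurable_effSinr p).comp h1
  exact h2.ennreal_ofReal

/-- No summability is needed: a divergent sum gives `∞`, whose `toReal` is `0`, the default value of
the real `tsum`. -/
lemma sumSinr_eq_tsum (p : Params) {w : Fin p.nT → ℂ} (hw : sqNorm w = 1) (x : ℕ → EuclideanSpace ℝ (Fin 2))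
    (v : ℕ → Fin p.nT → ℂ) : sumSinr p w x v = ∑' i, effSinr p w (x i) (v i) := by
  rw [sumSinr, ENNReal.tsum_toReal_eq fun i => ENNReal.ofReal_ne_top]
  exact tsum_congr fun i => ENNReal.toReal_ofReal (effSinr_nonneg p hw _ _)

lemma measurable_slot_all (henv : IsEnvironment P p g X h G) (t : ℕ) :
    Measurable fun ω => (g t ω, (fun i => X t i ω), fun i => h t i ω) :=
  (henv.measurable_g t).prodMk ((measurable_pi_lambda _ fun i => (henv.ppp t).measurable i).prodMk
    (measurable_pi_lambda _ fun i => henv.measurable_h t i))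

lemma measurable_sumSinr_slot (henv : IsEnvironment P p g X h G) (t : ℕ) :
    Measurable fun ω => sumSinr p (beam (g t ω)) (fun i => X t i ω) (fun i => h t i ω) := by
  have h1 : Measurable fun ω => (beam (g t ω), (fun i => X t i ω), fun i => h t i ω) :=
    (measurable_beam.comp (henv.measurable_g t)).prodMk
      ((measurable_pi_lambda _ fun i => (henv.ppp t).measurable i).prodMk
        (measurable_pi_lambda _ fun i => henv.measurable_h t i))
  have h2 := (measurable_sumSinr p).comp h1
  exact h2

variable [IsProbabilityMeasure P]

lemma ae_wiretapSinr_ce (henv : IsEnvironment P p g X h G) (t : ℕ) :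
    ∀ᵐ ω ∂P, wiretapSinr p g X h G .ce t ω = sumSinr p (beam (g t ω)) (fun i => X t i ω) (fun i => h t i ω) := by
  filter_upwards [ae_eveSinr_eq henv t, ae_sqNorm_beam henv t] with ω h1 h2
  rw [sumSinr_eq_tsum p h2, wiretapSinr]
  exact tsum_congr h1

lemma aemeasurable_wiretapSinr_ce (henv : IsEnvironment P p g X h G) (t : ℕ) :
    AEMeasurable (wiretapSinr p g X h G .ce t) P :=
  ⟨_, measurable_sumSinr_slot henv t, ae_wiretapSinr_ce henv t⟩

lemma ae_wiretapSinr_ce_nonneg (henv : IsEnvironment P p g X h G) (t : ℕ) :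
    ∀ᵐ ω ∂P, 0 ≤ wiretapSinr p g X h G .ce t ω := by
  filter_upwards [ae_wiretapSinr_ce henv t] with ω h1
  rw [h1]
  exact ENNReal.toReal_nonneg

/-- The Laplace transform of the colluding wiretap SINR, jointly with the legitimate channel. -/
theorem lintegral_exp_neg_wiretapSinr (henv : IsEnvironment P p g X h G) (t : ℕ) {s : ℝ} (hs : 0 ≤ s)
    {φ : (Fin p.nT → ℂ) → ℝ≥0∞} (hφ : Measurable φ) (hφ1 : ∀ v, φ v ≤ 1) :
    ∫⁻ ω, φ (g t ω) * ENNReal.ofReal (Real.exp (-(s * wiretapSinr p g X h G .ce t ω))) ∂P =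
      (∫⁻ ω, φ (g t ω) ∂P) * ENNReal.ofReal (laplaceCE p s) := by
  rcases hs.eq_or_lt with rfl | hs0
  · simp [laplaceCE_zero]
  let f : (Fin p.nT → ℂ) → EuclideanSpace ℝ (Fin 2) → (Fin p.nT → ℂ) → ℝ≥0∞ := fun w x v =>
    ENNReal.ofReal (s * effSinr p w x v)
  have hf : Measurable fun q : (Fin p.nT → ℂ) × EuclideanSpace ℝ (Fin 2) × (Fin p.nT → ℂ) => f q.1 q.2.1 q.2.2 :=
    ((measurable_effSinr p).const_mul s).ennreal_ofReal
  let u : EuclideanSpace ℝ (Fin 2) → ℝ≥0∞ := fun x => 1 - tailLaplace p s ‖x‖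
  have hu : Measurable u := measurable_const.sub ((measurable_tailLaplace p s).comp measurable_norm)
  have hsum : ∀ w, sqNorm w = 1 → ∀ x ≠ 0, ∫⁻ v, expNeg (f w x v) ∂(fadingLaw p.nT) + tailLaplace p s ‖x‖ = 1 := by
    intro w hw x hx
    have hm : Measurable fun v => effSinr p w x v := by
      have := (measurable_effSinr p).comp (f := fun v => (w, x, v)) (by fun_prop)
      exact this
    rw [← lintegral_one_sub_exp_effSinr p hw hx hs, ← lintegral_add_right _ (by fun_prop)]
    refine (lintegral_congr fun v => ?_).trans (lintegral_one.trans measure_univ)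
    have h0 := mul_nonneg hs (effSinr_nonneg p hw x v)
    rw [expNeg_ofReal h0, ← ENNReal.ofReal_add (Real.exp_pos _).le (by simpa using h0)]
    simp
  have hfu : ∀ w, sqNorm w = 1 → ∀ x ≠ 0, ∫⁻ v, expNeg (f w x v) ∂(fadingLaw p.nT) = u x := by
    intro w hw x hx
    refine ENNReal.eq_sub_of_add_eq ?_ (hsum w hw x hx)
    exact ne_top_of_le_ne_top ENNReal.one_ne_top ((hsum w hw x hx) ▸ le_add_self)
  have key := lintegral_slot_expNeg henv t hf hu (fun x => tsub_le_self) hfu hφ hφ1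
  have hint : ∫⁻ x, (1 - u x) = ENNReal.ofReal (laplaceMass p s) := by
    rw [← lintegral_tailLaplace p hs0]
    refine lintegral_congr_ae ?_
    have h0 : ∀ᵐ x : EuclideanSpace ℝ (Fin 2), x ≠ 0 := compl_mem_ae_iff.2 (measure_singleton 0)
    -- The bound on `tailLaplace` needs some unit vector, and any typical beam provides one.
    obtain ⟨ω, hω⟩ := (ae_sqNorm_beam henv t).exists
    filter_upwards [h0] with x hx
    exact ENNReal.sub_sub_cancel ENNReal.one_ne_top ((hsum _ hω x hx) ▸ le_add_self)
  rw [hint, ← ENNReal.ofReal_mul p.lam_pos.le, expNeg_ofReal, ← laplaceCE_eq p hs0] at key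
  · rw [← key]
    refine lintegral_congr_ae ?_
    filter_upwards [ae_eveSinr_eq henv t, ae_sqNorm_beam henv t, ae_summable_eveSinr henv t] with ω h1 h2 h3
    have h4 : wiretapSinr p g X h G .ce t ω = ∑' i, effSinr p (beam (g t ω)) (X t i ω) (h t i ω) := tsum_congr h1
    have h0 : ∀ i, 0 ≤ effSinr p (beam (g t ω)) (X t i ω) (h t i ω) := fun i => effSinr_nonneg p h2 _ _
    rw [h4, ← expNeg_ofReal (mul_nonneg hs (tsum_nonneg h0)), ← tsum_mul_left,
      ENNReal.ofReal_tsum_of_nonneg (fun i => mul_nonneg hs (h0 i)) ((h3.congr h1).mul_left s)]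
  · refine mul_nonneg p.lam_pos.le (setIntegral_nonneg measurableSet_Ioi fun y hy => ?_)
    exact mul_nonneg (tailMass_nonneg p (le_of_lt hy)) (by positivity)

/-- A device for null events decided by one fading vector: locations, `g` and the fading of all
eavesdroppers but the first are frozen in turn, so that only `v` is integrated. -/
lemma lintegral_slot_eq_zero (henv : IsEnvironment P p g X h G) (t : ℕ)
    {J : (Fin p.nT → ℂ) → (ℕ → EuclideanSpace ℝ (Fin 2)) → (Fin p.nT → ℂ) → (ℕ → Fin p.nT → ℂ) → ℝ≥0∞}
    (hJ : Measurable fun q : (Fin p.nT → ℂ) × (ℕ → EuclideanSpace ℝ (Fin 2)) × (Fin p.nT → ℂ) × (ℕ → Fin p.nT → ℂ) =>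
      J q.1 q.2.1 q.2.2.1 q.2.2.2)
    (hJ0 : ∀ w, sqNorm w = 1 → ∀ x, x 0 ≠ 0 → ∀ v', ∫⁻ v, J w x v v' ∂(fadingLaw p.nT) = 0) :
    ∫⁻ ω, J (beam (g t ω)) (fun i => X t i ω) (h t 0 ω) (fun i => h t (i + 1) ω) ∂P = 0 := by
  have hg := henv.measurable_g t
  have hX : Measurable fun ω i => X t i ω := measurable_pi_lambda _ fun i => (henv.ppp t).measurable i
  have hh : Measurable fun ω i => h t i ω := measurable_pi_lambda _ fun i => henv.measurable_h t i
  have hh' : Measurable fun ω i => h t (i + 1) ω := measurable_pi_lambda _ fun i => henv.measurable_h t (i + 1)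
  have s1 := lintegral_of_indepFun hX (hg.prodMk hh) (henv.indep_locations t)
    (F := fun x q => J (beam q.1) x (q.2 0) (fun i => q.2 (i + 1)))
    (hJ.comp (f := fun q : (ℕ → EuclideanSpace ℝ (Fin 2)) × (Fin p.nT → ℂ) × (ℕ → Fin p.nT → ℂ) =>
      (beam q.2.1, q.1, q.2.2 0, fun i => q.2.2 (i + 1))) (by fun_prop))
  refine s1.trans ((lintegral_congr_ae ?_).trans lintegral_zero)
  filter_upwards [ae_location_ne_zero henv t] with ω₁ hω₁
  have s2 := lintegral_of_indepFun hg hh (henv.indep_g_h t)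
    (F := fun w v => J (beam w) (fun i => X t i ω₁) (v 0) (fun i => v (i + 1)))
    (hJ.comp (f := fun q : (Fin p.nT → ℂ) × (ℕ → Fin p.nT → ℂ) =>
      (beam q.1, (fun i => X t i ω₁), q.2 0, fun i => q.2 (i + 1))) (by fun_prop))
  refine s2.trans ((lintegral_congr_ae ?_).trans lintegral_zero)
  filter_upwards [ae_sqNorm_beam henv t] with ω₂ hω₂
  have s3 := lintegral_of_indepFun hh' (henv.measurable_h t 0)
    (indepFun_zero_succ (henv.measurable_h t) (henv.indep_h t)).symm
    (F := fun v' v => J (beam (g t ω₂)) (fun i => X t i ω₁) v v')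
    (hJ.comp (f := fun q : (ℕ → Fin p.nT → ℂ) × (Fin p.nT → ℂ) =>
      (beam (g t ω₂), (fun i => X t i ω₁), q.2, q.1)) (by fun_prop))
  refine s3.trans ((lintegral_congr fun ω₃ => ?_).trans lintegral_zero)
  have hJv : Measurable fun v => J (beam (g t ω₂)) (fun i => X t i ω₁) v (fun i => h t (i + 1) ω₃) :=
    hJ.comp (f := fun v : Fin p.nT → ℂ => (beam (g t ω₂), (fun i => X t i ω₁), v, fun i => h t (i + 1) ω₃))
      (by fun_prop)
  rw [(henv.law_h t 0).lintegral_comp hJv.aemeasurable]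
  exact hJ0 _ hω₂ _ (hω₁ 0) _

/-- The sum of the SINRs, with the first eavesdropper separated from the others. -/
def splitSinr (p : Params) (w : Fin p.nT → ℂ) (x : ℕ → EuclideanSpace ℝ (Fin 2)) (v : Fin p.nT → ℂ)
    (v' : ℕ → Fin p.nT → ℂ) : ℝ :=
  effSinr p w (x 0) v + sumSinr p w (fun i => x (i + 1)) v'

lemma measurable_splitSinr (p : Params) :
    Measurable fun q : (Fin p.nT → ℂ) × (ℕ → EuclideanSpace ℝ (Fin 2)) × (Fin p.nT → ℂ) × (ℕ → Fin p.nT → ℂ) =>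
      splitSinr p q.1 q.2.1 q.2.2.1 q.2.2.2 := by
  have h1 := (measurable_effSinr p).comp
    (f := fun q : (Fin p.nT → ℂ) × (ℕ → EuclideanSpace ℝ (Fin 2)) × (Fin p.nT → ℂ) × (ℕ → Fin p.nT → ℂ) =>
      (q.1, q.2.1 0, q.2.2.1)) (by fun_prop)
  have h2 := (measurable_sumSinr p).comp
    (f := fun q : (Fin p.nT → ℂ) × (ℕ → EuclideanSpace ℝ (Fin 2)) × (Fin p.nT → ℂ) × (ℕ → Fin p.nT → ℂ) =>
      (q.1, (fun i => q.2.1 (i + 1)), q.2.2.2)) (by fun_prop)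
  exact h1.add h2

lemma ae_wiretapSinr_ce_eq_splitSinr (henv : IsEnvironment P p g X h G) (t : ℕ) :
    ∀ᵐ ω ∂P, wiretapSinr p g X h G .ce t ω =
      splitSinr p (beam (g t ω)) (fun i => X t i ω) (h t 0 ω) (fun i => h t (i + 1) ω) := by
  filter_upwards [ae_eveSinr_eq henv t, ae_sqNorm_beam henv t, ae_summable_eveSinr henv t] with ω h1 h2 h3
  rw [splitSinr, sumSinr_eq_tsum p h2, wiretapSinr, h3.tsum_eq_zero_add]
  simp_rw [h1]

/-- The colluding wiretap SINR has no atoms. -/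
theorem measure_wiretapSinr_ce_eq (henv : IsEnvironment P p g X h G) (t : ℕ) (c : ℝ) :
    P {ω | wiretapSinr p g X h G .ce t ω = c} = 0 := by
  have hJ : Measurable fun q : (Fin p.nT → ℂ) × (ℕ → EuclideanSpace ℝ (Fin 2)) × (Fin p.nT → ℂ) ×
      (ℕ → Fin p.nT → ℂ) => ({c} : Set ℝ).indicator (1 : ℝ → ℝ≥0∞) (splitSinr p q.1 q.2.1 q.2.2.1 q.2.2.2) := by
    have h1 : Measurable (({c} : Set ℝ).indicator (1 : ℝ → ℝ≥0∞)) :=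
      measurable_one.indicator (measurableSet_singleton c)
    have h2 := h1.comp (measurable_splitSinr p)
    exact h2
  have key := lintegral_slot_eq_zero henv t (J := fun w x v v' => ({c} : Set ℝ).indicator 1 (splitSinr p w x v v')) hJ ?_
  · have hm : Measurable fun ω =>
        splitSinr p (beam (g t ω)) (fun i => X t i ω) (h t 0 ω) (fun i => h t (i + 1) ω) := by
      have h1 : Measurable fun ω => (beam (g t ω), (fun i => X t i ω), h t 0 ω, fun i => h t (i + 1) ω) :=
        (measurable_beam.comp (henv.measurable_g t)).prodMk
          ((measurable_pi_lambda _ fun i => (henv.ppp t).measurable i).prodMk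
            ((henv.measurable_h t 0).prodMk (measurable_pi_lambda _ fun i => henv.measurable_h t (i + 1))))
      have h2 := (measurable_splitSinr p).comp h1
      exact h2
    have hm2 : MeasurableSet {ω | splitSinr p (beam (g t ω)) (fun i => X t i ω) (h t 0 ω)
        (fun i => h t (i + 1) ω) = c} := hm (measurableSet_singleton c)
    have hset : {ω | wiretapSinr p g X h G .ce t ω = c} =ᵐ[P]
        {ω | splitSinr p (beam (g t ω)) (fun i => X t i ω) (h t 0 ω) (fun i => h t (i + 1) ω) = c} := by
      filter_upwards [ae_wiretapSinr_ce_eq_splitSinr henv t] with ω hω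
      exact congrArg (· = c) hω
    rw [measure_congr hset, ← lintegral_indicator_one hm2]
    exact key
  · intro w hw x hx v'
    refine (lintegral_congr_ae ?_).trans lintegral_zero
    -- With the other summands frozen, the first SINR would have to equal one fixed number.
    filter_upwards [compl_mem_ae_iff.2 (fadingLaw_effSinr_eq p hw hx (c - sumSinr p w (fun i => x (i + 1)) v'))] with v hv
    have hv' : splitSinr p w x v v' ∉ ({c} : Set ℝ) := fun hmem => hv (eq_sub_of_add_eq hmem)
    exact Set.indicator_of_notMem hv' _

end Slot

/-! ### Failure probabilities -/

lemma theta_pos (p : Params) : 0 < theta p := by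
  have := p.Ls_pos
  have := p.b_pos
  have := p.B_pos
  have := p.T_pos
  rw [theta, sub_pos]
  exact Real.one_lt_rpow one_lt_two (by positivity)

lemma spectral_lt_iff (p : Params) {γ : ℝ} (hγ : 0 ≤ γ) :
    p.B * p.T / p.b * Real.logb 2 (1 + γ) < p.Ls ↔ γ < theta p := by
  have := p.b_pos
  have := p.B_pos
  have := p.T_pos
  have h1 : p.B * p.T / p.b * Real.logb 2 (1 + γ) < p.Ls ↔ Real.logb 2 (1 + γ) < p.Ls * p.b / (p.B * p.T) := by
    rw [lt_div_iff₀ (by positivity), div_mul_eq_mul_div, div_lt_iff₀ (by positivity), mul_comm (Real.logb _ _)]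
  rw [h1, Real.logb_lt_iff_lt_rpow one_lt_two (by positivity), theta, lt_sub_iff_add_lt']

/-- Strict bounds do not pass to a supremum in general. Here the terms tend to `0`, so all but
finitely many are below `θ/2`, and a finite maximum bounds the rest. -/
lemma ciSup_lt_iff_of_summable {γ : ℕ → ℝ} (hγ : Summable γ) {θ : ℝ} (hθ : 0 < θ) :
    ⨆ i, γ i < θ ↔ ∀ i, γ i < θ := by
  have hev := hγ.tendsto_atTop_zero.eventually (gt_mem_nhds (half_pos hθ))
  obtain ⟨N, hN⟩ := eventually_atTop.1 hev
  let s : Finset ℝ := insert (θ / 2) ((Finset.range N).image γ)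
  have hs : s.Nonempty := Finset.insert_nonempty _ _
  have hle : ∀ i, γ i ≤ s.max' hs := by
    intro i
    by_cases hi : i < N
    · exact s.le_max' _ (Finset.mem_insert_of_mem (Finset.mem_image_of_mem _ (Finset.mem_range.2 hi)))
    · exact (hN i (not_lt.1 hi)).le.trans (s.le_max' _ (Finset.mem_insert_self _ _))
  refine ⟨fun h i => (le_ciSup ⟨_, by rintro _ ⟨i, rfl⟩; exact hle i⟩ i).trans_lt h, fun h => ?_⟩
  refine (ciSup_le hle).trans_lt ?_
  rw [Finset.max'_lt_iff]
  intro y hy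
  rcases Finset.mem_insert.1 hy with rfl | hy
  · linarith
  · obtain ⟨i, _, rfl⟩ := Finset.mem_image.1 hy
    exact h i

section Slot

variable {Ω : Type*} [MeasurableSpace Ω] {P : Measure Ω} {p : Params}
  {g : ℕ → Ω → Fin p.nT → ℂ}
  {X : ℕ → ℕ → Ω → EuclideanSpace ℝ (Fin 2)}
  {h : ℕ → ℕ → Ω → Fin p.nT → ℂ}
  {G : ℕ → Ω → Matrix (Fin p.nT) (Fin (p.nT - 1)) ℂ}

/-- The realizations of a slot in which the eavesdroppers obtain the confidential packets. -/
def slotSuccess (p : Params) (c : Strategy) :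
    Set ((Fin p.nT → ℂ) × (ℕ → EuclideanSpace ℝ (Fin 2)) × (ℕ → Fin p.nT → ℂ)) :=
  {q | p.nu < sqNorm q.1} ∩
    match c with
    | .nce => ⋃ i, {q | theta p ≤ effSinr p (beam q.1) (q.2.1 i) (q.2.2 i)}
    | .ce => {q | theta p ≤ sumSinr p (beam q.1) q.2.1 q.2.2}

lemma measurableSet_slotSuccess (p : Params) (c : Strategy) : MeasurableSet (slotSuccess p c) := by
  refine (measurableSet_lt measurable_const (measurable_sqNorm.comp measurable_fst)).inter ?_
  cases c with
  | nce =>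
    refine MeasurableSet.iUnion fun i => measurableSet_le measurable_const ?_
    have h := (measurable_effSinr p).comp
      (f := fun q : (Fin p.nT → ℂ) × (ℕ → EuclideanSpace ℝ (Fin 2)) × (ℕ → Fin p.nT → ℂ) =>
        (beam q.1, q.2.1 i, q.2.2 i)) (by fun_prop)
    exact h
  | ce =>
    refine measurableSet_le measurable_const ?_
    have h := (measurable_sumSinr p).comp
      (f := fun q : (Fin p.nT → ℂ) × (ℕ → EuclideanSpace ℝ (Fin 2)) × (ℕ → Fin p.nT → ℂ) =>
        (beam q.1, q.2.1, q.2.2)) (by fun_prop)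
    exact h

lemma measurableSet_confSlot (henv : IsEnvironment P p g X h G) (t : ℕ) : MeasurableSet (confSlot p g t) :=
  measurableSet_lt measurable_const (measurable_sqNorm.comp (henv.measurable_g t))

variable [IsProbabilityMeasure P]

lemma ae_mem_wiretapOutage_ce (henv : IsEnvironment P p g X h G) (t : ℕ) :
    ∀ᵐ ω ∂P, ω ∈ wiretapOutage p g X h G .ce t ↔ wiretapSinr p g X h G .ce t ω < theta p := by
  filter_upwards [ae_wiretapSinr_ce_nonneg henv t] with ω h1
  exact spectral_lt_iff p h1

lemma ae_mem_wiretapOutage_nce (henv : IsEnvironment P p g X h G) (t : ℕ) :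
    ∀ᵐ ω ∂P, ω ∈ wiretapOutage p g X h G .nce t ↔
      ∀ i, effSinr p (beam (g t ω)) (X t i ω) (h t i ω) < theta p := by
  filter_upwards [ae_eveSinr_eq henv t, ae_sqNorm_beam henv t, ae_summable_eveSinr henv t] with ω h1 h2 h3
  have h4 : 0 ≤ wiretapSinr p g X h G .nce t ω := Real.iSup_nonneg fun i => by
    rw [h1]; exact effSinr_nonneg p h2 _ _
  refine (spectral_lt_iff p h4).trans ?_
  rw [wiretapSinr, ciSup_lt_iff_of_summable h3 (theta_pos p)]
  simp_rw [h1]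

/-- Expresses success through a fixed measurable set of one slot's data, so that independence of
slots applies. -/
lemma ae_mem_slotSuccess (henv : IsEnvironment P p g X h G) (c : Strategy) (t : ℕ) :
    ∀ᵐ ω ∂P, (ω ∈ confSlot p g t ∧ ω ∉ wiretapOutage p g X h G c t) ↔
      (g t ω, (fun i => X t i ω), fun i => h t i ω) ∈ slotSuccess p c := by
  cases c with
  | nce =>
    filter_upwards [ae_mem_wiretapOutage_nce henv t] with ω h1
    rw [h1]
    simp [slotSuccess, confSlot]
  | ce =>
    filter_upwards [ae_mem_wiretapOutage_ce henv t, ae_wiretapSinr_ce henv t] with ω h1 h2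
    rw [h1, h2]
    simp [slotSuccess, confSlot]

/-- The probability that the eavesdroppers obtain the confidential packets of slot `t`. -/
lemma measureReal_slotSuccess (henv : IsEnvironment P p g X h G) (c : Strategy) (t : ℕ) :
    P.real {ω | (g t ω, (fun i => X t i ω), fun i => h t i ω) ∈ slotSuccess p c} =
      1 - failProb P p g X h G c t := by
  have hC := measurableSet_confSlot henv t
  have hS : MeasurableSet {ω | (g t ω, (fun i => X t i ω), fun i => h t i ω) ∈ slotSuccess p c} :=
    measurable_slot_all henv t (measurableSet_slotSuccess p c)
  have hae : (confSlot p g t \ wiretapOutage p g X h G c t : Set Ω) =ᵐ[P]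
      {ω | (g t ω, (fun i => X t i ω), fun i => h t i ω) ∈ slotSuccess p c} := by
    filter_upwards [ae_mem_slotSuccess henv c t] with ω hω
    exact propext hω
  have hN : NullMeasurableSet (confSlot p g t \ wiretapOutage p g X h G c t) P := ⟨_, hS, hae⟩
  have h1 : P.real (confSlot p g t ∩ wiretapOutage p g X h G c t) +
      P.real (confSlot p g t \ wiretapOutage p g X h G c t) = P.real (confSlot p g t) := by
    have h2 := measureReal_inter_add_sdiff₀ (μ := P) (s := confSlot p g t) hN
    rw [← h2, add_comm]
    congr 2
    · ext ω; simp
    · ext ω; simp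
  rw [← measureReal_congr hae, failProb, measureReal_compl hC, probReal_univ]
  rw [show (ProbabilityTheory.cond P (confSlot p g t)).real (wiretapOutage p g X h G c t) =
    (P.real (confSlot p g t))⁻¹ * P.real (confSlot p g t ∩ wiretapOutage p g X h G c t) from
      by rw [Measure.real, cond_apply hC, ENNReal.toReal_mul, ENNReal.toReal_inv]; rfl]
  -- In the degenerate case the conditional probability is a default value, and its factor `0`
  -- removes it.
  by_cases h0 : P.real (confSlot p g t) = 0
  · rw [h0] at h1 ⊢
    have h3 : 0 ≤ P.real (confSlot p g t ∩ wiretapOutage p g X h G c t) := measureReal_nonneg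
    have h4 : 0 ≤ P.real (confSlot p g t \ wiretapOutage p g X h G c t) := measureReal_nonneg
    linarith
  · rw [mul_inv_cancel_left₀ h0]
    linarith

lemma lintegral_conf_indicator (henv : IsEnvironment P p g X h G) (t : ℕ) :
    ∫⁻ ω, ({v : Fin p.nT → ℂ | p.nu < sqNorm v}.indicator 1 (g t ω) : ℝ≥0∞) ∂P = ENNReal.ofReal (prConf p) := by
  have h1 : ∀ ω, ({v : Fin p.nT → ℂ | p.nu < sqNorm v}.indicator 1 (g t ω) : ℝ≥0∞) =
      (confSlot p g t).indicator 1 ω := fun ω => rfl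
  simp_rw [h1]
  rw [lintegral_indicator_one (measurableSet_confSlot henv t), ← measureReal_confSlot henv t, ofReal_measureReal]

lemma measurable_conf_indicator (p : Params) :
    Measurable ({v : Fin p.nT → ℂ | p.nu < sqNorm v}.indicator (1 : (Fin p.nT → ℂ) → ℝ≥0∞)) :=
  measurable_one.indicator (measurableSet_lt measurable_const measurable_sqNorm)

/-- The failure probability of non-colluding eavesdroppers. -/
theorem failProb_nce (henv : IsEnvironment P p g X h G) (t : ℕ) :
    failProb P p g X h G .nce t = LambdaNCE p := by
  have hθ := theta_pos p
  -- With this choice `expNeg (∑ f)` is the indicator that no eavesdropper reaches `θ`.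
  let f : (Fin p.nT → ℂ) → EuclideanSpace ℝ (Fin 2) → (Fin p.nT → ℂ) → ℝ≥0∞ := fun w x v =>
    (Set.Ici (theta p)).indicator (fun _ => ∞) (effSinr p w x v)
  have hf : Measurable fun q : (Fin p.nT → ℂ) × EuclideanSpace ℝ (Fin 2) × (Fin p.nT → ℂ) => f q.1 q.2.1 q.2.2 := by
    have h1 : Measurable ((Set.Ici (theta p)).indicator (fun _ => (∞ : ℝ≥0∞))) :=
      measurable_const.indicator measurableSet_Ici
    have h2 := h1.comp (measurable_effSinr p)
    exact h2
  let u : EuclideanSpace ℝ (Fin 2) → ℝ≥0∞ := fun x => 1 - ENNReal.ofReal (sinrTail p ‖x‖ (theta p))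
  have hu : Measurable u := by
    have h1 := (measurable_sinrTail p).comp (f := fun x : EuclideanSpace ℝ (Fin 2) => (‖x‖, theta p)) (by fun_prop)
    exact measurable_const.sub h1.ennreal_ofReal
  have hge : ∀ w, sqNorm w = 1 → ∀ x ≠ 0,
      fadingLaw p.nT {v | theta p ≤ effSinr p w x v} = ENNReal.ofReal (sinrTail p ‖x‖ (theta p)) := by
    intro w hw x hx
    rw [← fadingLaw_lt_effSinr p hw hx hθ.le]
    refine measure_congr ?_
    filter_upwards [compl_mem_ae_iff.2 (fadingLaw_effSinr_eq p hw hx (theta p))] with v hv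
    exact propext ⟨fun hle => lt_of_le_of_ne hle (Ne.symm hv), fun hlt => le_of_lt hlt⟩
  have hfu : ∀ w, sqNorm w = 1 → ∀ x ≠ 0, ∫⁻ v, expNeg (f w x v) ∂(fadingLaw p.nT) = u x := by
    intro w hw x hx
    have hm : Measurable fun v => effSinr p w x v := by
      have := (measurable_effSinr p).comp (f := fun v => (w, x, v)) (by fun_prop)
      exact this
    have hmS : MeasurableSet {v | theta p ≤ effSinr p w x v} := measurableSet_le measurable_const hm
    simp only [u]
    rw [← hge w hw x hx, ← prob_compl_eq_one_sub hmS, ← lintegral_indicator_one hmS.compl]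
    refine lintegral_congr fun v => ?_
    by_cases hv : theta p ≤ effSinr p w x v
    · have h1 : v ∉ {v | theta p ≤ effSinr p w x v}ᶜ := fun h => h hv
      rw [Set.indicator_of_notMem h1]
      simp only [f]
      rw [Set.indicator_of_mem (show effSinr p w x v ∈ Set.Ici (theta p) from hv), expNeg_top]
    · have h1 : v ∈ {v | theta p ≤ effSinr p w x v}ᶜ := hv
      rw [Set.indicator_of_mem h1]
      simp only [f]
      rw [Set.indicator_of_notMem (show effSinr p w x v ∉ Set.Ici (theta p) from hv), expNeg_zero]
      rfl
  have key := lintegral_slot_expNeg henv t hf hu (fun x => tsub_le_self) hfu (measurable_conf_indicator p)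
    (fun v => Set.indicator_le_self' (fun _ _ => zero_le) v)
  have hint : ∫⁻ x, (1 - u x) = ENNReal.ofReal (tailMass p (theta p)) := by
    rw [← lintegral_sinrTail p hθ]
    refine lintegral_congr_ae ?_
    have h0 : ∀ᵐ x : EuclideanSpace ℝ (Fin 2), x ≠ 0 := compl_mem_ae_iff.2 (measure_singleton 0)
    obtain ⟨ω, hω⟩ := (ae_sqNorm_beam henv t).exists
    filter_upwards [h0] with x hx
    refine ENNReal.sub_sub_cancel ENNReal.one_ne_top ?_
    rw [← hge _ hω x hx]
    exact prob_le_one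
  have hM := tailMass_nonneg p hθ.le
  rw [hint, ← ENNReal.ofReal_mul p.lam_pos.le, expNeg_ofReal (mul_nonneg p.lam_pos.le hM),
    lintegral_conf_indicator henv t] at key
  have hS : MeasurableSet {ω | (g t ω, (fun i => X t i ω), fun i => h t i ω) ∈ slotSuccess p .nce} :=
    measurable_slot_all henv t (measurableSet_slotSuccess p .nce)
  have hC := measurableSet_confSlot henv t
  have hpc : 0 ≤ prConf p := measureReal_confSlot henv t ▸ measureReal_nonneg
  have hsub : {ω | (g t ω, (fun i => X t i ω), fun i => h t i ω) ∈ slotSuccess p .nce} ⊆ confSlot p g t :=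
    fun ω hω => hω.1
  have h1 : P.real (confSlot p g t \ {ω | (g t ω, (fun i => X t i ω), fun i => h t i ω) ∈ slotSuccess p .nce}) =
      prConf p * Real.exp (-(p.lam * tailMass p (theta p))) := by
    rw [Measure.real, ← lintegral_indicator_one (hC.diff hS)]
    rw [← ENNReal.ofReal_mul hpc] at key
    rw [← ENNReal.toReal_ofReal (mul_nonneg hpc (Real.exp_pos (-(p.lam * tailMass p (theta p)))).le), ← key]
    congr 1
    refine lintegral_congr fun ω => ?_
    by_cases hc : ω ∈ confSlot p g t
    · have hc' : ({v : Fin p.nT → ℂ | p.nu < sqNorm v}.indicator 1 (g t ω) : ℝ≥0∞) = 1 :=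
        Set.indicator_of_mem (show g t ω ∈ {v : Fin p.nT → ℂ | p.nu < sqNorm v} from hc) _
      rw [hc', one_mul]
      by_cases hs : ∃ i, theta p ≤ effSinr p (beam (g t ω)) (X t i ω) (h t i ω)
      · obtain ⟨i, hi⟩ := hs
        have h2 : ∑' i, f (beam (g t ω)) (X t i ω) (h t i ω) = ∞ := by
          refine ENNReal.tsum_eq_top_of_eq_top ⟨i, ?_⟩
          exact Set.indicator_of_mem (show effSinr p (beam (g t ω)) (X t i ω) (h t i ω) ∈ Set.Ici (theta p) from hi) _
        rw [h2, expNeg_top]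
        refine Set.indicator_of_notMem (fun hmem => hmem.2 ⟨hc, ?_⟩) _
        exact Set.mem_iUnion.2 ⟨i, hi⟩
      · have h2 : ∑' i, f (beam (g t ω)) (X t i ω) (h t i ω) = 0 := by
          refine ENNReal.tsum_eq_zero.2 fun i => ?_
          exact Set.indicator_of_notMem
            (show effSinr p (beam (g t ω)) (X t i ω) (h t i ω) ∉ Set.Ici (theta p) from fun hi => hs ⟨i, hi⟩) _
        rw [h2, expNeg_zero]
        have hmem : ω ∈ confSlot p g t \
            {ω | (g t ω, (fun i => X t i ω), fun i => h t i ω) ∈ slotSuccess p .nce} :=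
          ⟨hc, fun hm => hs (Set.mem_iUnion.1 hm.2)⟩
        exact Set.indicator_of_mem hmem _
    · have hc' : ({v : Fin p.nT → ℂ | p.nu < sqNorm v}.indicator 1 (g t ω) : ℝ≥0∞) = 0 :=
        Set.indicator_of_notMem (show g t ω ∉ {v : Fin p.nT → ℂ | p.nu < sqNorm v} from hc) _
      rw [hc', zero_mul]
      exact Set.indicator_of_notMem (fun hmem => hc hmem.1) _
  rw [measureReal_sdiff hsub hS, measureReal_slotSuccess henv .nce t, measureReal_confSlot henv t] at h1
  have h2 : p.lam * tailMass p (theta p) = Real.pi * Real.Gamma (1 + 2 / p.eta) * p.lam *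
        (p.zeta * (p.Ps / p.sigma) / theta p) ^ (2 / p.eta) *
        (1 + (1 / p.zeta - 1) / ((p.nT : ℝ) - 1) * theta p) ^ (1 - (p.nT : ℝ)) := by
    rw [tailMass]; ring
  rw [LambdaNCE, neg_mul, neg_mul, neg_mul, ← h2]
  linarith

/-- The Laplace transform of the colluding wiretap SINR. -/
theorem integral_exp_neg_wiretapSinr (henv : IsEnvironment P p g X h G) (t : ℕ) {s : ℝ} (hs : 0 ≤ s) :
    ∫ ω, Real.exp (-s * wiretapSinr p g X h G .ce t ω) ∂P = laplaceCE p s := by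
  have h1 := lintegral_exp_neg_wiretapSinr henv t hs (φ := fun _ => 1) measurable_const (fun _ => le_rfl)
  simp only [one_mul, lintegral_one, measure_univ] at h1
  have hm := aemeasurable_wiretapSinr_ce henv t
  rw [integral_eq_lintegral_of_nonneg_ae (Eventually.of_forall fun ω => (Real.exp_pos _).le)
    (by fun_prop)]
  simp_rw [neg_mul]
  rw [h1]
  exact ENNReal.toReal_ofReal (by unfold laplaceCE; positivity)

/-- The colluding wiretap SINR is independent of the legitimate channel, and its law is the same in
all slots. -/
theorem measure_confSlot_inter_wiretapSinr (henv : IsEnvironment P p g X h G) (t t' : ℕ) {A : Set ℝ}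
    (hA : MeasurableSet A) :
    P (confSlot p g t ∩ wiretapSinr p g X h G .ce t ⁻¹' A) =
      ENNReal.ofReal (prConf p) * P (wiretapSinr p g X h G .ce t' ⁻¹' A) := by
  have hC := measurableSet_confSlot henv t
  have hm := aemeasurable_wiretapSinr_ce henv t
  have hm' := aemeasurable_wiretapSinr_ce henv t'
  have hmr : AEMeasurable (wiretapSinr p g X h G .ce t) (P.restrict (confSlot p g t)) := hm.restrict
  -- Both measures have Laplace transform `prConf p * laplaceCE p s`, so they coincide; independence
  -- and stationarity come out together.
  have key : (P.restrict (confSlot p g t)).map (wiretapSinr p g X h G .ce t) =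
      ENNReal.ofReal (prConf p) • P.map (wiretapSinr p g X h G .ce t') := by
    have : IsFiniteMeasure (ENNReal.ofReal (prConf p) • P.map (wiretapSinr p g X h G .ce t')) :=
      Measure.smul_finite _ ENNReal.ofReal_ne_top
    refine measure_ext_of_laplace ?_ ?_ fun s hs => ?_
    · rw [ae_map_iff hmr measurableSet_Ici]
      exact ae_restrict_of_ae (ae_wiretapSinr_ce_nonneg henv t)
    · refine Measure.ae_smul_measure ?_ _
      rw [ae_map_iff hm' measurableSet_Ici]
      exact ae_wiretapSinr_ce_nonneg henv t'
    · have h1 := lintegral_exp_neg_wiretapSinr henv t hs (measurable_conf_indicator p)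
        (fun v => Set.indicator_le_self' (fun _ _ => zero_le) v)
      have h2 := lintegral_exp_neg_wiretapSinr henv t' hs (φ := fun _ => 1) measurable_const (fun _ => le_rfl)
      simp only [one_mul, lintegral_one, measure_univ] at h2
      rw [lintegral_conf_indicator henv t] at h1
      rw [lintegral_smul_measure, lintegral_map' (by fun_prop) hmr, lintegral_map' (by fun_prop) hm', smul_eq_mul, h2, ← h1,
        ← lintegral_indicator hC]
      refine lintegral_congr fun ω => ?_
      by_cases hc : ω ∈ confSlot p g t
      · have hc' : ({v : Fin p.nT → ℂ | p.nu < sqNorm v}.indicator 1 (g t ω) : ℝ≥0∞) = 1 :=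
          Set.indicator_of_mem (show g t ω ∈ {v : Fin p.nT → ℂ | p.nu < sqNorm v} from hc) _
        rw [hc', one_mul, Set.indicator_of_mem hc]
      · have hc' : ({v : Fin p.nT → ℂ | p.nu < sqNorm v}.indicator 1 (g t ω) : ℝ≥0∞) = 0 :=
          Set.indicator_of_notMem (show g t ω ∉ {v : Fin p.nT → ℂ | p.nu < sqNorm v} from hc) _
        rw [hc', zero_mul, Set.indicator_of_notMem hc]
  have h3 := congrArg (fun μ => μ A) key
  simp only [Measure.smul_apply, smul_eq_mul] at h3
  rw [Measure.map_apply_of_aemeasurable hmr hA, Measure.map_apply_of_aemeasurable hm' hA,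
    Measure.restrict_apply' hC, Set.inter_comm] at h3
  exact h3

/-- The failure probability of colluding eavesdroppers. -/
theorem failProb_ce (henv : IsEnvironment P p g X h G) (t t' : ℕ) :
    failProb P p g X h G .ce t =
      prConf p * (1 - P.real {ω | theta p < wiretapSinr p g X h G .ce t' ω}) + (1 - prConf p) := by
  have hpc : 0 ≤ prConf p := measureReal_confSlot henv t ▸ measureReal_nonneg
  have h1 := measure_confSlot_inter_wiretapSinr henv t t' (A := Set.Ici (theta p)) measurableSet_Ici
  have h2 : P (confSlot p g t ∩ wiretapSinr p g X h G .ce t ⁻¹' Set.Ici (theta p)) =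
      P {ω | (g t ω, (fun i => X t i ω), fun i => h t i ω) ∈ slotSuccess p .ce} := by
    refine measure_congr ?_
    filter_upwards [ae_wiretapSinr_ce henv t] with ω hω
    refine propext (and_congr_right fun _ => ?_)
    show theta p ≤ _ ↔ theta p ≤ _
    rw [hω]
  -- Success means `≥ θ` while the smoothed threshold uses `>`; the law has no atom at `θ`.
  have h3 : P (wiretapSinr p g X h G .ce t' ⁻¹' Set.Ici (theta p)) = P {ω | theta p < wiretapSinr p g X h G .ce t' ω} := by
    refine measure_congr ?_
    filter_upwards [compl_mem_ae_iff.2 (measure_wiretapSinr_ce_eq henv t' (theta p))] with ω hω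
    exact propext ⟨fun hle => lt_of_le_of_ne hle (Ne.symm hω), fun hlt => le_of_lt hlt⟩
  have h4 := measureReal_slotSuccess henv .ce t
  rw [Measure.real, ← h2, h1, h3, ENNReal.toReal_mul, ENNReal.toReal_ofReal hpc] at h4
  rw [Measure.real]
  linarith

/-- The colluding case lacks a closed form, so both slots are compared through the law in a common
reference slot. -/
lemma failProb_eq (henv : IsEnvironment P p g X h G) (c : Strategy) (t t' : ℕ) :
    failProb P p g X h G c t = failProb P p g X h G c t' := by
  cases c with
  | nce => rw [failProb_nce henv, failProb_nce henv]
  | ce => rw [failProb_ce henv t t, failProb_ce henv t' t]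

end Slot

/-! ### The number of slots until the packets are collected -/

/-- The probability that `k` independent trials with failure probability `Λ` contain at least `m`
successes. -/
def negBinomCdf (m k : ℕ) (Λ : ℝ) : ℝ := ∑ j ∈ Finset.range (k + 1 - m), Upsilon j m Λ

/-- Shift `l = m + j`; truncated subtraction makes the range empty exactly when `k < m`. -/
lemma sum_Icc_Upsilon (m k : ℕ) (Λ : ℝ) :
    ∑ l ∈ Finset.Icc m k, Upsilon (l - m) m Λ = negBinomCdf m k Λ := by
  rw [← Finset.Ico_add_one_right_eq_Icc, Finset.sum_Ico_eq_sum_range, negBinomCdf]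
  simp

lemma upsilonSum_eq (p : Params) (k : ℕ) (Λ : ℝ) :
    upsilonSum p k Λ = negBinomCdf (p.Nroi / p.Ls) k Λ :=
  sum_Icc_Upsilon _ _ _

/-- Pascal's rule for the binomial coefficient. -/
lemma Upsilon_succ_succ (j m : ℕ) (Λ : ℝ) :
    Upsilon (j + 1) (m + 1) Λ = Λ * Upsilon j (m + 1) Λ + (1 - Λ) * Upsilon (j + 1) m Λ := by
  have h1 : j + 1 + (m + 1) - 1 = (j + m) + 1 := by omega
  have h2 : j + (m + 1) - 1 = j + m := by omega
  have h3 : j + 1 + m - 1 = j + m := by omega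
  rw [Upsilon, Upsilon, Upsilon, h1, h2, h3, Nat.choose_succ_succ]
  push_cast
  ring

lemma Upsilon_zero_succ (m : ℕ) (Λ : ℝ) : Upsilon 0 (m + 1) Λ = (1 - Λ) * Upsilon 0 m Λ := by
  simp [Upsilon]
  ring

/-- For `m = 0` only `j = 0` survives: `C(j - 1, j) = 0` for `j ≥ 1`, while truncation reads `C(0 +
0 - 1, 0)` as `C(0, 0) = 1`. -/
lemma negBinomCdf_zero_left (k : ℕ) (Λ : ℝ) : negBinomCdf 0 k Λ = 1 := by
  rw [negBinomCdf, Nat.sub_zero, Finset.sum_range_succ', Finset.sum_eq_zero]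
  · simp [Upsilon]
  · intro j _
    simp [Upsilon]

lemma negBinomCdf_succ_zero (m : ℕ) (Λ : ℝ) : negBinomCdf (m + 1) 0 Λ = 0 := by
  simp [negBinomCdf]

/-- Conditioning on one trial: a failure leaves `m + 1` successes to find in `k` trials, a success
leaves `m`. -/
lemma negBinomCdf_succ_succ (m k : ℕ) (Λ : ℝ) :
    negBinomCdf (m + 1) (k + 1) Λ =
      Λ * negBinomCdf (m + 1) k Λ + (1 - Λ) * negBinomCdf m k Λ := by
  unfold negBinomCdf
  rcases le_or_gt m k with hmk | hmk
  · obtain ⟨n, rfl⟩ := Nat.exists_eq_add_of_le hmk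
    have h1 : m + n + 1 + 1 - (m + 1) = n + 1 := by omega
    have h2 : m + n + 1 - (m + 1) = n := by omega
    have h3 : m + n + 1 - m = n + 1 := by omega
    rw [h1, h2, h3, Finset.sum_range_succ', Finset.sum_range_succ' (fun j => Upsilon j m Λ), Upsilon_zero_succ]
    simp_rw [Upsilon_succ_succ]
    rw [Finset.sum_add_distrib, Finset.mul_sum, mul_add, Finset.mul_sum]
    ring
  · have h1 : k + 1 + 1 - (m + 1) = 0 := by omega
    have h2 : k + 1 - (m + 1) = 0 := by omega
    have h3 : k + 1 - m = 0 := by omega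
    rw [h1, h2, h3]
    simp

lemma negBinomCdf_nonneg {Λ : ℝ} (h0 : 0 ≤ Λ) (h1 : Λ ≤ 1) (m k : ℕ) : 0 ≤ negBinomCdf m k Λ := by
  refine Finset.sum_nonneg fun j _ => ?_
  have := sub_nonneg.2 h1
  unfold Upsilon
  positivity

lemma negBinomCdf_succ_le {Λ : ℝ} (h0 : 0 ≤ Λ) (h1 : Λ ≤ 1) (m k : ℕ) :
    negBinomCdf (m + 1) k Λ ≤ negBinomCdf m k Λ := by
  induction k generalizing m with
  | zero =>
    rw [negBinomCdf_succ_zero]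
    exact negBinomCdf_nonneg h0 h1 _ _
  | succ k ih =>
    have h2 := sub_nonneg.2 h1
    rw [negBinomCdf_succ_succ]
    cases m with
    | zero =>
      have h3 := ih 0
      rw [negBinomCdf_zero_left] at h3 ⊢
      rw [negBinomCdf_zero_left]
      nlinarith
    | succ m =>
      rw [negBinomCdf_succ_succ]
      gcongr
      · exact ih _
      · exact ih _

/-- The recursion is a convex combination with weight `Λ` on the smaller value. Raising `Λ` shifts
weight towards it, and by induction lowers both values. -/
lemma negBinomCdf_antitoneOn (m k : ℕ) : AntitoneOn (negBinomCdf m k) (Set.Icc 0 1) := by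
  rintro Λ ⟨h0, h1⟩ Λ' ⟨h0', h1'⟩ hle
  induction k generalizing m with
  | zero =>
    cases m with
    | zero => rw [negBinomCdf_zero_left, negBinomCdf_zero_left]
    | succ m => rw [negBinomCdf_succ_zero, negBinomCdf_succ_zero]
  | succ k ih =>
    cases m with
    | zero => rw [negBinomCdf_zero_left, negBinomCdf_zero_left]
    | succ m =>
      rw [negBinomCdf_succ_succ, negBinomCdf_succ_succ]
      have h2 := ih (m + 1)
      have h3 := ih m
      have h4 := negBinomCdf_succ_le h0 h1 m k
      have h5 := sub_nonneg.2 h1'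
      calc Λ' * negBinomCdf (m + 1) k Λ' + (1 - Λ') * negBinomCdf m k Λ'
          ≤ Λ' * negBinomCdf (m + 1) k Λ + (1 - Λ') * negBinomCdf m k Λ := by gcongr
        _ ≤ Λ * negBinomCdf (m + 1) k Λ + (1 - Λ) * negBinomCdf m k Λ := by nlinarith

lemma continuous_negBinomCdf (m k : ℕ) : Continuous (negBinomCdf m k) := by
  unfold negBinomCdf Upsilon
  fun_prop

/-- The number of successes in independent trials with a common failure probability is
binomially distributed. -/
lemma measureReal_le_sum_of_iIndepFun {Ω : Type*} [MeasurableSpace Ω] {P : Measure Ω}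
    [IsProbabilityMeasure P] {N : ℕ → Ω → ℕ} (hm : ∀ t, Measurable (N t)) (hind : iIndepFun N P)
    (hN : ∀ t ω, N t ω = 0 ∨ N t ω = 1) {Λ : ℝ} (hΛ : ∀ t, P.real {ω | N t ω = 1} = 1 - Λ) (m k : ℕ) :
    P.real {ω | m ≤ ∑ t ∈ Finset.range k, N t ω} = negBinomCdf m k Λ := by
  induction k generalizing m with
  | zero =>
    cases m with
    | zero => simp [negBinomCdf_zero_left]
    | succ m => simp [negBinomCdf_succ_zero]
  | succ k ih =>
    cases m with
    | zero => simp [negBinomCdf_zero_left]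
    | succ m =>
      have hS : Measurable fun ω => ∑ t ∈ Finset.range k, N t ω := by fun_prop
      have hi : IndepFun (fun ω => ∑ t ∈ Finset.range k, N t ω) (N k) P := by
        have h1 := hind.indepFun_finsetSum_of_notMem hm (s := Finset.range k) (i := k) (by simp)
        convert! h1 using 1
        ext ω
        simp
      have hinter : ∀ (a b : ℕ), P.real ({ω | a ≤ ∑ t ∈ Finset.range k, N t ω} ∩ {ω | N k ω = b}) =
          P.real {ω | a ≤ ∑ t ∈ Finset.range k, N t ω} * P.real {ω | N k ω = b} := by
        intro a b
        have h1 := hi.measure_inter_preimage_eq_mul (Set.Ici a) {b} measurableSet_Ici (measurableSet_singleton b)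
        rw [Measure.real, Measure.real, Measure.real, ← ENNReal.toReal_mul]
        exact congrArg ENNReal.toReal h1
      have h0 : P.real {ω | N k ω = 0} = Λ := by
        have h1 : {ω | N k ω = 0} = {ω | N k ω = 1}ᶜ := by
          ext ω
          rcases hN k ω with h | h <;> simp [h]
        rw [h1, measureReal_compl (measurableSet_eq_fun (hm k) measurable_const), hΛ, probReal_univ]
        ring
      -- The last trial is split off, reproducing the recursion of `negBinomCdf`.
      have hset : {ω | m + 1 ≤ ∑ t ∈ Finset.range (k + 1), N t ω} =
          ({ω | m + 1 ≤ ∑ t ∈ Finset.range k, N t ω} ∩ {ω | N k ω = 0}) ∪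
            ({ω | m ≤ ∑ t ∈ Finset.range k, N t ω} ∩ {ω | N k ω = 1}) := by
        ext ω
        simp only [Set.mem_ofPred_eq, Set.mem_union, Set.mem_inter_iff, Finset.sum_range_succ]
        rcases hN k ω with h | h <;> simp [h]
      rw [hset, measureReal_union, hinter, hinter, ih, ih, h0, hΛ, negBinomCdf_succ_succ]
      · ring
      · refine Set.disjoint_left.2 fun ω h1 h2 => ?_
        have h3 : N k ω = 0 := h1.2
        have h4 : N k ω = 1 := h2.2
        omega
      · exact (measurableSet_le measurable_const hS).inter (hm k (measurableSet_singleton 1))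

/-- An infimum below `k + 1` is witnessed by some `j ≤ k`, and the number of collected packets never
decreases. -/
lemma TE_le_iff {Ω : Type*} {p : Params} {g : ℕ → Ω → Fin p.nT → ℂ}
    {X : ℕ → ℕ → Ω → EuclideanSpace ℝ (Fin 2)} {h : ℕ → ℕ → Ω → Fin p.nT → ℂ}
    {G : ℕ → Ω → Matrix (Fin p.nT) (Fin (p.nT - 1)) ℂ} (c : Strategy) (k : ℕ) (ω : Ω) :
    TE p g X h G c ω ≤ k ↔ p.Nroi ≤ collected p g X h G c k ω := by
  constructor
  · intro hle
    have h1 : TE p g X h G c ω < ((k + 1 : ℕ) : ℕ∞) := lt_of_le_of_lt hle (by exact_mod_cast Nat.lt_succ_self k)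
    rw [TE, iInf_lt_iff] at h1
    obtain ⟨j, hj⟩ := h1
    obtain ⟨hj1, hj2⟩ := iInf_lt_iff.1 hj
    have hjk : j ≤ k := Nat.lt_succ_iff.1 (by exact_mod_cast hj2)
    refine hj1.trans ?_
    exact Finset.sum_le_sum_of_subset (Finset.range_mono hjk)
  · intro hk
    exact iInf₂_le k hk

section Slots

variable {Ω : Type*} [MeasurableSpace Ω] {P : Measure Ω} {p : Params}
  {g : ℕ → Ω → Fin p.nT → ℂ}
  {X : ℕ → ℕ → Ω → EuclideanSpace ℝ (Fin 2)}
  {h : ℕ → ℕ → Ω → Fin p.nT → ℂ}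
  {G : ℕ → Ω → Matrix (Fin p.nT) (Fin (p.nT - 1)) ℂ}

variable [IsProbabilityMeasure P]

/-- The distribution of the number of slots that the eavesdroppers need. -/
theorem measureReal_TE_le (henv : IsEnvironment P p g X h G) (c : Strategy) (t k : ℕ) :
    P.real {ω | TE p g X h G c ω ≤ k} = upsilonSum p k (failProb P p g X h G c t) := by
  let ι := (Fin p.nT → ℂ) × (ℕ → EuclideanSpace ℝ (Fin 2)) × (ℕ → Fin p.nT → ℂ)
  let φ : ι → ℕ := (slotSuccess p c).indicator 1
  let N : ℕ → Ω → ℕ := fun s ω => φ (g s ω, (fun i => X s i ω), fun i => h s i ω)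
  have hφ : Measurable φ := measurable_one.indicator (measurableSet_slotSuccess p c)
  have hm : ∀ s, Measurable (N s) := fun s => hφ.comp (measurable_slot_all henv s)
  have hind : iIndepFun N P := henv.indep_slots.comp (fun _ => φ) fun _ => hφ
  have hN1 : ∀ s ω, N s ω = 1 ↔ (g s ω, (fun i => X s i ω), fun i => h s i ω) ∈ slotSuccess p c := by
    intro s ω
    by_cases hmem : (g s ω, (fun i => X s i ω), fun i => h s i ω) ∈ slotSuccess p c <;>
      simp [N, φ, hmem]
  have hN : ∀ s ω, N s ω = 0 ∨ N s ω = 1 := by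
    intro s ω
    by_cases hmem : (g s ω, (fun i => X s i ω), fun i => h s i ω) ∈ slotSuccess p c <;>
      simp [N, φ, hmem]
  have hΛ : ∀ s, P.real {ω | N s ω = 1} = 1 - failProb P p g X h G c t := by
    intro s
    simp_rw [hN1]
    rw [measureReal_slotSuccess henv c s, failProb_eq henv c s t]
  rw [upsilonSum_eq, ← measureReal_le_sum_of_iIndepFun hm hind hN hΛ]
  refine measureReal_congr ?_
  have hall : ∀ᵐ ω ∂P, ∀ s, (ω ∈ confSlot p g s ∧ ω ∉ wiretapOutage p g X h G c s) ↔
      (g s ω, (fun i => X s i ω), fun i => h s i ω) ∈ slotSuccess p c :=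
    ae_all_iff.2 fun s => ae_mem_slotSuccess henv c s
  filter_upwards [hall] with ω hω
  refine propext ?_
  show TE p g X h G c ω ≤ k ↔ p.Nroi / p.Ls ≤ ∑ s ∈ Finset.range k, N s ω
  have h1 : collected p g X h G c k ω = p.Ls * ∑ s ∈ Finset.range k, N s ω := by
    rw [collected, Finset.mul_sum]
    refine Finset.sum_congr rfl fun s _ => ?_
    by_cases hc : ω ∈ confSlot p g s ∧ ω ∉ wiretapOutage p g X h G c s
    · rw [if_pos hc, (hN1 s ω).2 ((hω s).1 hc), mul_one]
    · rw [if_neg hc, (hN s ω).resolve_right fun h1 => hc ((hω s).2 ((hN1 s ω).1 h1)), mul_zero]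
  rw [TE_le_iff, h1]
  -- Divisibility makes `Nroi ≤ Ls · S` equivalent to `Nroi / Ls ≤ S`; without it the quotient would
  -- round down.
  obtain ⟨m, hm⟩ := p.Ls_dvd
  rw [hm, Nat.mul_div_cancel_left _ p.Ls_pos]
  exact Nat.mul_le_mul_left_iff p.Ls_pos

end Slots

/-! ### Alzer's inequality -/

/-- A function that vanishes at `0` and whose derivative stays nonpositive once it has become
negative does not increase after it has become negative. -/
lemma le_of_neg_of_deriv_sign {f f' : ℝ → ℝ} (hd : ∀ x, HasDerivAt f (f' x) x) (h0 : f 0 = 0)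
    (hs : ∀ w, 0 < w → f' w < 0 → ∀ w', w < w' → f' w' ≤ 0) {v u : ℝ} (hv : 0 < v) (hfv : f v < 0)
    (hvu : v ≤ u) : f u ≤ f v := by
  have hc : Continuous f := continuous_iff_continuousAt.2 fun x => (hd x).continuousAt
  -- The mean value theorem on `[0, v]` finds a negative derivative before `v`, so the derivative is
  -- nonpositive on all of `[v, u]`.
  obtain ⟨w, hw, hw'⟩ := exists_hasDerivAt_eq_slope f f' hv hc.continuousOn fun x _ => hd x
  have hneg : f' w < 0 := by
    rw [hw', h0]
    exact div_neg_of_neg_of_pos (by linarith) (by linarith)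
  rcases hvu.eq_or_lt with rfl | hlt
  · exact le_rfl
  obtain ⟨z, hz, hz'⟩ := exists_hasDerivAt_eq_slope f f' hlt hc.continuousOn fun x _ => hd x
  have h1 := hs w hw.1 hneg z (hw.2.trans hz.1)
  rw [hz'] at h1
  by_contra! hcon
  exact absurd h1 (not_le.2 (div_pos (by linarith) (by linarith)))

/-- Multiplied by `e^{ax}`, the inequality says that `r x = x - e^{ax} + e^{-(1-a)x}` is negative.
Its derivative is concave and vanishes at `0`, so once negative it stays so, and `r` cannot recover.
-/
lemma lt_one_sub_exp_of_lt {a : ℝ} (ha0 : 0 ≤ a) (ha1 : a ≤ 1) {v u : ℝ} (hv : 0 < v) (hvu : v ≤ u)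
    (h : v * Real.exp (-(a * v)) < 1 - Real.exp (-v)) :
    u * Real.exp (-(a * u)) < 1 - Real.exp (-u) := by
  let r : ℝ → ℝ := fun x => x - Real.exp (a * x) + Real.exp (-((1 - a) * x))
  let r' : ℝ → ℝ := fun x => 1 - a * Real.exp (a * x) - (1 - a) * Real.exp (-((1 - a) * x))
  have hd : ∀ x, HasDerivAt r (r' x) x := by
    intro x
    have h1 : HasDerivAt (fun x => Real.exp (a * x)) (Real.exp (a * x) * (a * 1)) x :=
      ((hasDerivAt_id x).const_mul a).exp
    have h2 : HasDerivAt (fun x => Real.exp (-((1 - a) * x)))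
        (Real.exp (-((1 - a) * x)) * (-((1 - a) * 1))) x :=
      ((hasDerivAt_id x).const_mul (1 - a)).neg.exp
    refine (((hasDerivAt_id x).sub h1).add h2).congr_deriv ?_
    simp only [r']
    ring
  -- Convexity of `exp` along the chord from `0` to `c w'`, with denominators cleared.
  have hconv : ∀ {w w' : ℝ}, 0 < w → w < w' → ∀ c : ℝ,
      w' * Real.exp (c * w) ≤ (w' - w) + w * Real.exp (c * w') := by
    intro w w' hw hww c
    have hw' : 0 < w' := hw.trans hww
    have h1 : Real.exp ((1 - w / w') • 0 + (w / w') • (c * w')) ≤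
        (1 - w / w') • Real.exp 0 + (w / w') • Real.exp (c * w') :=
      convexOn_exp.2 (Set.mem_univ 0) (Set.mem_univ (c * w')) (by rw [sub_nonneg, div_le_one hw']; exact hww.le) (by positivity) (by ring)
    simp only [smul_eq_mul, mul_zero, zero_add, Real.exp_zero, mul_one] at h1
    rw [show w / w' * (c * w') = c * w by field_simp] at h1
    have h2 := mul_le_mul_of_nonneg_left h1 hw'.le
    calc w' * Real.exp (c * w) ≤ _ := h2
      _ = _ := by field_simp
  have hs : ∀ w, 0 < w → r' w < 0 → ∀ w', w < w' → r' w' ≤ 0 := by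
    intro w hw hneg w' hww
    have h1 := hconv hw hww a
    have h2 := hconv hw hww (-(1 - a))
    rw [neg_mul, neg_mul] at h2
    have h3 := mul_le_mul_of_nonneg_left h1 ha0
    have h4 := mul_le_mul_of_nonneg_left h2 (sub_nonneg.2 ha1)
    have h5 : w * r' w' ≤ w' * r' w := by
      simp only [r']
      nlinarith
    have h6 : w' * r' w < 0 := mul_neg_of_pos_of_neg (hw.trans hww) hneg
    by_contra! hcon
    have := mul_pos hw hcon
    linarith
  have hr : ∀ x, r x = Real.exp (a * x) * (x * Real.exp (-(a * x)) - (1 - Real.exp (-x))) := by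
    intro x
    have h1 : Real.exp (a * x) * Real.exp (-(a * x)) = 1 := by rw [← Real.exp_add]; simp
    have h2 : Real.exp (-((1 - a) * x)) = Real.exp (a * x) * Real.exp (-x) := by
      rw [← Real.exp_add]; congr 1; ring
    simp only [r]
    rw [h2]
    linear_combination (-x) * h1
  have hrv : r v < 0 := by
    rw [hr]
    exact mul_neg_of_pos_of_neg (Real.exp_pos _) (by linarith)
  have hru : r u < 0 := (le_of_neg_of_deriv_sign hd (by simp [r]) hs hv hrv hvu).trans_lt hrv
  rw [hr] at hru
  have := neg_of_mul_neg_right hru (Real.exp_pos _).le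
  linarith

lemma gammaPDFReal_natCast (n : ℕ) {x : ℝ} (hx : 0 ≤ x) :
    gammaPDFReal ((n + 1 : ℕ) : ℝ) ((n + 1 : ℕ) : ℝ) x =
      ((n + 1 : ℕ) : ℝ) ^ (n + 1) / (n.factorial : ℝ) * (x ^ n * Real.exp (-(((n + 1 : ℕ) : ℝ) * x))) := by
  rw [gammaPDFReal, if_pos hx, Real.rpow_natCast, Nat.cast_succ, Real.Gamma_nat_eq_factorial,
    add_sub_cancel_right, Real.rpow_natCast]
  ring

lemma cdf_gammaMeasure_natCast (n : ℕ) {x : ℝ} (hx : 0 ≤ x) :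
    cdf (gammaMeasure ((n + 1 : ℕ) : ℝ) ((n + 1 : ℕ) : ℝ)) x =
      ∫ y in (0 : ℝ)..x, ((n + 1 : ℕ) : ℝ) ^ (n + 1) / (n.factorial : ℝ) *
        (y ^ n * Real.exp (-(((n + 1 : ℕ) : ℝ) * y))) := by
  have hK : (0 : ℝ) < ((n + 1 : ℕ) : ℝ) := by positivity
  have hnn := gammaPDFReal_nonneg hK hK
  have hint : Integrable (gammaPDFReal ((n + 1 : ℕ) : ℝ) ((n + 1 : ℕ) : ℝ)) := by
    refine ⟨(measurable_gammaPDFReal _ _).aestronglyMeasurable, ?_⟩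
    rw [hasFiniteIntegral_iff_ofReal (Eventually.of_forall hnn)]
    have := lintegral_gammaPDF_eq_one hK hK
    unfold gammaPDF at this
    rw [this]
    exact ENNReal.one_lt_top
  have h0 : ∫ y in Set.Iic (0 : ℝ), gammaPDFReal ((n + 1 : ℕ) : ℝ) ((n + 1 : ℕ) : ℝ) y = 0 := by
    rw [integral_Iic_eq_integral_Iio]
    refine setIntegral_eq_zero_of_forall_eq_zero fun y hy => ?_
    rw [gammaPDFReal, if_neg (not_le.2 hy)]
  have h1 := intervalIntegral.integral_Iic_sub_Iic (a := (0 : ℝ)) (b := x) hint.integrableOn hint.integrableOn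
  rw [h0, sub_zero] at h1
  rw [cdf_gammaMeasure_eq_integral hK hK, h1]
  apply intervalIntegral.integral_congr
  intro y hy
  rw [Set.uIcc_of_le hx] at hy
  exact gammaPDFReal_natCast n hy.1

lemma measureReal_gammaMeasure_Iio {a r : ℝ} (ha : 0 < a) (hr : 0 < r) (x : ℝ) :
    (gammaMeasure a r).real (Set.Iio x) = cdf (gammaMeasure a r) x := by
  have := isProbabilityMeasure_gammaMeasure ha hr
  rw [cdf_eq_real]
  refine measureReal_congr ?_
  exact (withDensity_absolutelyContinuous _ _).ae_le Iio_ae_eq_Iic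

lemma varphi_pos {K : ℕ} (hK : 1 ≤ K) : 0 < varphi K := by
  unfold varphi
  have : 0 < K := hK
  have := K.factorial_pos
  positivity

/-- Alzer's inequality for the normalized incomplete Gamma function. -/
theorem one_sub_exp_pow_le_gammaMeasure {K : ℕ} (hK : 1 ≤ K) {x : ℝ} (hx : 0 ≤ x) :
    (1 - Real.exp (-(varphi K * x))) ^ K ≤ (gammaMeasure K K).real (Set.Iio x) := by
  obtain ⟨n, rfl⟩ := Nat.exists_eq_add_of_le' hK
  have hKpos : (0 : ℝ) < ((n + 1 : ℕ) : ℝ) := by positivity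
  rw [measureReal_gammaMeasure_Iio hKpos hKpos]
  set φ := varphi (n + 1) with hφdef
  have hφ : 0 < φ := varphi_pos hK
  -- With `K = n + 1`, `ρ = (K!)^{1/K} = K/φ` lies between `1` and `K`.
  set ρ : ℝ := ((n + 1).factorial : ℝ) ^ (1 / ((n + 1 : ℕ) : ℝ)) with hρdef
  have hfac : (1 : ℝ) ≤ ((n + 1).factorial : ℝ) := by exact_mod_cast (n + 1).factorial_pos
  have hρpow : ρ ^ (n + 1) = ((n + 1).factorial : ℝ) := by
    rw [hρdef, ← Real.rpow_natCast, ← Real.rpow_mul (by positivity), one_div, inv_mul_cancel₀ hKpos.ne',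
      Real.rpow_one]
  have hρ1 : 1 ≤ ρ := Real.one_le_rpow hfac (by positivity)
  have hρK : ρ ≤ ((n + 1 : ℕ) : ℝ) := by
    refine le_of_pow_le_pow_left₀ (Nat.succ_ne_zero n) hKpos.le ?_
    rw [hρpow]
    exact_mod_cast Nat.factorial_le_pow (n + 1)
  have hφρ : φ * ρ = ((n + 1 : ℕ) : ℝ) := by
    rw [hφdef, varphi, div_mul_cancel₀]
    positivity
  -- Chosen so that `K = φ (1 + n a)`: the Gamma density then shares the factor `e^{-φx}` with the
  -- derivative of the power, leaving two `n`-th powers to compare. For `n = 0`, `ρ = 1` and the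
  -- default quotient `0` is consistent.
  set a : ℝ := (ρ - 1) / n with hadef
  have ha0 : 0 ≤ a := div_nonneg (by linarith) (by positivity)
  have ha1 : a ≤ 1 := div_le_one_of_le₀ (by push_cast at hρK; linarith) (by positivity)
  have hna : n * a = ρ - 1 := by
    rcases Nat.eq_zero_or_pos n with h0 | h0
    · subst h0
      simp [hρdef]
    · rw [hadef, mul_div_cancel₀]
      positivity
  have hC : ((n + 1 : ℕ) : ℝ) ^ (n + 1) / (n.factorial : ℝ) = ((n + 1 : ℕ) : ℝ) * φ ^ (n + 1) := by
    have h1 : ((n + 1 : ℕ) : ℝ) ^ (n + 1) = φ ^ (n + 1) * ((n + 1).factorial : ℝ) := by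
      rw [← hρpow, ← mul_pow, hφρ]
    rw [h1, Nat.factorial_succ, div_eq_iff (by positivity)]
    push_cast
    ring
  let f : ℝ → ℝ := fun x => (∫ y in (0 : ℝ)..x, ((n + 1 : ℕ) : ℝ) ^ (n + 1) / (n.factorial : ℝ) *
        (y ^ n * Real.exp (-(((n + 1 : ℕ) : ℝ) * y)))) - (1 - Real.exp (-(φ * x))) ^ (n + 1)
  let f' : ℝ → ℝ := fun x => ((n + 1 : ℕ) : ℝ) * φ * Real.exp (-(φ * x)) *
    ((φ * x * Real.exp (-(a * (φ * x)))) ^ n - (1 - Real.exp (-(φ * x))) ^ n)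
  have hd : ∀ x, HasDerivAt f (f' x) x := by
    intro x
    have h1 : HasDerivAt (fun x => ∫ y in (0 : ℝ)..x, ((n + 1 : ℕ) : ℝ) ^ (n + 1) / (n.factorial : ℝ) *
        (y ^ n * Real.exp (-(((n + 1 : ℕ) : ℝ) * y)))) (((n + 1 : ℕ) : ℝ) ^ (n + 1) / (n.factorial : ℝ) *
        (x ^ n * Real.exp (-(((n + 1 : ℕ) : ℝ) * x)))) x :=
      (Continuous.integral_hasStrictDerivAt (by fun_prop) 0 x).hasDerivAt
    have h2 : HasDerivAt (fun x => Real.exp (-(φ * x))) (Real.exp (-(φ * x)) * (-(φ * 1))) x :=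
      ((hasDerivAt_id x).const_mul φ).neg.exp
    have h3 := (h2.const_sub 1).pow (n + 1)
    refine (h1.sub h3).congr_deriv ?_
    have h4 : Real.exp (-(((n + 1 : ℕ) : ℝ) * x)) = Real.exp (-(φ * x)) * Real.exp (-(a * (φ * x))) ^ n := by
      rw [← Real.exp_nat_mul, ← Real.exp_add, ← hφρ]
      congr 1
      linear_combination (φ * x) * hna
    rw [hC, h4]
    simp only [f', Nat.add_sub_cancel, mul_pow, pow_succ]
    ring
  have h0 : f 0 = 0 := by simp [f]
  have hs : ∀ w, 0 < w → f' w < 0 → ∀ w', w < w' → f' w' ≤ 0 := by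
    intro w hw hneg w' hww
    have hw' := hw.trans hww
    have h1 : (φ * w * Real.exp (-(a * (φ * w)))) ^ n < (1 - Real.exp (-(φ * w))) ^ n := by
      have := neg_of_mul_neg_right hneg (by positivity)
      linarith
    have hone : 0 ≤ 1 - Real.exp (-(φ * w)) := by
      rw [sub_nonneg, Real.exp_le_one_iff]
      have := mul_pos hφ hw
      linarith
    have h2 := lt_of_pow_lt_pow_left₀ n hone h1
    have h3 := lt_one_sub_exp_of_lt ha0 ha1 (mul_pos hφ hw) (mul_le_mul_of_nonneg_left hww.le hφ.le) h2
    have h4 := pow_le_pow_left₀ (by positivity) h3.le n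
    exact mul_nonpos_of_nonneg_of_nonpos (by positivity) (by linarith)
  have hlim : Tendsto f atTop (𝓝 0) := by
    have := isProbabilityMeasure_gammaMeasure hKpos hKpos
    have h1 := tendsto_cdf_atTop (gammaMeasure ((n + 1 : ℕ) : ℝ) ((n + 1 : ℕ) : ℝ))
    have h2 : Tendsto (fun x => Real.exp (-(φ * x))) atTop (𝓝 0) :=
      Real.tendsto_exp_neg_atTop_nhds_zero.comp (tendsto_id.const_mul_atTop hφ)
    have h3 := h1.sub ((h2.const_sub 1).pow (n + 1))
    simp only [sub_zero, one_pow, sub_self] at h3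
    refine h3.congr' ?_
    filter_upwards [eventually_ge_atTop 0] with y hy
    rw [cdf_gammaMeasure_natCast n hy]
  rw [cdf_gammaMeasure_natCast n hx, ← sub_nonneg]
  change 0 ≤ f x
  rcases hx.eq_or_lt with rfl | hxpos
  · exact h0.ge
  -- The difference `f` vanishes at `0` and at infinity. Once negative it could only decrease
  -- further, contradicting its limit.
  by_contra! hneg
  have h1 : (0 : ℝ) ≤ f x := le_of_tendsto hlim ((eventually_ge_atTop x).mono fun u hu =>
    le_of_neg_of_deriv_sign hd h0 hs hxpos hneg hu)
  linarith

/-! ### Concentration of the normalized Gamma law -/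

/-- Size-biasing a Gamma law raises its shape by one; all moments follow from this. -/
lemma gammaPDFReal_mul_self {a r : ℝ} (ha : 0 < a) (hr : 0 < r) (x : ℝ) :
    gammaPDFReal a r x * x = a / r * gammaPDFReal (a + 1) r x := by
  unfold gammaPDFReal
  split_ifs with hx
  · rcases hx.eq_or_lt with rfl | hx
    · rw [add_sub_cancel_right, Real.zero_rpow ha.ne']
      simp
    · rw [Real.Gamma_add_one ha.ne', Real.rpow_add_one hr.ne', add_sub_cancel_right, Real.rpow_sub_one hx.ne']
      have := Real.Gamma_pos_of_pos ha
      field_simp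
  · simp

lemma lintegral_mul_gammaMeasure {a r : ℝ} (ha : 0 < a) (hr : 0 < r) {f : ℝ → ℝ≥0∞} (hf : Measurable f) :
    ∫⁻ x, ENNReal.ofReal x * f x ∂(gammaMeasure a r) =
      ENNReal.ofReal (a / r) * ∫⁻ x, f x ∂(gammaMeasure (a + 1) r) := by
  have hm : ∀ a r, Measurable (gammaPDF a r) := fun a r => (measurable_gammaPDFReal a r).ennreal_ofReal
  have hmf : Measurable fun x => ENNReal.ofReal x * f x := ENNReal.measurable_ofReal.mul hf
  rw [gammaMeasure, gammaMeasure, lintegral_withDensity_eq_lintegral_mul _ (hm a r) hmf,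
    lintegral_withDensity_eq_lintegral_mul _ (hm (a + 1) r) hf, ← lintegral_const_mul _ ((hm (a + 1) r).mul hf)]
  refine lintegral_congr fun x => ?_
  simp only [Pi.mul_apply]
  rw [← mul_assoc, ← mul_assoc, gammaPDF, gammaPDF, ← ENNReal.ofReal_mul (gammaPDFReal_nonneg ha hr x),
    ← ENNReal.ofReal_mul (by positivity), gammaPDFReal_mul_self ha hr]

lemma ae_nonneg_gammaMeasure (a r : ℝ) : ∀ᵐ x ∂(gammaMeasure a r), 0 ≤ x := by
  have hm : Measurable (gammaPDF a r) := (measurable_gammaPDFReal a r).ennreal_ofReal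
  rw [gammaMeasure, ae_withDensity_iff hm]
  refine Eventually.of_forall fun x hx => ?_
  by_contra! hneg
  exact hx (gammaPDF_of_neg hneg)

/-- The variance of the normalized Gamma law of shape `K` is `1 / K`. -/
lemma lintegral_sub_one_sq_gammaMeasure {K : ℝ} (hK : 0 < K) :
    ∫⁻ x, ENNReal.ofReal ((x - 1) ^ 2) ∂(gammaMeasure K K) = ENNReal.ofReal (1 / K) := by
  have := isProbabilityMeasure_gammaMeasure hK hK
  have hK1 : 0 < K + 1 := by positivity
  have := isProbabilityMeasure_gammaMeasure hK1 hK
  have hK2 : 0 < K + 1 + 1 := by positivity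
  have := isProbabilityMeasure_gammaMeasure hK2 hK
  have h1 : ∫⁻ x, ENNReal.ofReal x ∂(gammaMeasure K K) = 1 := by
    have := lintegral_mul_gammaMeasure hK hK (f := fun _ => 1) measurable_const
    simpa [hK.ne'] using this
  have h1' : ∫⁻ x, ENNReal.ofReal x ∂(gammaMeasure (K + 1) K) = ENNReal.ofReal ((K + 1) / K) := by
    have := lintegral_mul_gammaMeasure hK1 hK (f := fun _ => 1) measurable_const
    simpa using this
  have h2 : ∫⁻ x, ENNReal.ofReal x * ENNReal.ofReal x ∂(gammaMeasure K K) = ENNReal.ofReal ((K + 1) / K) := by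
    rw [lintegral_mul_gammaMeasure hK hK ENNReal.measurable_ofReal, h1', div_self hK.ne', ENNReal.ofReal_one,
      one_mul]
  -- The identity `(x - 1)² + 2x = x² + 1` avoids subtraction in `[0, ∞]`.
  have h3 : ∫⁻ x, (ENNReal.ofReal ((x - 1) ^ 2) + 2 * ENNReal.ofReal x) ∂(gammaMeasure K K) =
      ∫⁻ x, (ENNReal.ofReal x * ENNReal.ofReal x + 1) ∂(gammaMeasure K K) := by
    refine lintegral_congr_ae ?_
    filter_upwards [ae_nonneg_gammaMeasure K K] with x hx
    rw [← ENNReal.ofReal_one, ← ENNReal.ofReal_mul hx, ← ENNReal.ofReal_add (by positivity) zero_le_one,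
      ← ENNReal.ofReal_ofNat, ← ENNReal.ofReal_mul (by norm_num), ← ENNReal.ofReal_add (by positivity) (by positivity)]
    congr 1
    ring
  rw [lintegral_add_left (by fun_prop), lintegral_const_mul _ ENNReal.measurable_ofReal, h1,
    lintegral_add_right _ measurable_const, h2, lintegral_const, measure_univ, mul_one, mul_one] at h3
  have h4 : ENNReal.ofReal ((K + 1) / K) + 1 = ENNReal.ofReal (1 / K) + 2 := by
    rw [← ENNReal.ofReal_one, ← ENNReal.ofReal_ofNat, ← ENNReal.ofReal_add (by positivity) zero_le_one,
      ← ENNReal.ofReal_add (by positivity) (by norm_num)]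
    congr 1
    field_simp
    ring
  rw [h4] at h3
  exact (ENNReal.add_left_inj (by norm_num)).1 h3

/-- Chebyshev's inequality. -/
lemma measureReal_gammaMeasure_abs_ge {K : ℝ} (hK : 0 < K) {c : ℝ} (hc : 0 < c) :
    (gammaMeasure K K).real {x | c ≤ |x - 1|} ≤ 1 / K / c ^ 2 := by
  have h1 := mul_meas_ge_le_lintegral (μ := gammaMeasure K K) (f := fun x => ENNReal.ofReal ((x - 1) ^ 2))
    (by fun_prop) (ENNReal.ofReal (c ^ 2))
  rw [lintegral_sub_one_sq_gammaMeasure hK] at h1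
  have hset : {x : ℝ | ENNReal.ofReal (c ^ 2) ≤ ENNReal.ofReal ((x - 1) ^ 2)} = {x | c ≤ |x - 1|} := by
    ext x
    simp only [Set.mem_ofPred_eq]
    rw [ENNReal.ofReal_le_ofReal_iff (by positivity), ← abs_of_pos hc, sq_le_sq, abs_abs]
  rw [hset] at h1
  have h2 := ENNReal.toReal_mono ENNReal.ofReal_ne_top h1
  rw [ENNReal.toReal_mul, ENNReal.toReal_ofReal (by positivity), ENNReal.toReal_ofReal (by positivity)] at h2
  rw [le_div_iff₀ (by positivity), mul_comm]
  exact h2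

lemma tendsto_gammaMeasure_abs_ge {c : ℝ} (hc : 0 < c) :
    Tendsto (fun K : ℕ => (gammaMeasure K K).real {x | c ≤ |x - 1|}) atTop (𝓝 0) := by
  have h1 : Tendsto (fun K : ℕ => 1 / (K : ℝ) / c ^ 2) atTop (𝓝 0) := by
    have := (tendsto_one_div_atTop_nhds_zero_nat (𝕜 := ℝ)).div_const (c ^ 2)
    rwa [zero_div] at this
  refine squeeze_zero' (Eventually.of_forall fun _ => measureReal_nonneg) ?_ h1
  filter_upwards [eventually_gt_atTop 0] with K hK
  exact measureReal_gammaMeasure_abs_ge (by exact_mod_cast hK) hc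

/-- The distribution function of the normalized Gamma law converges to the one of the constant `1`. -/
lemma tendsto_gammaMeasure_Iio {x : ℝ} (hx : x ≠ 1) :
    Tendsto (fun K : ℕ => (gammaMeasure K K).real (Set.Iio x)) atTop (𝓝 (if 1 < x then 1 else 0)) := by
  rcases lt_or_gt_of_ne hx with hlt | hgt
  · rw [if_neg (not_lt.2 hlt.le)]
    refine squeeze_zero' (Eventually.of_forall fun _ => measureReal_nonneg) ?_
      (tendsto_gammaMeasure_abs_ge (sub_pos.2 hlt))
    filter_upwards [eventually_gt_atTop 0] with K hK
    have hK' : (0 : ℝ) < K := by exact_mod_cast hK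
    have := isProbabilityMeasure_gammaMeasure hK' hK'
    refine measureReal_mono fun y hy => ?_
    have hy' : y < x := hy
    show 1 - x ≤ |y - 1|
    rw [abs_sub_comm]
    exact (by linarith : 1 - x ≤ 1 - y).trans (le_abs_self _)
  · rw [if_pos hgt]
    have h1 := (tendsto_gammaMeasure_abs_ge (sub_pos.2 hgt)).const_sub 1
    rw [sub_zero] at h1
    refine tendsto_of_tendsto_of_tendsto_of_le_of_le' h1 tendsto_const_nhds ?_ ?_
    · filter_upwards [eventually_gt_atTop 0] with K hK
      have hK' : (0 : ℝ) < K := by exact_mod_cast hK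
      have := isProbabilityMeasure_gammaMeasure hK' hK'
      have h2 := measureReal_compl (μ := gammaMeasure K K) (measurableSet_Iio (a := x))
      rw [probReal_univ] at h2
      have h3 : (gammaMeasure K K).real (Set.Iio x)ᶜ ≤ (gammaMeasure K K).real {y | x - 1 ≤ |y - 1|} := by
        refine measureReal_mono fun y hy => ?_
        have hy' : x ≤ y := not_lt.1 hy
        exact (by linarith : x - 1 ≤ y - 1).trans (le_abs_self _)
      linarith
    · filter_upwards [eventually_gt_atTop 0] with K hK
      have hK' : (0 : ℝ) < K := by exact_mod_cast hK
      have := isProbabilityMeasure_gammaMeasure hK' hK'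
      exact measureReal_le_one

/-! ### The smoothed threshold -/

lemma aemeasurable_measure_Iio {Ω : Type*} [MeasurableSpace Ω] {P : Measure Ω} {Y : Ω → ℝ}
    (hY : AEMeasurable Y P) (μ : Measure ℝ) : AEMeasurable (fun ω => μ (Set.Iio (Y ω))) P :=
  (Monotone.measurable fun _ _ hxy => measure_mono (Set.Iio_subset_Iio hxy)).comp_aemeasurable hY

/-- The probability that a random variable exceeds an independent one, as an average of the
distribution function of the latter. -/
lemma measureReal_prod_mul_lt {Ω : Type*} [MeasurableSpace Ω] {P : Measure Ω} [IsProbabilityMeasure P]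
    {Y : Ω → ℝ} (hY : AEMeasurable Y P) (μ : Measure ℝ) [IsProbabilityMeasure μ] {θ : ℝ} (hθ : 0 < θ) :
    (P.prod μ).real {q : Ω × ℝ | θ * q.2 < Y q.1} = ∫ ω, μ.real (Set.Iio (Y ω / θ)) ∂P := by
  obtain ⟨Z, hZ, hYZ⟩ := hY
  have h1 : (P.prod μ) {q : Ω × ℝ | θ * q.2 < Y q.1} = (P.prod μ) {q : Ω × ℝ | θ * q.2 < Z q.1} := by
    refine measure_congr ?_
    filter_upwards [Measure.quasiMeasurePreserving_fst.ae hYZ] with q hq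
    refine propext ?_
    show θ * q.2 < Y q.1 ↔ θ * q.2 < Z q.1
    rw [hq]
  have h2 : MeasurableSet {q : Ω × ℝ | θ * q.2 < Z q.1} :=
    measurableSet_lt (measurable_const.mul measurable_snd) (hZ.comp measurable_fst)
  have h3 : ∫ ω, μ.real (Set.Iio (Y ω / θ)) ∂P = ∫ ω, (μ (Set.Iio (Z ω / θ))).toReal ∂P := by
    refine integral_congr_ae ?_
    filter_upwards [hYZ] with ω hω
    rw [hω, Measure.real]
  rw [Measure.real, h1, Measure.prod_apply h2, h3,
    integral_toReal (aemeasurable_measure_Iio (hZ.div_const θ).aemeasurable μ)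
      (Eventually.of_forall fun _ => measure_lt_top _ _)]
  congr 1
  refine lintegral_congr fun ω => ?_
  congr 1
  ext y
  simp [lt_div_iff₀ hθ, mul_comm]

/-! ### The `K`-term approximation for colluding eavesdroppers. -/

section Colluding

variable {Ω : Type*} [MeasurableSpace Ω] {P : Measure Ω} {p : Params}
  {g : ℕ → Ω → Fin p.nT → ℂ}
  {X : ℕ → ℕ → Ω → EuclideanSpace ℝ (Fin 2)}
  {h : ℕ → ℕ → Ω → Fin p.nT → ℂ}
  {G : ℕ → Ω → Matrix (Fin p.nT) (Fin (p.nT - 1)) ℂ}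
  [IsProbabilityMeasure P]

lemma integrable_exp_neg_wiretapSinr (henv : IsEnvironment P p g X h G) (t : ℕ) {s : ℝ} (hs : 0 ≤ s) :
    Integrable (fun ω => Real.exp (-s * wiretapSinr p g X h G .ce t ω)) P := by
  have hm := aemeasurable_wiretapSinr_ce henv t
  refine Integrable.of_bound (C := 1) (AEMeasurable.aestronglyMeasurable (by fun_prop)) ?_
  filter_upwards [ae_wiretapSinr_ce_nonneg henv t] with ω hω
  rw [Real.norm_of_nonneg (Real.exp_pos _).le, Real.exp_le_one_iff, neg_mul, neg_nonpos]
  positivity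

/-- Expand the power by the binomial theorem; each `e^{-kφγ/θ}` averages to a value of the Laplace
transform. -/
theorem ccdfCE_eq_integral (henv : IsEnvironment P p g X h G) (t : ℕ) {K : ℕ} (hK : 1 ≤ K) :
    ccdfCE p K (theta p) =
      ∫ ω, (1 - Real.exp (-varphi K * (wiretapSinr p g X h G .ce t ω / theta p))) ^ K ∂P := by
  have hθ := theta_pos p
  have hφ := varphi_pos hK
  have h1 : ∀ ω, (1 - Real.exp (-varphi K * (wiretapSinr p g X h G .ce t ω / theta p))) ^ K =
      ∑ k ∈ Finset.range (K + 1), (K.choose k : ℝ) * (-1) ^ k *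
        Real.exp (-((k : ℝ) * varphi K / theta p) * wiretapSinr p g X h G .ce t ω) := by
    intro ω
    rw [sub_eq_neg_add, add_pow]
    refine Finset.sum_congr rfl fun k _ => ?_
    rw [one_pow, mul_one, neg_eq_neg_one_mul (Real.exp _), mul_pow, ← Real.exp_nat_mul]
    rw [show (k : ℝ) * (-varphi K * (wiretapSinr p g X h G .ce t ω / theta p)) =
      -((k : ℝ) * varphi K / theta p) * wiretapSinr p g X h G .ce t ω by ring]
    ring
  have hs : ∀ k : ℕ, 0 ≤ (k : ℝ) * varphi K / theta p := fun k => by positivity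
  simp_rw [h1]
  rw [integral_finsetSum _ fun k _ => (integrable_exp_neg_wiretapSinr henv t (hs k)).const_mul _, ccdfCE]
  refine Finset.sum_congr rfl fun k _ => ?_
  rw [integral_const_mul, integral_exp_neg_wiretapSinr henv t (hs k)]

lemma prConf_mem_Icc (henv : IsEnvironment P p g X h G) : prConf p ∈ Set.Icc (0 : ℝ) 1 := by
  rw [← measureReal_confSlot henv 0]
  exact ⟨measureReal_nonneg, measureReal_le_one⟩

lemma smoothedFailProb_eq (henv : IsEnvironment P p g X h G) (t : ℕ) {K : ℕ} (hK : 1 ≤ K) :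
    smoothedFailProb P p g X h G K t = prConf p *
      (1 - ∫ ω, (gammaMeasure K K).real (Set.Iio (wiretapSinr p g X h G .ce t ω / theta p)) ∂P) +
        (1 - prConf p) := by
  have hK' : (0 : ℝ) < K := by exact_mod_cast hK
  have := isProbabilityMeasure_gammaMeasure hK' hK'
  rw [smoothedFailProb, measureReal_prod_mul_lt (aemeasurable_wiretapSinr_ce henv t) _ (theta_pos p),
    measureReal_compl (measurableSet_confSlot henv t), probReal_univ, measureReal_confSlot henv t]

lemma mix_mem_Icc {q x : ℝ} (hq : q ∈ Set.Icc (0 : ℝ) 1) (hx : x ∈ Set.Icc (0 : ℝ) 1) :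
    q * (1 - x) + (1 - q) ∈ Set.Icc (0 : ℝ) 1 := by
  obtain ⟨hq0, hq1⟩ := hq
  obtain ⟨hx0, hx1⟩ := hx
  constructor <;> nlinarith

lemma integral_mem_Icc {f : Ω → ℝ} (h0 : ∀ᵐ ω ∂P, 0 ≤ f ω) (h1 : ∀ᵐ ω ∂P, f ω ≤ 1) :
    ∫ ω, f ω ∂P ∈ Set.Icc (0 : ℝ) 1 := by
  refine ⟨integral_nonneg_of_ae h0, ?_⟩
  have h2 := integral_mono_of_nonneg h0 (integrable_const (1 : ℝ)) h1
  simpa using h2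

lemma one_sub_exp_mem_Icc {K : ℕ} (hK : 1 ≤ K) {x : ℝ} (hx : 0 ≤ x) :
    (1 - Real.exp (-varphi K * x)) ^ K ∈ Set.Icc (0 : ℝ) 1 := by
  have hφ := varphi_pos hK
  have h1 : Real.exp (-varphi K * x) ≤ 1 := by
    rw [Real.exp_le_one_iff, neg_mul, neg_nonpos]
    positivity
  have h2 := Real.exp_pos (-varphi K * x)
  exact ⟨pow_nonneg (by linarith) _, pow_le_one₀ (by linarith) (by linarith)⟩

/-- Not visible from the alternating sum, but clear from its integral form. Monotonicity of
`negBinomCdf` is only available on `[0, 1]`. -/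
lemma ccdfCE_mem_Icc (henv : IsEnvironment P p g X h G) {K : ℕ} (hK : 1 ≤ K) :
    ccdfCE p K (theta p) ∈ Set.Icc (0 : ℝ) 1 := by
  have hθ := theta_pos p
  have h1 : ∀ᵐ ω ∂P, (1 - Real.exp (-varphi K * (wiretapSinr p g X h G .ce 0 ω / theta p))) ^ K ∈
      Set.Icc (0 : ℝ) 1 := by
    filter_upwards [ae_wiretapSinr_ce_nonneg henv 0] with ω hω
    exact one_sub_exp_mem_Icc hK (by positivity)
  rw [ccdfCE_eq_integral henv 0 hK]
  exact integral_mem_Icc (h1.mono fun _ h => h.1) (h1.mono fun _ h => h.2)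

lemma measureReal_gammaMeasure_mem_Icc {K : ℕ} (hK : 1 ≤ K) (A : Set ℝ) :
    (gammaMeasure K K).real A ∈ Set.Icc (0 : ℝ) 1 := by
  have hK' : (0 : ℝ) < K := by exact_mod_cast hK
  have := isProbabilityMeasure_gammaMeasure hK' hK'
  exact ⟨measureReal_nonneg, measureReal_le_one⟩

lemma smoothedFailProb_mem_Icc (henv : IsEnvironment P p g X h G) (t : ℕ) {K : ℕ} (hK : 1 ≤ K) :
    smoothedFailProb P p g X h G K t ∈ Set.Icc (0 : ℝ) 1 := by
  rw [smoothedFailProb_eq henv t hK]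
  exact mix_mem_Icc (prConf_mem_Icc henv) (integral_mem_Icc
    (Eventually.of_forall fun _ => (measureReal_gammaMeasure_mem_Icc hK _).1)
    (Eventually.of_forall fun _ => (measureReal_gammaMeasure_mem_Icc hK _).2))

/-- Alzer's inequality at `x = γ/θ`, averaged over `γ`. -/
theorem smoothedFailProb_le_LambdaCE (henv : IsEnvironment P p g X h G) (t : ℕ) {K : ℕ} (hK : 1 ≤ K) :
    smoothedFailProb P p g X h G K t ≤ LambdaCE p K := by
  have hθ := theta_pos p
  have hm := aemeasurable_wiretapSinr_ce henv t
  have hnn := ae_wiretapSinr_ce_nonneg henv t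
  have hK' : (0 : ℝ) < K := by exact_mod_cast hK
  have := isProbabilityMeasure_gammaMeasure hK' hK'
  rw [smoothedFailProb_eq henv t hK, LambdaCE, ccdfCE_eq_integral henv t hK]
  have hint : Integrable (fun ω => (gammaMeasure K K).real
      (Set.Iio (wiretapSinr p g X h G .ce t ω / theta p))) P := by
    refine Integrable.of_bound (C := 1)
      (aemeasurable_measure_Iio (hm.div_const _) _).ennreal_toReal.aestronglyMeasurable
      (Eventually.of_forall fun ω => ?_)
    rw [Real.norm_of_nonneg measureReal_nonneg]
    exact measureReal_le_one
  have hle : ∫ ω, (1 - Real.exp (-varphi K * (wiretapSinr p g X h G .ce t ω / theta p))) ^ K ∂P ≤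
      ∫ ω, (gammaMeasure K K).real (Set.Iio (wiretapSinr p g X h G .ce t ω / theta p)) ∂P := by
    refine integral_mono_of_nonneg ?_ hint ?_
    · filter_upwards [hnn] with ω hω
      exact (one_sub_exp_mem_Icc hK (by positivity)).1
    · filter_upwards [hnn] with ω hω
      rw [neg_mul]
      exact one_sub_exp_pow_le_gammaMeasure hK (by positivity)
  have := mul_le_mul_of_nonneg_left hle (prConf_mem_Icc henv).1
  linarith

/-- The Gamma distribution functions converge to a unit step away from `1`, and almost surely `γ/θ ≠
1`; dominated convergence concludes. -/
theorem tendsto_smoothedFailProb (henv : IsEnvironment P p g X h G) (t : ℕ) :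
    Tendsto (fun K => smoothedFailProb P p g X h G K t) atTop (𝓝 (failProb P p g X h G .ce t)) := by
  have hθ := theta_pos p
  have hm := aemeasurable_wiretapSinr_ce henv t
  have hset : NullMeasurableSet {ω | theta p < wiretapSinr p g X h G .ce t ω} P :=
    nullMeasurableSet_lt aemeasurable_const hm
  have hlim : Tendsto (fun K : ℕ => ∫ ω, (gammaMeasure K K).real
      (Set.Iio (wiretapSinr p g X h G .ce t ω / theta p)) ∂P) atTop
      (𝓝 (∫ ω, {ω | theta p < wiretapSinr p g X h G .ce t ω}.indicator (fun _ => (1 : ℝ)) ω ∂P)) := by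
    refine tendsto_integral_filter_of_dominated_convergence (fun _ => (1 : ℝ))
      (Eventually.of_forall fun K =>
        (aemeasurable_measure_Iio (hm.div_const _) _).ennreal_toReal.aestronglyMeasurable) ?_
      (integrable_const _) ?_
    · filter_upwards [eventually_ge_atTop 1] with K hK
      refine Eventually.of_forall fun ω => ?_
      rw [Real.norm_of_nonneg measureReal_nonneg]
      exact (measureReal_gammaMeasure_mem_Icc hK _).2
    · filter_upwards [compl_mem_ae_iff.2 (measure_wiretapSinr_ce_eq henv t (theta p))] with ω hω
      have hne : wiretapSinr p g X h G .ce t ω ≠ theta p := hω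
      have h1 := tendsto_gammaMeasure_Iio (x := wiretapSinr p g X h G .ce t ω / theta p)
        (by rwa [ne_eq, div_eq_one_iff_eq hθ.ne'])
      convert h1 using 2
      simp only [Set.indicator_apply, Set.mem_ofPred_eq, one_lt_div hθ]
  rw [integral_indicator₀ hset, setIntegral_const, smul_eq_mul, mul_one] at hlim
  rw [failProb_ce henv t t]
  refine (((hlim.const_sub 1).const_mul (prConf p)).add_const (1 - prConf p)).congr' ?_
  filter_upwards [eventually_ge_atTop 1] with K hK
  rw [smoothedFailProb_eq henv t hK]

lemma LambdaCE_mem_Icc (henv : IsEnvironment P p g X h G) {K : ℕ} (hK : 1 ≤ K) :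
    LambdaCE p K ∈ Set.Icc (0 : ℝ) 1 :=
  mix_mem_Icc (prConf_mem_Icc henv) (ccdfCE_mem_Icc henv hK)

end Colluding

end

end SecureImage

theorem proposition2 {Ω : Type*} [MeasurableSpace Ω] (P : Measure Ω) [IsProbabilityMeasure P]
    (p : Params)
    (g : ℕ → Ω → Fin p.nT → ℂ)
    (X : ℕ → ℕ → Ω → EuclideanSpace ℝ (Fin 2))
    (h : ℕ → ℕ → Ω → Fin p.nT → ℂ)
    (G : ℕ → Ω → Matrix (Fin p.nT) (Fin (p.nT - 1)) ℂ)
    (henv : IsEnvironment P p g X h G) :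
    -- the value of `Pr(Ψ₁)`; the wiretap SINRs are almost surely finite
    (∀ t, P.real (confSlot p g t) = prConf p) ∧
    (∀ t, ∀ᵐ ω ∂P, Summable fun i => eveSinr p g X h G t i ω) ∧
    -- the distribution of `T_E`, for both strategies
    (∀ (c : Strategy) (t k : ℕ),
      P.real {ω | TE p g X h G c ω ≤ k} = upsilonSum p k (failProb P p g X h G c t)) ∧
    -- non-colluding eavesdroppers: exact closed form
    (∀ t, failProb P p g X h G .nce t = LambdaNCE p) ∧
    (∀ k : ℕ, P.real {ω | TE p g X h G .nce ω ≤ k} = upsilonSum p k (LambdaNCE p)) ∧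
    -- colluding eavesdroppers: exact Laplace transform
    (∀ (t : ℕ) (s : ℝ), 0 ≤ s →
      ∫ ω, Real.exp (-s * wiretapSinr p g X h G .ce t ω) ∂P = laplaceCE p s) ∧
    -- colluding eavesdroppers: the `K`-term closed form, and the sense in which it approximates
    (∀ t K : ℕ, 1 ≤ K →
      ccdfCE p K (theta p) =
        ∫ ω, (1 - Real.exp (-varphi K * (wiretapSinr p g X h G .ce t ω / theta p))) ^ K ∂P ∧
      smoothedFailProb P p g X h G K t ≤ LambdaCE p K) ∧
    (∀ t, Tendsto (fun K => smoothedFailProb P p g X h G K t) atTop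
      (𝓝 (failProb P p g X h G .ce t))) ∧
    (∀ t k K : ℕ, 1 ≤ K →
      upsilonSum p k (LambdaCE p K) ≤ upsilonSum p k (smoothedFailProb P p g X h G K t)) ∧
    (∀ t k : ℕ, Tendsto (fun K => upsilonSum p k (smoothedFailProb P p g X h G K t)) atTop
      (𝓝 (P.real {ω | TE p g X h G .ce ω ≤ k}))) := by
  refine ⟨measureReal_confSlot henv, ae_summable_eveSinr henv, measureReal_TE_le henv, failProb_nce henv, fun k => ?_,
    fun t s hs => integral_exp_neg_wiretapSinr henv t hs,
    fun t K hK => ⟨ccdfCE_eq_integral henv t hK, smoothedFailProb_le_LambdaCE henv t hK⟩,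
    tendsto_smoothedFailProb henv, fun t k K hK => ?_, fun t k => ?_⟩
  · rw [measureReal_TE_le henv .nce 0 k, failProb_nce henv]
  · rw [upsilonSum_eq, upsilonSum_eq]
    exact negBinomCdf_antitoneOn _ _ (smoothedFailProb_mem_Icc henv t hK) (LambdaCE_mem_Icc henv hK)
      (smoothedFailProb_le_LambdaCE henv t hK)
  · rw [measureReal_TE_le henv .ce t k]
    simp_rw [upsilonSum_eq]
    exact ((continuous_negBinomCdf _ _).tendsto _).comp (tendsto_smoothedFailProb henv t)
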